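/- \textbf{Theorem.} Let $T>0$ and let $\Omega\subset\mathbb{R}^d$ be a bounded open set with Lipschitz boundary. Let $u\in L^2(\Omega\times(0,T);\mathbb{R}^d)$ and $p:\Omega\times(0,T)\to\mathbb{R}$ be such that, for all intervals $I=(a,b)$ with $0<a<b<T$ and all open sets $O$ whose closure is a compact subset of $\Omega$, $$u\in L^1(I;BV(O))\cap L^\infty(O\times I),\qquad p\in L^1(O\times I).$$ Assume that $(u,p)$ is a weak solution of the incompressible Euler equations on $\Omega$ with tangential boundary condition, that is, $$\int_0^T\!\!\int_\Omega \big(u\cdot\partial_t\Psi+(u\otimes u):\nabla\Psi+p\,\operatorname{div}\Psi\big)\,dx\,dt=0\qquad\forall\,\Psi\in C^\infty_c(\Omega\times(0,T);\mathbb{R}^d),$$ and, for a.e. $t\in(0,T)$, $\int_\Omega u(x,t)\cdot\nabla\varphi(x)\,dx=0$ for all $\varphi\in H^1(\Omega)$. For $\varepsilon>0$ set $\Omega^\varepsilon:=\{x\in\Omega:\operatorname{dist}(x,\partial\Omega)>\varepsilon\}$ and $$\varphi_\varepsilon(x):=\begin{cases}1&\text{if }x\in\Omega^{2\varepsilon},\\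 \varepsilon^{-1}\operatorname{dist}(x,\partial\Omega^\varepsilon)&\text{if }x\in\Omega^\varepsilon\setminus\Omega^{2\varepsilon},\\ 0&\text{if }x\in\Omega\setminus\Omega^\varepsilon.\end{cases}$$ Suppose that $$\liminf_{\varepsilon\to0^+}\left|\int_I\int_\Omega\Big(\frac{|u|^2}{2}+p\Big)\,u\cdot\nabla\varphi_\varepsilon\,dx\,dt\right|=0\qquad\text{for all intervals } I=(a,b),\ 0<a<b<T.$$ Then $u$ conserves the kinetic energy: with $e_u(t):=\frac12\int_\Omega|u(x,t)|^2\,dx$, $$\int_0^T e_u(t)\,\phi'(t)\,dt=0\qquad\forall\,\phi\in C^\infty_c(0,T).$$ -/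

import Mathlib

open Set Filter Topology MeasureTheory
open scoped ENNReal NNReal ContDiff

namespace EulerBounded

/-- Euclidean space `ℝ^d`. -/
abbrev Space (d : ℕ) : Type := EuclideanSpace ℝ (Fin d)

/-- The `j`-th standard basis vector of `ℝ^d`. -/
noncomputable def basisVec {d : ℕ} (j : Fin d) : Space d := EuclideanSpace.single j 1

/-- `O` is an open set which is compactly contained in `Ω`. -/
def OpenCompactlyIn {X : Type*} [TopologicalSpace X] (O Ω : Set X) : Prop :=
  IsOpen O ∧ IsCompact (closure O) ∧ closure O ⊆ Ω

/-- `φ ∈ C^∞_c(U; F)`: a smooth function whose support is a compact subset of `U`. -/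
structure IsTestFunction {X F : Type*} [NormedAddCommGroup X] [NormedSpace ℝ X]
    [NormedAddCommGroup F] [NormedSpace ℝ F] (U : Set X) (φ : X → F) : Prop where
  smooth : ContDiff ℝ ∞ φ
  hasCompactSupport : HasCompactSupport φ
  tsupport_subset : tsupport φ ⊆ U

/-- `Ω` is a bounded open set with Lipschitz boundary: near each boundary point, `Ω` is the part of
a ball lying strictly above the graph of a Lipschitz function, in Cartesian coordinates whose
vertical axis is spanned by a unit vector `ν`. The point `y - ⟪ν, y⟫ ν` is the orthogonal
projection of `y` to the hyperplane `ν^⊥`, and only the values of `ψ` on that hyperplane matter.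
(Connectedness is not required.) -/
structure IsBoundedLipschitz {d : ℕ} (Ω : Set (Space d)) : Prop where
  isOpen : IsOpen Ω
  isBounded : Bornology.IsBounded Ω
  graph : ∀ x ∈ frontier Ω, ∃ r : ℝ, 0 < r ∧ ∃ ν : Space d, ‖ν‖ = 1 ∧
    ∃ (L : ℝ≥0) (ψ : Space d → ℝ), LipschitzWith L ψ ∧
      Ω ∩ Metric.ball x r =
        {y | ψ (y - inner ℝ ν y • ν) < inner ℝ ν y} ∩ Metric.ball x r

/-- The divergence of a differentiable vector field on `ℝ^d`. -/
noncomputable def divergence {d : ℕ} (Φ : Space d → Space d) (x : Space d) : ℝ :=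
  ∑ j : Fin d, (fderiv ℝ Φ x (basisVec j)) j

/-- The total variation `|∇f|(O)` of the distributional gradient of `f : O → ℝ^d`, i.e.
`sup ∫_O ∑ᵢ fᵢ div Φᵢ` over all matrix fields `Φ ∈ C^∞_c(O; ℝ^{d×d})` with rows `Φᵢ` and
`|Φ| ≤ 1` pointwise (Euclidean norm on matrices). It is finite exactly when the distributional
gradient of `f` is a finite matrix-valued Radon measure on `O`. -/
noncomputable def totalVariation {d : ℕ} (f : Space d → Space d) (O : Set (Space d)) : ℝ≥0∞ :=
  ⨆ (Φ : Fin d → Space d → Space d) (_ : ∀ i, IsTestFunction O (Φ i))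
    (_ : ∀ x, ∑ i, ‖Φ i x‖ ^ 2 ≤ 1),
    ENNReal.ofReal (∫ x in O, ∑ i, f x i * divergence (Φ i) x)

/-- `f ∈ BV(O; ℝ^d)`. -/
def MemBV {d : ℕ} (f : Space d → Space d) (O : Set (Space d)) : Prop :=
  MemLp f 1 (volume.restrict O) ∧ totalVariation f O < ⊤

/-- `u ∈ L^1(I; BV(O; ℝ^d))`, for `u` a function of space `x` and time `t`. -/
structure MemL1BV {d : ℕ} (u : Space d → ℝ → Space d) (O : Set (Space d)) (I : Set ℝ) :
    Prop where
  aestronglyMeasurable :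
    AEStronglyMeasurable (fun z : Space d × ℝ => u z.1 z.2) (volume.restrict (O ×ˢ I))
  memBV : ∀ᵐ t ∂(volume.restrict I), MemBV (fun x => u x t) O
  norm_integrable :
    ∫⁻ t in I, (eLpNorm (fun x => u x t) 1 (volume.restrict O)
      + totalVariation (fun x => u x t) O) < ⊤

/-- `φ ∈ H^1(Ω)` with weak gradient `G ∈ L^2(Ω; ℝ^d)`. -/
structure IsH1WithGradient {d : ℕ} (Ω : Set (Space d)) (φ : Space d → ℝ)
    (G : Space d → Space d) : Prop where
  memLp : MemLp φ 2 (volume.restrict Ω)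
  memLp_gradient : MemLp G 2 (volume.restrict Ω)
  weak_gradient : ∀ η : Space d → ℝ, IsTestFunction Ω η → ∀ j : Fin d,
    ∫ x in Ω, φ x * fderiv ℝ η x (basisVec j) = -∫ x in Ω, G x j * η x

/-- `(u, p)`, with `u ∈ L^2` and `p ∈ L^1_loc`, is a weak solution in `Ω × (0,T)` of the
incompressible Euler equations `∂ₜu + div (u ⊗ u) + ∇p = 0`, `div u = 0`, with `u · n = 0` on the
boundary of `Ω`. -/
structure IsWeakEulerSolution {d : ℕ} (Ω : Set (Space d)) (T : ℝ) (u : Space d → ℝ → Space d)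
    (p : Space d → ℝ → ℝ) : Prop where
  /-- The momentum equation in the sense of distributions on `Ω × (0,T)`:
  `∬ u · ∂ₜΨ + (u ⊗ u) : ∇Ψ + p div Ψ = 0`. -/
  momentum : ∀ Ψ : Space d × ℝ → Space d, IsTestFunction (Ω ×ˢ Ioo 0 T) Ψ →
    ∫ z in Ω ×ˢ Ioo 0 T,
      (inner ℝ (u z.1 z.2) (fderiv ℝ Ψ z (0, 1))
        + inner ℝ (u z.1 z.2) (fderiv ℝ Ψ z (u z.1 z.2, 0))
        + p z.1 z.2 * ∑ j : Fin d, (fderiv ℝ Ψ z (basisVec j, 0)) j) = 0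
  /-- For almost every time `u` is divergence-free and tangent to the boundary, in the weak
  sense: it is orthogonal to the gradients of all `H^1(Ω)` functions. -/
  divFree_tangent : ∀ᵐ t ∂(volume.restrict (Ioo 0 T)),
    ∀ (φ : Space d → ℝ) (G : Space d → Space d), IsH1WithGradient Ω φ G →
      ∫ x in Ω, inner ℝ (u x t) (G x) = 0

/-- `Ω^ε = {x ∈ Ω : dist(x, ∂Ω) > ε}`. -/
def innerSet {d : ℕ} (Ω : Set (Space d)) (ε : ℝ) : Set (Space d) :=
  {x | x ∈ Ω ∧ ε < Metric.infDist x (frontier Ω)}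

open Classical in
/-- The cutoff `φ_ε`: equal to `1` on `Ω^{2ε}`, to `ε⁻¹ dist(x, ∂Ω^ε)` on `Ω^ε \ Ω^{2ε}`, and to `0`
elsewhere. It is Lipschitz, so its gradient exists almost everywhere. -/
noncomputable def cutoff {d : ℕ} (Ω : Set (Space d)) (ε : ℝ) (x : Space d) : ℝ :=
  if x ∈ innerSet Ω (2 * ε) then 1
  else if x ∈ innerSet Ω ε then ε⁻¹ * Metric.infDist x (frontier (innerSet Ω ε))
  else 0

/-- The energy flux `∫_I ∫_Ω (|u|²/2 + p) u · ∇φ_ε dx dt`. -/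
noncomputable def boundaryFlux {d : ℕ} (Ω : Set (Space d)) (I : Set ℝ)
    (u : Space d → ℝ → Space d) (p : Space d → ℝ → ℝ) (ε : ℝ) : ℝ :=
  ∫ t in I, ∫ x in Ω,
    (‖u x t‖ ^ 2 / 2 + p x t) * inner ℝ (u x t) (gradient (cutoff Ω ε) x)

/-- The kinetic energy `e_u(t) = ½ ∫_Ω |u(x,t)|² dx`. -/
noncomputable def kineticEnergy {d : ℕ} (Ω : Set (Space d)) (u : Space d → ℝ → Space d)
    (t : ℝ) : ℝ :=
  (1 / 2) * ∫ x in Ω, ‖u x t‖ ^ 2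

/-- The kinetic energy of `u ∈ L^2(Ω × (0,T))` is conserved: its distributional derivative on
`(0,T)` vanishes. -/
def KineticEnergyConserved {d : ℕ} (Ω : Set (Space d)) (T : ℝ) (u : Space d → ℝ → Space d) :
    Prop :=
  ∀ φ : ℝ → ℝ, IsTestFunction (Ioo 0 T) φ →
    ∫ t in Ioo 0 T, kineticEnergy Ω u t * deriv φ t = 0

end EulerBounded

/-! Multiplying the Euler equations by `u` formally gives `∂ₜ(|u|²/2) + div((|u|²/2 + p) u) = 0`.
The proof first establishes this balance in the interior, in the sense of distributions, and then
tests it with the cutoffs `φ_ε`.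

Interior balance. Testing the momentum equation with `φ (κ * U)`, its mollified version with `φ U`,
and subtracting yields the Duchon-Robert identity (`LocalEuler.commutator_identity`). Its left side
tends to the energy form as `κ` concentrates at the origin. Since `U` is bounded, its right side is
at most `L² ∬ |φ(x)| |∇κ(w) · (U(x) - U(x - w))|`. For a `BV` field the increment behaves like `DU
w`, so the bound becomes the integral of `∫ |∇ρ(z) · M z| dz` against `|φ| |DU|`, where `M` is the
polar direction of `DU`. A fixed kernel does not make this small. However `div u = 0` makes `M`
trace-free, and for one trace-free `M` Alberti's averaging along the volume-preserving flow
`exp(sM)` yields a kernel whose flux is as small as desired (`exists_kernelFlux_lt`). By compactness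
finitely many kernels handle all trace-free directions of bounded norm (`exists_finite_kernels`).
Since the energy form is linear in `φ`, a partition of unity allows a different kernel where the
direction differs (`LocalEuler.abs_energyForm_le_mul`).

The polar decomposition of `DU` is never formed. Instead, the gradient of a mollification of `U` is
shown to be `L¹`-close to its modulus times a fixed smooth matrix field which nearly attains the
variation (`exists_polar_approximation`). No regularity in time is needed: the kernel is a product
of a space and a time kernel, only the former is differentiated, and shifts in time are absorbed by
the continuity of translations in `L¹`.

Passage to the boundary. The balance extends to Lipschitz functions of space
(`energy_balance_lipschitz`), so the energy weighted with `φ_ε` is a primitive in time of the flux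
through the layer. These weighted energies increase to the kinetic energy as `ε` decreases to `0`.
Hence for almost all endpoints `a < b` the time-integrated flux has a genuine limit, namely the
difference of the energies at `b` and `a`; the vanishing of its lower limit then forces the two
energies to agree (`ae_eq_kineticEnergy`). -/

namespace EulerBounded

open scoped Pointwise Manifold

set_option linter.unusedSectionVars false

/-! ### Mollification on a finite-dimensional space. -/

section Mollification

variable {G : Type*} [NormedAddCommGroup G] [NormedSpace ℝ G] [FiniteDimensional ℝ G]
  [MeasureSpace G] [BorelSpace G] [(volume : Measure G).IsAddHaarMeasure]
  {F : Type*} [NormedAddCommGroup F] [NormedSpace ℝ F]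

/-- Translations are continuous in `L¹`. -/
theorem tendsto_integral_norm_translate_sub {f : G → F} (hf : Integrable f) :
    Tendsto (fun w : G => ∫ x, ‖f (x - w) - f x‖) (𝓝 0) (𝓝 0) := by
  have : Fact ((1 : ℝ≥0∞) ≤ 1) := ⟨le_rfl⟩
  -- Translations form a continuous family of measure-preserving maps, and composition with such a
  -- family is continuous in `L¹`.
  let g : G → C(G, G) := fun w => ⟨fun x => x - w, by fun_prop⟩
  have hg : Continuous g :=
    ContinuousMap.continuous_of_continuous_uncurry _
      (continuous_snd.sub continuous_fst)
  have hm : ∀ w, MeasurePreserving (g w) (volume : Measure G) volume := fun w =>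
    measurePreserving_sub_right volume w
  let f' : Lp F 1 (volume : Measure G) := (memLp_one_iff_integrable.2 hf).toLp f
  have hc := (continuous_const (y := f')).compMeasurePreservingLp hg hm ENNReal.one_ne_top
  have h1 : Tendsto (fun w => ‖Lp.compMeasurePreserving (g w) (hm w) f' -
      Lp.compMeasurePreserving (g 0) (hm 0) f'‖) (𝓝 0) (𝓝 0) := by
    have := (hc.sub (continuous_const (y := Lp.compMeasurePreserving (g 0) (hm 0) f'))).norm
    simpa using this.tendsto 0
  refine h1.congr fun w => ?_
  rw [L1.norm_eq_integral_norm]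
  refine integral_congr_ae ?_
  have e0 : (f' : G → F) =ᵐ[volume] f := MemLp.coeFn_toLp _
  have key : ∀ w, (Lp.compMeasurePreserving (g w) (hm w) f' : G → F) =ᵐ[volume]
      fun x => f (x - w) := fun w =>
    (Lp.coeFn_compMeasurePreserving f' (hm w)).trans
      ((hm w).quasiMeasurePreserving.ae_eq_comp e0)
  filter_upwards [Lp.coeFn_sub (Lp.compMeasurePreserving (g w) (hm w) f')
    (Lp.compMeasurePreserving (g 0) (hm 0) f'), key w, key 0] with x h1 h2 h3
  rw [h1, Pi.sub_apply, h2, h3, sub_zero]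

/-- The mollification `κ * f`. -/
noncomputable def moll (κ : G → ℝ) (f : G → F) (x : G) : F := ∫ y, κ (x - y) • f y

theorem moll_eq_convolution (κ : G → ℝ) (f : G → F) :
    moll κ f = convolution f κ (ContinuousLinearMap.lsmul ℝ ℝ (E := F)).flip volume := rfl

variable {κ : G → ℝ} {f : G → F}

theorem contDiff_moll (hκ : ContDiff ℝ ∞ κ) (hκc : HasCompactSupport κ)
    (hf : LocallyIntegrable f) : ContDiff ℝ ∞ (moll κ f) := by
  rw [moll_eq_convolution]
  exact hκc.contDiff_convolution_right (n := ⊤) _ hf hκ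

theorem fderiv_moll [CompleteSpace F] (hκ : ContDiff ℝ ∞ κ) (hκc : HasCompactSupport κ)
    (hf : LocallyIntegrable f) (x v : G) :
    fderiv ℝ (moll κ f) x v = ∫ y, (fderiv ℝ κ (x - y) v) • f y := by
  have h1 : ContDiff ℝ 1 κ := hκ.of_le (by exact_mod_cast le_top)
  rw [moll_eq_convolution, (hκc.hasFDerivAt_convolution_right _ hf h1 x).fderiv,
    convolution_precompR_apply _ hf (hκc.fderiv ℝ) (h1.continuous_fderiv one_ne_zero)]
  rfl

theorem moll_eq_zero {x : G} (h : ∀ w ∈ tsupport κ, f (x - w) = 0) : moll κ f x = 0 := by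
  rw [moll]
  refine integral_eq_zero_of_ae (Eventually.of_forall fun y => ?_)
  by_cases hy : x - y ∈ tsupport κ
  · have := h _ hy
    rw [sub_sub_cancel] at this
    simp [this]
  · simp [image_eq_zero_of_notMem_tsupport hy]

theorem tsupport_moll_subset (hκc : HasCompactSupport κ) (hf : HasCompactSupport f) :
    tsupport (moll κ f) ⊆ tsupport f + tsupport κ := by
  refine closure_minimal (fun x hx => ?_) (hf.isCompact.add hκc.isCompact).isClosed
  by_contra hcon
  refine hx (moll_eq_zero fun w hw => ?_)
  by_contra hne
  exact hcon ⟨x - w, subset_tsupport _ hne, w, hw, by simp⟩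

theorem hasCompactSupport_moll (hκc : HasCompactSupport κ) (hf : HasCompactSupport f) :
    HasCompactSupport (moll κ f) :=
  (hf.isCompact.add hκc.isCompact).of_isClosed_subset (isClosed_tsupport _)
    (tsupport_moll_subset hκc hf)

theorem isTestFunction_moll {W : Set G} (hκ : ContDiff ℝ ∞ κ) (hκc : HasCompactSupport κ)
    (hf : Integrable f) (hfc : HasCompactSupport f)
    (hW : ∀ x ∈ tsupport f, ∀ w ∈ tsupport κ, x + w ∈ W) : IsTestFunction W (moll κ f) where
  smooth := contDiff_moll hκ hκc hf.locallyIntegrable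
  hasCompactSupport := hasCompactSupport_moll hκc hfc
  tsupport_subset := by
    refine (tsupport_moll_subset hκc hfc).trans ?_
    rintro _ ⟨x, hx, w, hw, rfl⟩
    exact hW x hx w hw

theorem norm_moll_le {L : ℝ} (hf : ∀ x, ‖f x‖ ≤ L) (hκ0 : ∀ x, 0 ≤ κ x) (hκi : ∫ x, κ x = 1)
    (x : G) : ‖moll κ f x‖ ≤ L := by
  have hi : Integrable κ := integrable_of_integral_eq_one hκi
  calc ‖moll κ f x‖ ≤ ∫ y, κ (x - y) * L := by
        refine norm_integral_le_of_norm_le ((hi.comp_sub_left x).mul_const L) ?_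
        refine Eventually.of_forall fun y => ?_
        rw [norm_smul, Real.norm_of_nonneg (hκ0 _)]
        exact mul_le_mul_of_nonneg_left (hf y) (hκ0 _)
    _ = L := by
        rw [integral_mul_const, integral_sub_left_eq_self κ volume x, hκi, one_mul]

/-- The product `κ (x - y) f(y)` is integrable on the product space. -/
theorem integrable_kernel_smul (hκ : Integrable κ) (hf : Integrable f) :
    Integrable (fun z : G × G => κ (z.1 - z.2) • f z.2) (volume.prod volume) :=
  hf.convolution_integrand (ContinuousLinearMap.lsmul ℝ ℝ (E := F)).flip hκ

theorem integrable_moll (hκ : Integrable κ) (hf : Integrable f) : Integrable (moll κ f) :=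
  (integrable_kernel_smul hκ hf).integral_prod_left

/-- `L¹` error of mollification by a kernel concentrated near the origin. -/
theorem exists_moll_sub_le [CompleteSpace F] (hf : Integrable f) {e : ℝ} (he : 0 < e) :
    ∃ r > 0, ∀ κ : G → ℝ, Continuous κ → (∀ x, 0 ≤ κ x) → ∫ x, κ x = 1 →
      tsupport κ ⊆ Metric.ball 0 r → ∫ x, ‖moll κ f x - f x‖ ≤ e := by
  obtain ⟨r, hr, h⟩ := Metric.eventually_nhds_iff_ball.1
    ((tendsto_integral_norm_translate_sub hf).eventually (gt_mem_nhds he))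
  refine ⟨r, hr, fun κ hκ hκ0 hκ1 hs => ?_⟩
  have hκi : Integrable κ := integrable_of_integral_eq_one hκ1
  have hI : Integrable (fun z : G × G => κ z.2 • (f (z.1 - z.2) - f z.1))
      (volume.prod volume) := by
    have h1 : Integrable (fun z : G × G => κ z.2 • f z.1) (volume.prod volume) := by
      have := (hκi.smul_prod hf (μ := volume) (ν := volume)).swap
      exact this
    have h2 : Integrable (fun z : G × G => κ z.2 • f (z.1 - z.2)) (volume.prod volume) :=
      hκi.convolution_integrand (ContinuousLinearMap.lsmul ℝ ℝ (E := F)) hf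
    exact (h2.sub h1).congr (Eventually.of_forall fun z => by simp [smul_sub])
  have hpt : ∀ᵐ x, moll κ f x - f x = ∫ w, κ w • (f (x - w) - f x) := by
    filter_upwards [hI.prod_right_ae] with x hx
    have e1 : f x = ∫ w, κ w • f x := by rw [integral_smul_const, hκ1, one_smul]
    have hx1 : Integrable fun w => κ w • f x := hκi.smul_const _
    have hx2 : Integrable fun w => κ w • f (x - w) := by
      refine (hx.add hx1).congr (Eventually.of_forall fun w => ?_)
      simp only [Pi.add_apply, smul_sub, sub_add_cancel]
    have e2 : moll κ f x = ∫ w, κ w • f (x - w) := by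
      rw [moll, ← integral_sub_left_eq_self _ volume x]
      simp
    conv_lhs => rw [e2, e1]
    rw [← integral_sub hx2 hx1]
    simp only [smul_sub]
  calc ∫ x, ‖moll κ f x - f x‖ = ∫ x, ‖∫ w, κ w • (f (x - w) - f x)‖ :=
        integral_congr_ae (hpt.mono fun x hx => by simp only [hx])
    _ ≤ ∫ x, ∫ w, ‖κ w • (f (x - w) - f x)‖ :=
        integral_mono_ae hI.integral_prod_left.norm hI.norm.integral_prod_left
          (Eventually.of_forall fun x => norm_integral_le_integral_norm _)
    _ = ∫ w, ∫ x, ‖κ w • (f (x - w) - f x)‖ := integral_integral_swap hI.norm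
    _ = ∫ w, κ w * ∫ x, ‖f (x - w) - f x‖ := by
        refine integral_congr_ae (Eventually.of_forall fun w => ?_)
        simp only [norm_smul, Real.norm_of_nonneg (hκ0 w), integral_const_mul]
    _ ≤ ∫ w, κ w * e := by
        refine integral_mono_of_nonneg (Eventually.of_forall fun w => ?_) (hκi.mul_const e)
          (Eventually.of_forall fun w => ?_)
        · exact mul_nonneg (hκ0 w) (integral_nonneg fun x => norm_nonneg _)
        · by_cases hw : w ∈ tsupport κ
          · exact mul_le_mul_of_nonneg_left (h w (hs hw)).le (hκ0 w)
          · simp [image_eq_zero_of_notMem_tsupport hw]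
    _ = e := by rw [integral_mul_const, hκ1, one_mul]

end Mollification

/-! ### Local weak solutions of the Euler equations. -/

instance isAddHaarMeasure_volume_prod {d : ℕ} :
    (volume : Measure (Space d × ℝ)).IsAddHaarMeasure :=
  inferInstanceAs (Measure.IsAddHaarMeasure (volume.prod volume))

/-- A bounded velocity field `U` and an integrable pressure `q` on space-time which satisfy the
incompressible Euler equations in the sense of distributions in the set `W`. -/
structure LocalEuler {d : ℕ} (W : Set (Space d × ℝ)) (L : ℝ) (U : Space d × ℝ → Space d)
    (q : Space d × ℝ → ℝ) : Prop where
  measurable : StronglyMeasurable U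
  bound : ∀ z, ‖U z‖ ≤ L
  integrable : Integrable U
  pressure_integrable : Integrable q
  momentum : ∀ Ψ : Space d × ℝ → Space d, IsTestFunction W Ψ →
    ∫ z, (inner ℝ (U z) (fderiv ℝ Ψ z (0, 1)) + inner ℝ (U z) (fderiv ℝ Ψ z (U z, 0))
      + q z * ∑ j : Fin d, (fderiv ℝ Ψ z (basisVec j, 0)) j) = 0
  divFree : ∀ η : Space d × ℝ → ℝ, IsTestFunction W η → ∫ z, fderiv ℝ η z (U z, 0) = 0

/-! ### Algebra of test functions. -/

section TestFunctions

variable {X F : Type*} [NormedAddCommGroup X] [NormedSpace ℝ X]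
  [NormedAddCommGroup F] [NormedSpace ℝ F] {W : Set X}

theorem IsTestFunction.mono {φ : X → F} {W' : Set X} (h : IsTestFunction W φ) (hW : W ⊆ W') :
    IsTestFunction W' φ := ⟨h.smooth, h.hasCompactSupport, h.tsupport_subset.trans hW⟩

theorem IsTestFunction.smul {φ : X → ℝ} {f : X → F} (h : IsTestFunction W φ)
    (hf : ContDiff ℝ ∞ f) : IsTestFunction W (fun x => φ x • f x) where
  smooth := h.smooth.smul hf
  hasCompactSupport := h.hasCompactSupport.smul_right
  tsupport_subset := (tsupport_smul_subset_left _ _).trans h.tsupport_subset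

theorem IsTestFunction.add {φ ψ : X → F} (h : IsTestFunction W φ) (h' : IsTestFunction W ψ) :
    IsTestFunction W (fun x => φ x + ψ x) where
  smooth := h.smooth.add h'.smooth
  hasCompactSupport := h.hasCompactSupport.add h'.hasCompactSupport
  tsupport_subset := (tsupport_add _ _).trans (union_subset h.tsupport_subset h'.tsupport_subset)

theorem IsTestFunction.differentiable {φ : X → F} (h : IsTestFunction W φ) :
    Differentiable ℝ φ := h.smooth.differentiable (by simp)

theorem IsTestFunction.continuous {φ : X → F} (h : IsTestFunction W φ) :
    Continuous φ := h.smooth.continuous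

theorem IsTestFunction.continuous_fderiv {φ : X → F} (h : IsTestFunction W φ) :
    Continuous (fderiv ℝ φ) := h.smooth.continuous_fderiv (by simp)

theorem exists_norm_le_of_hasCompactSupport {φ : X → F} (h : HasCompactSupport φ)
    (hc : Continuous φ) : ∃ C, 0 ≤ C ∧ ∀ x, ‖φ x‖ ≤ C := by
  obtain ⟨C, hC⟩ := h.exists_bound_of_continuous hc
  exact ⟨max C 0, le_max_right _ _, fun x => (hC x).trans (le_max_left _ _)⟩

end TestFunctions

theorem apply_eq_sum_basisVec {d : ℕ} (A : Space d × ℝ →L[ℝ] ℝ) (v : Space d) :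
    A (v, 0) = ∑ j, v j * A (basisVec j, 0) := by
  have h : v = ∑ j, v j • basisVec j := by
    have := (EuclideanSpace.basisFun (Fin d) ℝ).sum_repr v
    simpa [basisVec] using this.symm
  have : A (v, 0) = (A.comp (ContinuousLinearMap.inl ℝ (Space d) ℝ)) v := rfl
  rw [this]
  conv_lhs => rw [h]
  simp

theorem integral_fun_add_add {X : Type*} [MeasurableSpace X] {μ : Measure X} {f g k : X → ℝ}
    (hf : Integrable f μ) (hg : Integrable g μ) (hk : Integrable k μ) :
    ∫ x, (f x + g x + k x) ∂μ = ∫ x, f x ∂μ + ∫ x, g x ∂μ + ∫ x, k x ∂μ := by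
  rw [← integral_add hf hg]
  exact integral_add (hf.add hg) hk

/-! ### The Duchon-Robert commutator identity. -/

section Commutator

variable {d : ℕ} {W : Set (Space d × ℝ)} {L : ℝ} {U : Space d × ℝ → Space d}
  {q : Space d × ℝ → ℝ} {φ κ : Space d × ℝ → ℝ}

theorem norm_pair_le {v : Space d} {s M : ℝ} (h : ‖v‖ ≤ M) (hs : |s| ≤ 1) :
    ‖(v, s)‖ ≤ M + 1 := by
  have := norm_nonneg v
  rw [Prod.norm_def]
  exact max_le (by simpa using by linarith) (by simpa using by linarith)

theorem aestronglyMeasurable_clm_apply {X E F : Type*} [MeasurableSpace X] {μ : Measure X}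
    [NormedAddCommGroup E] [NormedSpace ℝ E] [NormedAddCommGroup F] [NormedSpace ℝ F]
    {A : X → E →L[ℝ] F} {v : X → E} (hA : AEStronglyMeasurable A μ)
    (hv : AEStronglyMeasurable v μ) : AEStronglyMeasurable (fun x => A x (v x)) μ :=
  isBoundedBilinearMap_apply.continuous.comp_aestronglyMeasurable (hA.prodMk hv)

/-- The integrand of the left-hand side of the commutator identity. -/
noncomputable def commIntegrand (U : Space d × ℝ → Space d) (q φ : Space d × ℝ → ℝ)
    (x y : Space d × ℝ) : ℝ :=
  fderiv ℝ φ x (U x, 1) * inner ℝ (U x) (U y) + q x * fderiv ℝ φ x (U y, 0)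
    + q y * fderiv ℝ φ x (U x, 0)

namespace LocalEuler

theorem L_nonneg (h : LocalEuler W L U q) : 0 ≤ L := (norm_nonneg _).trans (h.bound 0)

/-- The weak divergence condition is tested with `y ↦ κ (x - y)`, which is supported in `W` under
`hx`. -/
theorem divergence_moll_eq_zero (h : LocalEuler W L U q) (hκ : ContDiff ℝ ∞ κ)
    (hκc : HasCompactSupport κ) {x : Space d × ℝ} (hx : ∀ w ∈ tsupport κ, x - w ∈ W) :
    ∑ j, (fderiv ℝ (moll κ U) x (basisVec j, 0)) j = 0 := by
  have hκ' : Continuous (fderiv ℝ κ) := hκ.continuous_fderiv (by simp)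
  obtain ⟨C, hC0, hC⟩ := exists_norm_le_of_hasCompactSupport (hκc.fderiv ℝ) hκ'
  have hint2 : ∀ v, Integrable fun y => fderiv ℝ κ (x - y) v • U y := fun v =>
    h.integrable.bdd_smul (C * ‖v‖)
      ((hκ'.comp (continuous_const.sub continuous_id)).clm_apply
        continuous_const).aestronglyMeasurable
      (Eventually.of_forall fun y => ContinuousLinearMap.le_of_opNorm_le _ (hC _) _)
  have : ∑ j, (fderiv ℝ (moll κ U) x (basisVec j, 0)) j
      = ∫ y, fderiv ℝ κ (x - y) (U y, 0) := by
    simp_rw [fderiv_moll hκ hκc h.integrable.locallyIntegrable]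
    have : ∀ j : Fin d, (∫ y, fderiv ℝ κ (x - y) (basisVec j, 0) • U y) j
        = ∫ y, fderiv ℝ κ (x - y) (basisVec j, 0) * U y j := fun j => by
      have := ((EuclideanSpace.proj j : Space d →L[ℝ] ℝ).integral_comp_comm
        (hint2 (basisVec j, 0))).symm
      simpa using this
    simp_rw [this]
    rw [← integral_finsetSum]
    · refine integral_congr_ae (Eventually.of_forall fun y => ?_)
      simp only
      rw [apply_eq_sum_basisVec]
      exact Finset.sum_congr rfl fun j _ => mul_comm _ _
    · intro j _
      have := (EuclideanSpace.proj j : Space d →L[ℝ] ℝ).integrable_comp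
        (hint2 (basisVec j, 0))
      simpa using this
  have hη : IsTestFunction W fun y => κ (x - y) := by
    refine ⟨hκ.comp (contDiff_const.sub contDiff_id),
      hκc.comp_homeomorph (Homeomorph.subLeft x), ?_⟩
    have : tsupport (fun y => κ (x - y)) ⊆ (fun y => x - y) ⁻¹' tsupport κ :=
      tsupport_comp_subset_preimage κ (continuous_const.sub continuous_id)
    intro y hy
    simpa using hx _ (this hy)
  have hz := h.divFree _ hη
  have hder : ∀ y v, fderiv ℝ (fun y => κ (x - y)) y v = - fderiv ℝ κ (x - y) v := by
    intro y v
    have := (((hκ.differentiable (by simp)) (x - y)).hasFDerivAt.comp y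
      ((hasFDerivAt_id y).const_sub x)).fderiv
    simp only [Function.comp_def] at this
    rw [this]
    simp
  simp_rw [hder, integral_neg] at hz
  rw [this, neg_eq_zero.1 hz]

variable (h : LocalEuler W L U q) (hφ : IsTestFunction W φ)
  (hκ : ContDiff ℝ ∞ κ) (hκc : HasCompactSupport κ)
include h hφ hκ hκc

/-- The field `f` stands for `(U x, 1)` or `(U y, 1)`. Both terms must be integrable on the product
space before they can be subtracted. -/
theorem integrable_kernel_fderiv (f : Space d × ℝ → Space d × ℝ → Space d × ℝ)
    (hf : AEStronglyMeasurable (fun z : (Space d × ℝ) × (Space d × ℝ) => f z.1 z.2)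
      (volume.prod volume)) (hfL : ∀ x y, ‖f x y‖ ≤ 2 * L + 1) :
    Integrable (fun z : (Space d × ℝ) × (Space d × ℝ) =>
      φ z.1 * inner ℝ (U z.1) (U z.2) * fderiv ℝ κ (z.1 - z.2) (f z.1 z.2))
      (volume.prod volume) := by
  have hL := L_nonneg h
  obtain ⟨C, hC0, hC⟩ := exists_norm_le_of_hasCompactSupport (hκc.fderiv ℝ)
    (hκ.continuous_fderiv (by simp))
  have hφi : Integrable φ := hφ.continuous.integrable_of_hasCompactSupport hφ.hasCompactSupport
  have hdom := (hφi.norm.mul_prod h.integrable.norm (μ := volume) (ν := volume)).const_mul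
    (L * C * (2 * L + 1))
  refine hdom.mono' ?_ (Eventually.of_forall fun z => ?_)
  · have h1 : Continuous fun z : (Space d × ℝ) × (Space d × ℝ) => φ z.1 :=
      hφ.continuous.comp continuous_fst
    have h2 : Continuous fun z : (Space d × ℝ) × (Space d × ℝ) => fderiv ℝ κ (z.1 - z.2) :=
      (hκ.continuous_fderiv (by simp)).comp (continuous_fst.sub continuous_snd)
    have h3 := h.measurable.aestronglyMeasurable (μ := volume)
    exact (h1.aestronglyMeasurable.mul (h3.comp_fst.inner h3.comp_snd)).mul
      (aestronglyMeasurable_clm_apply h2.aestronglyMeasurable hf)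
  · rw [norm_mul, norm_mul]
    have h1 : ‖inner ℝ (U z.1) (U z.2)‖ ≤ L * ‖U z.2‖ :=
      (norm_inner_le_norm _ _).trans (mul_le_mul_of_nonneg_right (h.bound _) (norm_nonneg _))
    have h2 : ‖fderiv ℝ κ (z.1 - z.2) (f z.1 z.2)‖ ≤ C * (2 * L + 1) :=
      (ContinuousLinearMap.le_opNorm _ _).trans
        (mul_le_mul (hC _) (hfL _ _) (norm_nonneg _) hC0)
    calc _ ≤ ‖φ z.1‖ * (L * ‖U z.2‖) * (C * (2 * L + 1)) := by gcongr
      _ = _ := by ring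

theorem integrable_kernel_pressure :
    Integrable (fun z : (Space d × ℝ) × (Space d × ℝ) =>
      κ (z.1 - z.2) * (q z.2 * fderiv ℝ φ z.1 (U z.1, 0))) (volume.prod volume) := by
  have hL := L_nonneg h
  obtain ⟨C, hC0, hC⟩ := exists_norm_le_of_hasCompactSupport hκc hκ.continuous
  have hφi : Integrable (fderiv ℝ φ) := hφ.continuous_fderiv.integrable_of_hasCompactSupport
    (hφ.hasCompactSupport.fderiv ℝ)
  have hdom := (hφi.norm.mul_prod h.pressure_integrable.norm
    (μ := volume) (ν := volume)).const_mul (C * (L + 1))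
  refine hdom.mono' ?_ (Eventually.of_forall fun z => ?_)
  · have h1 : Continuous fun z : (Space d × ℝ) × (Space d × ℝ) => κ (z.1 - z.2) :=
      hκ.continuous.comp (continuous_fst.sub continuous_snd)
    have h2 : Continuous fun z : (Space d × ℝ) × (Space d × ℝ) => fderiv ℝ φ z.1 :=
      hφ.continuous_fderiv.comp continuous_fst
    have h3 := h.measurable.aestronglyMeasurable (μ := volume)
    exact h1.aestronglyMeasurable.mul (h.pressure_integrable.aestronglyMeasurable.comp_snd.mul
      (aestronglyMeasurable_clm_apply h2.aestronglyMeasurable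
        (h3.comp_fst.prodMk aestronglyMeasurable_const)))
  · rw [norm_mul, norm_mul]
    have h2 : ‖fderiv ℝ φ z.1 (U z.1, 0)‖ ≤ ‖fderiv ℝ φ z.1‖ * (L + 1) :=
      (ContinuousLinearMap.le_opNorm _ _).trans
        (mul_le_mul_of_nonneg_left (norm_pair_le (h.bound _) (by simp)) (norm_nonneg _))
    calc _ ≤ C * (‖q z.2‖ * (‖fderiv ℝ φ z.1‖ * (L + 1))) := by
          gcongr; exact hC _
      _ = _ := by ring

theorem integrable_kernel_flux :
    Integrable (fun z : (Space d × ℝ) × (Space d × ℝ) =>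
      κ (z.1 - z.2) * (fderiv ℝ φ z.1 (U z.1, 1) * inner ℝ (U z.1) (U z.2)
        + q z.1 * fderiv ℝ φ z.1 (U z.2, 0))) (volume.prod volume) := by
  have hL := L_nonneg h
  obtain ⟨C, hC0, hC⟩ := exists_norm_le_of_hasCompactSupport hκc hκ.continuous
  obtain ⟨B, hB0, hB⟩ := exists_norm_le_of_hasCompactSupport (hφ.hasCompactSupport.fderiv ℝ)
    hφ.continuous_fderiv
  have hφi : Integrable (fderiv ℝ φ) := hφ.continuous_fderiv.integrable_of_hasCompactSupport
    (hφ.hasCompactSupport.fderiv ℝ)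
  have hdom := ((hφi.norm.mul_prod h.integrable.norm
    (μ := volume) (ν := volume)).const_mul (C * ((L + 1) * L))).add
    ((h.pressure_integrable.norm.mul_prod h.integrable.norm
    (μ := volume) (ν := volume)).const_mul (C * B))
  have h1 : Continuous fun z : (Space d × ℝ) × (Space d × ℝ) => κ (z.1 - z.2) :=
    hκ.continuous.comp (continuous_fst.sub continuous_snd)
  have h2 : Continuous fun z : (Space d × ℝ) × (Space d × ℝ) => fderiv ℝ φ z.1 :=
    hφ.continuous_fderiv.comp continuous_fst
  have h3 := h.measurable.aestronglyMeasurable (μ := volume)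
  refine hdom.mono' ?_ (Eventually.of_forall fun z => ?_)
  · exact h1.aestronglyMeasurable.mul (((aestronglyMeasurable_clm_apply h2.aestronglyMeasurable
        (h3.comp_fst.prodMk aestronglyMeasurable_const)).mul (h3.comp_fst.inner h3.comp_snd)).add
      (h.pressure_integrable.aestronglyMeasurable.comp_fst.mul
      (aestronglyMeasurable_clm_apply h2.aestronglyMeasurable
        (h3.comp_snd.prodMk aestronglyMeasurable_const))))
  · rw [norm_mul]
    have e1 : ‖inner ℝ (U z.1) (U z.2)‖ ≤ L * ‖U z.2‖ :=
      (norm_inner_le_norm _ _).trans (mul_le_mul_of_nonneg_right (h.bound _) (norm_nonneg _))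
    have e2 : ‖fderiv ℝ φ z.1 (U z.1, 1)‖ ≤ ‖fderiv ℝ φ z.1‖ * (L + 1) :=
      (ContinuousLinearMap.le_opNorm _ _).trans
        (mul_le_mul_of_nonneg_left (norm_pair_le (h.bound _) (by simp)) (norm_nonneg _))
    have e3 : ‖fderiv ℝ φ z.1 (U z.2, 0)‖ ≤ B * ‖U z.2‖ := by
      refine (ContinuousLinearMap.le_opNorm _ _).trans ?_
      have : ‖(U z.2, (0 : ℝ))‖ = ‖U z.2‖ := by simp [Prod.norm_def]
      rw [this]
      exact mul_le_mul_of_nonneg_right (hB _) (norm_nonneg _)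
    calc _ ≤ C * ((‖fderiv ℝ φ z.1‖ * (L + 1)) * (L * ‖U z.2‖) + ‖q z.1‖ * (B * ‖U z.2‖)) := by
          refine mul_le_mul (hC _) ((norm_add_le _ _).trans ?_) (norm_nonneg _) hC0
          rw [norm_mul, norm_mul]
          gcongr
      _ = _ := by simp only [Pi.add_apply]; ring

/-- The momentum equation tested against `φ (κ * U)`. -/
theorem momentum_mul_moll
    (hW : ∀ x ∈ tsupport φ, ∀ w ∈ tsupport κ, x - w ∈ W) :
    ∫ x, ∫ y, (φ x * inner ℝ (U x) (U y) * fderiv ℝ κ (x - y) (U x, 1)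
      + κ (x - y) * (fderiv ℝ φ x (U x, 1) * inner ℝ (U x) (U y)
        + q x * fderiv ℝ φ x (U y, 0))) = 0 := by
  have hUl := h.integrable.locallyIntegrable
  have hκi : Integrable κ := hκ.continuous.integrable_of_hasCompactSupport hκc
  have hsm := contDiff_moll hκ hκc hUl
  have hd : Differentiable ℝ (moll κ U) := hsm.differentiable (by simp)
  have hmom := h.momentum _ (hφ.smul hsm)
  refine Eq.trans ?_ hmom
  have hint1 : ∀ x, Integrable fun y => κ (x - y) • U y := fun x =>
    h.integrable.bdd_smul (exists_norm_le_of_hasCompactSupport hκc hκ.continuous).choose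
      (hκ.continuous.comp (continuous_const.sub continuous_id)).aestronglyMeasurable
      (Eventually.of_forall fun y =>
        (exists_norm_le_of_hasCompactSupport hκc hκ.continuous).choose_spec.2 _)
  have hκ' : Continuous (fderiv ℝ κ) := hκ.continuous_fderiv (by simp)
  obtain ⟨C, hC0, hC⟩ := exists_norm_le_of_hasCompactSupport (hκc.fderiv ℝ) hκ'
  have hint2 : ∀ x v, Integrable fun y => fderiv ℝ κ (x - y) v • U y := fun x v =>
    h.integrable.bdd_smul (C * ‖v‖)
      ((hκ'.comp (continuous_const.sub continuous_id)).clm_apply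
        continuous_const).aestronglyMeasurable
      (Eventually.of_forall fun y => ContinuousLinearMap.le_of_opNorm_le _ (hC _) _)
  refine integral_congr_ae (Eventually.of_forall fun x => ?_)
  have hD : ∀ v, fderiv ℝ (fun x => φ x • moll κ U x) x v
      = φ x • fderiv ℝ (moll κ U) x v + fderiv ℝ φ x v • moll κ U x := fun v => by
    rw [fderiv_fun_smul (hφ.differentiable x) (hd x)]
    simp
  have hU : ∀ v, fderiv ℝ (moll κ U) x v = ∫ y, fderiv ℝ κ (x - y) v • U y := fun v =>
    fderiv_moll hκ hκc hUl x v
  -- On the support of `φ` the mollified field is divergence-free, so the pressure only meets `∇φ`.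
  have hdiv : φ x * ∑ j, (fderiv ℝ (moll κ U) x (basisVec j, 0)) j = 0 := by
    by_cases hx : x ∈ tsupport φ
    · rw [h.divergence_moll_eq_zero hκ hκc (hW x hx), mul_zero]
    · rw [image_eq_zero_of_notMem_tsupport hx, zero_mul]
  have hq : ∑ j, fderiv ℝ φ x (basisVec j, 0) * (moll κ U x) j
      = fderiv ℝ φ x (moll κ U x, 0) := by
    rw [apply_eq_sum_basisVec]
    exact Finset.sum_congr rfl fun j _ => mul_comm _ _
  have e1 : inner ℝ (U x) (fderiv ℝ (moll κ U) x (U x, 1))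
      = ∫ y, inner ℝ (U x) (U y) * fderiv ℝ κ (x - y) (U x, 1) := by
    rw [hU, ← integral_inner (hint2 _ _)]
    exact integral_congr_ae (Eventually.of_forall fun y => by
      simp only [inner_smul_right]; ring)
  have e2 : inner ℝ (U x) (moll κ U x) = ∫ y, κ (x - y) * inner ℝ (U x) (U y) := by
    rw [moll, ← integral_inner (hint1 _)]
    exact integral_congr_ae (Eventually.of_forall fun y => by simp only [inner_smul_right])
  have e3 : fderiv ℝ φ x (moll κ U x, 0) = ∫ y, κ (x - y) * fderiv ℝ φ x (U y, 0) := by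
    have := (((fderiv ℝ φ x).comp
      (ContinuousLinearMap.inl ℝ (Space d) ℝ)).integral_comp_comm (hint1 x)).symm
    simpa [moll] using this
  have i1 : Integrable fun y => inner ℝ (U x) (U y) * fderiv ℝ κ (x - y) (U x, 1) := by
    refine ((hint2 x (U x, 1)).const_inner (U x) (𝕜 := ℝ)).congr
      (Eventually.of_forall fun y => by simp only [inner_smul_right]; ring)
  have i2 : Integrable fun y => κ (x - y) * inner ℝ (U x) (U y) :=
    ((hint1 x).const_inner (U x) (𝕜 := ℝ)).congr
      (Eventually.of_forall fun y => by simp only [inner_smul_right])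
  have i3 : Integrable fun y => κ (x - y) * fderiv ℝ φ x (U y, 0) := by
    have := ((fderiv ℝ φ x).comp (ContinuousLinearMap.inl ℝ (Space d) ℝ)).integrable_comp (hint1 x)
    simpa using this
  have split : (U x, (1 : ℝ)) = ((0 : Space d), (1 : ℝ)) + (U x, 0) := by simp
  calc ∫ y, (φ x * inner ℝ (U x) (U y) * fderiv ℝ κ (x - y) (U x, 1)
      + κ (x - y) * (fderiv ℝ φ x (U x, 1) * inner ℝ (U x) (U y)
        + q x * fderiv ℝ φ x (U y, 0)))
      = ∫ y, (φ x * (inner ℝ (U x) (U y) * fderiv ℝ κ (x - y) (U x, 1))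
        + fderiv ℝ φ x (U x, 1) * (κ (x - y) * inner ℝ (U x) (U y))
        + q x * (κ (x - y) * fderiv ℝ φ x (U y, 0))) :=
        integral_congr_ae (Eventually.of_forall fun y => by simp only; ring)
    _ = φ x * inner ℝ (U x) (fderiv ℝ (moll κ U) x (U x, 1))
        + fderiv ℝ φ x (U x, 1) * inner ℝ (U x) (moll κ U x)
        + q x * fderiv ℝ φ x (moll κ U x, 0) := by
        rw [integral_fun_add_add (i1.const_mul _) (i2.const_mul _) (i3.const_mul _),
          integral_const_mul, integral_const_mul,
          integral_const_mul, e1, e2, e3]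
    _ = _ := by
        simp only [hD, PiLp.add_apply, PiLp.smul_apply, smul_eq_mul, inner_add_right,
          inner_smul_right, Finset.sum_add_distrib, ← Finset.mul_sum, hdiv, hq, zero_add]
        rw [split]
        simp only [map_add, inner_add_right]
        ring

/-- The mollified momentum equation tested against `φ U`. -/
theorem moll_momentum_mul (hW : ∀ x ∈ tsupport φ, ∀ w ∈ tsupport κ, x - w ∈ W) :
    ∫ y, ∫ x, (φ x * inner ℝ (U x) (U y) * fderiv ℝ κ (x - y) (U y, 1)
      - κ (x - y) * (q y * fderiv ℝ φ x (U x, 0))) = 0 := by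
  have hL := L_nonneg h
  -- The reflected kernel is the adjoint one: `κ' * (φ U)` is a smooth test field, and using it
  -- amounts to testing the mollified equation with the rough field `φ U`. No evenness of `κ` is
  -- assumed.
  set κ' : Space d × ℝ → ℝ := fun w => κ (-w) with hκ'
  have hκ's : ContDiff ℝ ∞ κ' := hκ.comp contDiff_neg
  have hκ'c : HasCompactSupport κ' := hκc.comp_homeomorph (Homeomorph.neg _)
  have hD : ∀ w v, fderiv ℝ κ' w v = - fderiv ℝ κ (-w) v := fun w v => by
    have := (((hκ.differentiable (by simp)) (-w)).hasFDerivAt.comp w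
      (hasFDerivAt_id w).neg).fderiv
    simp only [Function.comp_def] at this
    rw [hκ', this]
    simp
  set f : Space d × ℝ → Space d := fun x => φ x • U x with hf
  obtain ⟨B, hB0, hB⟩ := exists_norm_le_of_hasCompactSupport hφ.hasCompactSupport hφ.continuous
  have hfi : Integrable f := h.integrable.bdd_smul B hφ.continuous.aestronglyMeasurable
    (Eventually.of_forall hB)
  have hfc : HasCompactSupport f := hφ.hasCompactSupport.smul_right
  have hΨ : IsTestFunction W (moll κ' f) := by
    refine isTestFunction_moll hκ's hκ'c hfi hfc fun x hx w hw => ?_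
    have hx' : x ∈ tsupport φ := tsupport_smul_subset_left _ _ hx
    have hw' : -w ∈ tsupport κ := tsupport_comp_subset_preimage κ continuous_neg hw
    simpa using hW x hx' _ hw'
  have hmom := h.momentum _ hΨ
  rw [← neg_eq_zero, ← integral_neg]
  refine Eq.trans ?_ hmom
  obtain ⟨C, hC0, hC⟩ := exists_norm_le_of_hasCompactSupport (hκ'c.fderiv ℝ)
    (hκ's.continuous_fderiv (by simp))
  have hcκ' : Continuous (fderiv ℝ κ') := hκ's.continuous_fderiv (by simp)
  have hint2 : ∀ y v, Integrable fun x => fderiv ℝ κ' (y - x) v • f x := fun x v =>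
    hfi.bdd_smul (C * ‖v‖)
      ((hcκ'.comp (continuous_const.sub continuous_id)).clm_apply
        continuous_const).aestronglyMeasurable
      (Eventually.of_forall fun y => ContinuousLinearMap.le_of_opNorm_le _ (hC _) _)
  refine integral_congr_ae (Eventually.of_forall fun y => ?_)
  have hU : ∀ v, fderiv ℝ (moll κ' f) y v = ∫ x, fderiv ℝ κ' (y - x) v • f x := fun v =>
    fderiv_moll hκ's hκ'c hfi.locallyIntegrable y v
  have e1 : inner ℝ (U y) (fderiv ℝ (moll κ' f) y (U y, 1))
      = ∫ x, -(φ x * inner ℝ (U x) (U y) * fderiv ℝ κ (x - y) (U y, 1)) := by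
    rw [hU, ← integral_inner (hint2 _ _)]
    refine integral_congr_ae (Eventually.of_forall fun x => ?_)
    simp only [inner_smul_right, hD, hf, neg_sub, real_inner_comm (U x)]
    ring
  have i1 : Integrable fun x => -(φ x * inner ℝ (U x) (U y) * fderiv ℝ κ (x - y) (U y, 1)) := by
    refine ((hint2 y (U y, 1)).const_inner (U y) (𝕜 := ℝ)).congr
      (Eventually.of_forall fun x => ?_)
    simp only [inner_smul_right, hD, hf, neg_sub, real_inner_comm (U x)]
    ring
  have hη : IsTestFunction W fun x => φ x • κ (x - y) :=
    hφ.smul (hκ.comp (contDiff_id.sub contDiff_const))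
  have hder : ∀ x v, fderiv ℝ (fun x => φ x • κ (x - y)) x v
      = φ x * fderiv ℝ κ (x - y) v + κ (x - y) * fderiv ℝ φ x v := by
    intro x v
    have h1 : HasFDerivAt (fun x => κ (x - y)) (fderiv ℝ κ (x - y)) x := by
      have := (((hκ.differentiable (by simp)) (x - y)).hasFDerivAt.comp x
        ((hasFDerivAt_id x).sub_const y))
      simpa [Function.comp_def] using this
    have := ((hφ.differentiable x).hasFDerivAt.smul h1).fderiv
    rw [show (fun x => φ x • κ (x - y)) = φ • fun x => κ (x - y) from rfl, this]
    simp [mul_comm]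
  have hUb : Integrable fun x => φ x * fderiv ℝ κ (x - y) (U x, 0) := by
    have hφi : Integrable φ := hφ.continuous.integrable_of_hasCompactSupport hφ.hasCompactSupport
    refine hφi.mul_bdd (c := C * (L + 1)) ?_ (Eventually.of_forall fun x => ?_)
    · exact aestronglyMeasurable_clm_apply ((hκ.continuous_fderiv (by simp)).comp
        (continuous_id.sub continuous_const)).aestronglyMeasurable
        (h.measurable.aestronglyMeasurable.prodMk aestronglyMeasurable_const)
    · have := hD (y - x) (U x, 0)
      rw [neg_sub] at this
      rw [← norm_neg, ← this]
      exact (ContinuousLinearMap.le_of_opNorm_le _ (hC _) _).trans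
        (mul_le_mul_of_nonneg_left (norm_pair_le (h.bound _) (by simp)) hC0)
  obtain ⟨K, hK0, hK⟩ := exists_norm_le_of_hasCompactSupport hκc hκ.continuous
  have hUb' : Integrable fun x => κ (x - y) * fderiv ℝ φ x (U x, 0) := by
    have hφi : Integrable fun x => fderiv ℝ φ x (U x, 0) := by
      have hφi : Integrable (fderiv ℝ φ) := hφ.continuous_fderiv.integrable_of_hasCompactSupport
        (hφ.hasCompactSupport.fderiv ℝ)
      refine (hφi.norm.mul_const (L + 1)).mono' ?_ (Eventually.of_forall fun x => ?_)
      · exact aestronglyMeasurable_clm_apply hφ.continuous_fderiv.aestronglyMeasurable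
          (h.measurable.aestronglyMeasurable.prodMk aestronglyMeasurable_const)
      · exact (ContinuousLinearMap.le_opNorm _ _).trans
          (mul_le_mul_of_nonneg_left (norm_pair_le (h.bound _) (by simp)) (norm_nonneg _))
    exact hφi.bdd_mul (c := K) (hκ.continuous.comp
      (continuous_id.sub continuous_const)).aestronglyMeasurable
      (Eventually.of_forall fun x => hK _)
  -- The divergence condition tested with `x ↦ φ x κ (x - y)` moves the derivative from the kernel
  -- to `φ`.
  have hdf : ∫ x, φ x * fderiv ℝ κ (x - y) (U x, 0) = - ∫ x, κ (x - y) * fderiv ℝ φ x (U x, 0) := by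
    have := h.divFree _ hη
    simp_rw [hder] at this
    rw [integral_add hUb hUb'] at this
    linarith
  have e2 : ∑ j, (fderiv ℝ (moll κ' f) y (basisVec j, 0)) j
      = ∫ x, κ (x - y) * fderiv ℝ φ x (U x, 0) := by
    rw [← neg_inj, ← hdf]
    simp_rw [hU]
    have : ∀ j : Fin d, (∫ x, fderiv ℝ κ' (y - x) (basisVec j, 0) • f x) j
        = ∫ x, fderiv ℝ κ' (y - x) (basisVec j, 0) * f x j := fun j => by
      have := ((EuclideanSpace.proj j : Space d →L[ℝ] ℝ).integral_comp_comm
        (hint2 y (basisVec j, 0))).symm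
      simpa using this
    simp_rw [this]
    rw [← integral_finsetSum, ← integral_neg]
    · refine integral_congr_ae (Eventually.of_forall fun x => ?_)
      simp only [hD, hf, neg_sub, PiLp.smul_apply, smul_eq_mul]
      rw [apply_eq_sum_basisVec, Finset.mul_sum, ← Finset.sum_neg_distrib]
      exact Finset.sum_congr rfl fun j _ => by ring
    · intro j _
      have := (EuclideanSpace.proj j : Space d →L[ℝ] ℝ).integrable_comp
        (hint2 y (basisVec j, 0))
      simpa using this
  have split : (U y, (1 : ℝ)) = ((0 : Space d), (1 : ℝ)) + (U y, 0) := by simp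
  simp only
  rw [← inner_add_right, ← map_add, ← split, e1, e2, ← integral_const_mul,
    ← integral_add i1 (hUb'.const_mul _), ← integral_neg]
  exact integral_congr_ae (Eventually.of_forall fun x => by simp only; ring)

/-- The commutator identity of Duchon and Robert. -/
theorem commutator_identity (hW : ∀ x ∈ tsupport φ, ∀ w ∈ tsupport κ, x - w ∈ W) :
    ∫ x, ∫ y, κ (x - y) * commIntegrand U q φ x y
      = - ∫ x, ∫ y, φ x * inner ℝ (U x) (U y) * fderiv ℝ κ (x - y) (U x - U y, 0) := by
  have hL := L_nonneg h
  have h3 := h.measurable.aestronglyMeasurable (μ := volume)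
  have T1 := integrable_kernel_fderiv h hφ hκ hκc (fun x _ => (U x, 1))
    (h3.comp_fst.prodMk aestronglyMeasurable_const)
    (fun x y => (norm_pair_le (h.bound _) (by simp)).trans (by linarith))
  have T2 := integrable_kernel_fderiv h hφ hκ hκc (fun _ y => (U y, 1))
    (h3.comp_snd.prodMk aestronglyMeasurable_const)
    (fun x y => (norm_pair_le (h.bound _) (by simp)).trans (by linarith))
  have T3 := integrable_kernel_flux h hφ hκ hκc
  have T4 := integrable_kernel_pressure h hφ hκ hκc
  have m1 := momentum_mul_moll h hφ hκ hκc hW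
  have m2 := moll_momentum_mul h hφ hκ hκc hW
  replace m2 := (integral_prod_symm _ (T2.sub T4)).trans m2
  replace m1 := (integral_prod _ (T1.add T3)).trans m1
  -- The time components of `(U x, 1)` and `(U y, 1)` cancel, so the remainder contains no time
  -- derivative of the kernel. This is what makes spatial `BV` regularity sufficient.
  have hT : Integrable (fun z : (Space d × ℝ) × (Space d × ℝ) =>
      φ z.1 * inner ℝ (U z.1) (U z.2) * fderiv ℝ κ (z.1 - z.2) (U z.1 - U z.2, 0))
      (volume.prod volume) := by
    refine (T1.sub T2).congr (Eventually.of_forall fun z => ?_)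
    have : (U z.1 - U z.2, (0 : ℝ)) = (U z.1, 1) - (U z.2, 1) := by simp
    simp only [Pi.sub_apply]
    rw [this, map_sub]
    ring
  have hT' : Integrable (fun z : (Space d × ℝ) × (Space d × ℝ) =>
      κ (z.1 - z.2) * commIntegrand U q φ z.1 z.2) (volume.prod volume) :=
    (T3.add T4).congr (Eventually.of_forall fun z => by
      simp only [Pi.add_apply, commIntegrand]; ring)
  rw [← integral_prod _ hT', ← integral_prod _ hT, eq_neg_iff_add_eq_zero, ← integral_add hT' hT]
  refine Eq.trans ?_ ((integral_sub (T1.add T3) (T2.sub T4)).trans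
    (sub_eq_zero.2 (m1.trans m2.symm)))
  refine integral_congr_ae (Eventually.of_forall fun z => ?_)
  have : (U z.1 - U z.2, (0 : ℝ)) = (U z.1, 1) - (U z.2, 1) := by simp
  simp only [Pi.add_apply, Pi.sub_apply, commIntegrand]
  rw [this, map_sub]
  ring

end LocalEuler

end Commutator

/-! ### Alberti's kernels for trace-free linear flows. -/

section AlbertiKernel

variable {X : Type*} [NormedAddCommGroup X] [NormedSpace ℝ X] [FiniteDimensional ℝ X]

theorem differentiable_det : Differentiable ℝ fun A : X →L[ℝ] X => LinearMap.det (A : X →ₗ[ℝ] X) := by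
  classical
  let b := Module.finBasis ℝ X
  have h : ∀ A : X →L[ℝ] X, LinearMap.det (A : X →ₗ[ℝ] X) =
      ∑ σ : Equiv.Perm (Fin (Module.finrank ℝ X)), ((Equiv.Perm.sign σ : ℤ) : ℝ) *
        ∏ i, b.repr (A (b i)) (σ i) := fun A => by
    rw [← LinearMap.det_toMatrix b, Matrix.det_apply']
    simp [LinearMap.toMatrix_apply]
  simp_rw [h]
  have hl : ∀ i j, Differentiable ℝ fun A : X →L[ℝ] X => b.repr (A (b i)) j := fun i j => by
    have : (fun A : X →L[ℝ] X => b.repr (A (b i)) j) =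
      ((LinearMap.toContinuousLinearMap (b.coord j)).comp
        (ContinuousLinearMap.apply ℝ X (b i)) : (X →L[ℝ] X) →L[ℝ] ℝ) := by
      ext A; simp
    rw [this]
    exact ContinuousLinearMap.differentiable _
  refine Differentiable.fun_sum fun σ _ => (differentiable_const _).mul ?_
  have hp := fun A => HasFDerivAt.finsetProd (u := Finset.univ) (x := A)
    fun i _ => (hl i (σ i) A).hasFDerivAt
  intro A
  have := (hp A).differentiableAt
  convert this using 1

/-- Jacobi's formula at the identity, from the expansion `det (1 + t M) = 1 + t tr M + O(t²)`. -/
theorem fderiv_det_one (M : X →L[ℝ] X) :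
    fderiv ℝ (fun A : X →L[ℝ] X => LinearMap.det (A : X →ₗ[ℝ] X)) 1 M
      = LinearMap.trace ℝ X M := by
  classical
  let b := Module.finBasis ℝ X
  have h1 : HasDerivAt (fun t : ℝ => LinearMap.det ((1 + t • M : X →L[ℝ] X) : X →ₗ[ℝ] X))
      (fderiv ℝ (fun A : X →L[ℝ] X => LinearMap.det (A : X →ₗ[ℝ] X)) 1 M) 0 := by
    have hp : HasDerivAt (fun t : ℝ => 1 + t • M) M 0 := by
      simpa using ((hasDerivAt_id (0 : ℝ)).smul_const M).const_add 1
    have hd := (differentiable_det (X := X) 1).hasFDerivAt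
    have : (1 : X →L[ℝ] X) = 1 + (0 : ℝ) • M := by simp
    rw [this] at hd
    have := hd.comp_hasDerivAt (0 : ℝ) hp
    rw [zero_smul, add_zero] at this
    exact this
  have h2 : HasDerivAt (fun t : ℝ => LinearMap.det ((1 + t • M : X →L[ℝ] X) : X →ₗ[ℝ] X))
      (LinearMap.trace ℝ X M) 0 := by
    let N := LinearMap.toMatrix b b (M : X →ₗ[ℝ] X)
    have e : ∀ t : ℝ, LinearMap.det ((1 + t • M : X →L[ℝ] X) : X →ₗ[ℝ] X)
        = (1 + t • N).det := fun t => by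
      rw [← LinearMap.det_toMatrix b]
      congr 1
      rw [← LinearMap.toMatrix_one b, ← map_smul, ← map_add]
      rfl
    have e' := fun t : ℝ => (e t).trans (Matrix.det_one_add_smul t N)
    rw [funext e']
    rw [LinearMap.trace_eq_matrix_trace ℝ b]
    set P := (Matrix.det (1 + (Polynomial.X : Polynomial ℝ) • N.map Polynomial.C)).divX.divX
    have := (((hasDerivAt_const (0 : ℝ) (1 : ℝ)).add ((hasDerivAt_id (0 : ℝ)).const_mul N.trace)).add
      ((P.hasDerivAt 0).mul (hasDerivAt_pow 2 (0 : ℝ))))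
    refine (this.congr_deriv (by simp [N])).congr_of_eventuallyEq
      (Eventually.of_forall fun t => ?_)
    simp [P]
  exact h1.unique h2

theorem exp_smul_mul_exp_smul (M : X →L[ℝ] X) (s t : ℝ) :
    NormedSpace.exp (s • M) * NormedSpace.exp (t • M) = NormedSpace.exp ((s + t) • M) := by
  let _ : NormedAlgebra ℚ (X →L[ℝ] X) := NormedAlgebra.restrictScalars ℚ ℝ (X →L[ℝ] X)
  rw [add_smul, NormedSpace.exp_add_of_commute (((Commute.refl M).smul_left s).smul_right t)]

theorem exp_smul_apply_exp_smul (M : X →L[ℝ] X) (s t : ℝ) (z : X) :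
    NormedSpace.exp (s • M) (NormedSpace.exp (t • M) z) = NormedSpace.exp ((s + t) • M) z := by
  rw [← exp_smul_mul_exp_smul]
  rfl

/-- Liouville's formula: `s ↦ det (exp (s M))` is multiplicative, so its derivative everywhere is a
multiple of its derivative at `0`, which is the trace of `M`. -/
theorem det_exp_smul {M : X →L[ℝ] X} (hM : LinearMap.trace ℝ X M = 0) (s : ℝ) :
    LinearMap.det ((NormedSpace.exp (s • M) : X →L[ℝ] X) : X →ₗ[ℝ] X) = 1 := by
  set f : ℝ → ℝ := fun s => LinearMap.det ((NormedSpace.exp (s • M) : X →L[ℝ] X) : X →ₗ[ℝ] X)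
  have h0 : HasDerivAt f 0 0 := by
    have hp := hasDerivAt_exp_smul_const (𝕂 := ℝ) M 0
    have hd := (differentiable_det (X := X) (NormedSpace.exp ((0 : ℝ) • M))).hasFDerivAt
    have := hd.comp_hasDerivAt (0 : ℝ) hp
    simp only [zero_smul, NormedSpace.exp_zero, one_mul, fderiv_det_one, hM] at this
    exact this
  have hmul : ∀ s t, f (s + t) = f s * f t := fun s t => by
    simp only [f]
    rw [← exp_smul_mul_exp_smul, ← LinearMap.det_comp]
    rfl
  have hd : ∀ s, HasDerivAt f 0 s := fun s => by
    have h1 : HasDerivAt (fun t => f s * f (t - s)) 0 s := by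
      have h2 : HasDerivAt f 0 (s - s) := by simpa using h0
      simpa using (h2.comp_sub_const s s).const_mul (f s)
    have : (fun t => f s * f (t - s)) = f := by
      ext t; rw [← hmul]; congr 1; ring
    rwa [this] at h1
  have := is_const_of_deriv_eq_zero (fun s => (hd s).differentiableAt) (fun s => (hd s).deriv) s 0
  change f s = 1
  rw [this]
  simp [f]

variable [MeasureSpace X] [BorelSpace X] [(volume : Measure X).IsAddHaarMeasure]

/-- Having determinant one, the flow of a trace-free generator preserves Lebesgue measure. -/
theorem integral_comp_exp_smul {M : X →L[ℝ] X} (hM : LinearMap.trace ℝ X M = 0) (s : ℝ)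
    (g : X → ℝ) : ∫ z, g (NormedSpace.exp (s • M) z) = ∫ z, g z := by
  have hd := det_exp_smul hM s
  set A : X →L[ℝ] X := NormedSpace.exp (s • M)
  have hmap := Measure.map_linearMap_addHaar_eq_smul_addHaar (volume : Measure X)
    (f := (A : X →ₗ[ℝ] X)) (by rw [hd]; exact one_ne_zero)
  rw [hd] at hmap
  simp only [inv_one, abs_one, ENNReal.ofReal_one, one_smul] at hmap
  have hinv : ∀ (s : ℝ) x, NormedSpace.exp ((-s) • M) (NormedSpace.exp (s • M) x) = x :=
    fun s x => by rw [exp_smul_apply_exp_smul]; simp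
  let e : X ≃L[ℝ] X := ContinuousLinearEquiv.equivOfInverse A (NormedSpace.exp ((-s) • M))
    (hinv s) (fun x => by simpa using hinv (-s) x)
  have hme : MeasurableEmbedding (fun z => A z) := e.toHomeomorph.measurableEmbedding
  have : MeasurePreserving (fun z => A z) (volume : Measure X) volume := ⟨hme.measurable, hmap⟩
  exact this.integral_comp hme g

/-- The quantity `∫ |∇ρ(z) · M z| dz`. -/
noncomputable def kernelFlux (ρ : X → ℝ) (M : X →L[ℝ] X) : ℝ := ∫ z, |fderiv ℝ ρ z (M z)|

theorem contDiff_exp_smul_apply (M : X →L[ℝ] X) :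
    ContDiff ℝ ∞ fun p : ℝ × X => NormedSpace.exp (p.1 • M) p.2 := by
  have h1 : ContDiff ℝ ∞ fun p : ℝ × X => NormedSpace.exp (p.1 • M) := by
    have : ContDiff ℝ ∞ (NormedSpace.exp : (X →L[ℝ] X) → (X →L[ℝ] X)) :=
      contDiff_iff_contDiffAt.2 fun A => (NormedSpace.exp_analytic (𝕂 := ℝ) A).contDiffAt
    exact this.comp (contDiff_fst.smul contDiff_const)
  exact h1.clm_apply contDiff_snd

/-- Alberti's lemma: for a trace-free `M`, averaging along the flow of `M` produces kernels which
are almost invariant under the flow. -/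
theorem exists_kernelFlux_lt {M : X →L[ℝ] X} (hM : LinearMap.trace ℝ X M = 0) {l : ℝ}
    (hl : 0 < l) : ∃ ρ : X → ℝ, ContDiff ℝ ∞ ρ ∧ HasCompactSupport ρ ∧ ∫ z, ρ z = 1 ∧
      kernelFlux ρ M < l := by
  -- `S` is the length of the averaging window; the flux of the averaged kernel will be at most `2 /
  -- S`.
  obtain ⟨S, hS⟩ : ∃ S : ℝ, 2 / l < S := exists_gt _
  have hS0 : 0 < S := lt_trans (by positivity) hS
  let b : ContDiffBump (0 : X) := ⟨1, 2, one_pos, one_lt_two⟩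
  let ρ₀ : X → ℝ := b.normed volume
  have hρ₀ : ContDiff ℝ ∞ ρ₀ := b.contDiff_normed
  have hρ₀c : HasCompactSupport ρ₀ := b.hasCompactSupport_normed
  have hρ₀0 : ∀ x, 0 ≤ ρ₀ x := b.nonneg_normed
  have hρ₀i : Integrable ρ₀ := b.integrable_normed
  have hρ₀1 : ∫ x, ρ₀ x = 1 := b.integral_normed
  have hA := contDiff_exp_smul_apply M
  let h : ℝ × X → ℝ := fun p => ρ₀ (NormedSpace.exp (p.1 • M) p.2)
  have hh : ContDiff ℝ ∞ h := hρ₀.comp hA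
  let ρ : X → ℝ := fun z => S⁻¹ * ∫ s in (0 : ℝ)..S, h (s, z)
  -- compact support
  let K : Set X := (fun p : ℝ × X => NormedSpace.exp ((-p.1) • M) p.2) '' (Icc 0 S ×ˢ tsupport ρ₀)
  have hK : IsCompact K := by
    refine (isCompact_Icc.prod hρ₀c.isCompact).image ?_
    exact (hA.continuous.comp (continuous_fst.neg.prodMk continuous_snd))
  have hinv : ∀ (s : ℝ) z, NormedSpace.exp ((-s) • M) (NormedSpace.exp (s • M) z) = z :=
    fun s z => by rw [exp_smul_apply_exp_smul]; simp
  have hKz : ∀ s ∈ Icc 0 S, ∀ z, z ∉ K → h (s, z) = 0 := fun s hs z hz => by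
    by_contra hne
    exact hz ⟨(s, NormedSpace.exp (s • M) z), ⟨hs, subset_tsupport _ hne⟩, hinv s z⟩
  have hρK : ∀ z, z ∉ K → ρ z = 0 := fun z hz => by
    have : ∫ s in (0 : ℝ)..S, h (s, z) = 0 :=
      intervalIntegral.integral_zero_ae (Eventually.of_forall fun s hs => by
        rw [uIoc_of_le hS0.le] at hs
        exact hKz s (Ioc_subset_Icc_self hs) z hz)
    simp only [ρ, this, mul_zero]
  have hρc : HasCompactSupport ρ := HasCompactSupport.intro hK hρK
  -- smoothness
  have hρs : ContDiff ℝ ∞ ρ := by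
    -- Smoothness in the parameter `z` is obtained by writing the time integral as a convolution
    -- with the indicator of `(0, S]`, evaluated at `0`. The bump equals `1` on `[-S, 0]` and serves
    -- only to make the other factor compactly supported in time.
    let χ : ContDiffBump (0 : ℝ) := ⟨S + 1, S + 2, by linarith, by linarith⟩
    have hf : LocallyIntegrable ((Ioc 0 S).indicator fun _ => (1 : ℝ)) volume :=
      ((integrable_indicator_iff measurableSet_Ioc).2
        (integrableOn_const (by simp))).locallyIntegrable
    have hg : ContDiff ℝ ∞ fun p : X × ℝ => χ p.2 * h (-p.2, p.1) :=
      (χ.contDiff.comp contDiff_snd).mul (hh.comp (contDiff_snd.neg.prodMk contDiff_fst))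
    have key := contDiffOn_convolution_right_with_param_comp (n := ⊤) (μ := volume)
      (ContinuousLinearMap.mul ℝ ℝ) (s := univ) (v := fun _ : X => (0 : ℝ)) contDiffOn_const
      (f := (Ioc 0 S).indicator fun _ => (1 : ℝ)) (g := fun z t => χ t * h (-t, z))
      isOpen_univ χ.hasCompactSupport.isCompact
      (fun z t _ ht => by simp [image_eq_zero_of_notMem_tsupport ht]) hf hg.contDiffOn
    rw [contDiffOn_univ] at key
    have : ρ = fun z => S⁻¹ * convolution ((Ioc 0 S).indicator fun _ => (1 : ℝ))
        (fun t => χ t * h (-t, z)) (ContinuousLinearMap.mul ℝ ℝ) volume 0 := by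
      ext z
      simp only [ρ, convolution, ContinuousLinearMap.mul_apply', zero_sub, neg_neg]
      congr 1
      rw [intervalIntegral.integral_of_le hS0.le, ← integral_indicator measurableSet_Ioc]
      refine integral_congr_ae (Eventually.of_forall fun s => ?_)
      by_cases hs : s ∈ Ioc 0 S
      · have : χ (-s) = 1 := χ.one_of_mem_closedBall (by
          simp only [mem_closedBall_zero_iff, norm_neg, Real.norm_eq_abs, χ]
          rw [abs_of_pos hs.1]; linarith [hs.2])
        simp [hs, this]
      · simp [hs]
    rw [this]
    exact contDiff_const.mul key
  have hint : ∀ s, ∫ z, h (s, z) = 1 := fun s => by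
    simp only [h]
    rw [integral_comp_exp_smul hM s ρ₀, hρ₀1]
  have hρ1 : ∫ z, ρ z = 1 := by
    simp only [ρ]
    rw [integral_const_mul]
    simp_rw [intervalIntegral.integral_of_le hS0.le]
    have hprod : Integrable (Function.uncurry fun s z => h (s, z))
        ((volume.restrict (Ioc 0 S)).prod (volume : Measure X)) := by
      refine (integrable_prod_iff hh.continuous.aestronglyMeasurable).2
        ⟨Eventually.of_forall fun s => integrable_of_integral_eq_one (hint s), ?_⟩
      have : ∀ s, ∫ z, ‖h (s, z)‖ = 1 := fun s => by
        rw [← hint s]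
        exact integral_congr_ae (Eventually.of_forall fun z => Real.norm_of_nonneg (hρ₀0 _))
      simp only [this]
      exact integrable_const _
    rw [← integral_integral_swap hprod]
    simp_rw [hint]
    simp [hS0.le, hS0.ne']
  refine ⟨ρ, hρs, hρc, hρ1, ?_⟩
  -- This is the derivative of `ρ` along its own flow. Moving by time `r` shifts the averaging
  -- window from `[0, S]` to `[r, S + r]`, so only the endpoint contributions survive.
  have hder : ∀ z, fderiv ℝ ρ z (M z) = S⁻¹ * (h (S, z) - ρ₀ z) := fun z => by
    have hcurve : HasDerivAt (fun r : ℝ => NormedSpace.exp (r • M) z) (M z) 0 := by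
      have hp := hasDerivAt_exp_smul_const (𝕂 := ℝ) M 0
      have := hp.clm_apply (hasDerivAt_const (0 : ℝ) z)
      simpa using this
    have h1 : HasDerivAt (fun r : ℝ => ρ (NormedSpace.exp (r • M) z)) (fderiv ℝ ρ z (M z)) 0 := by
      have hz : HasFDerivAt ρ (fderiv ℝ ρ z) (NormedSpace.exp ((0 : ℝ) • M) z) := by
        simpa using (hρs.differentiable (by simp) z).hasFDerivAt
      exact hz.comp_hasDerivAt (0 : ℝ) hcurve
    let k : ℝ → ℝ := fun s => h (s, z)
    have hk : Continuous k := hh.continuous.comp (continuous_id.prodMk continuous_const)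
    have e : (fun r : ℝ => ρ (NormedSpace.exp (r • M) z))
        = fun r => S⁻¹ * ((∫ s in (0 : ℝ)..(S + r), k s) - ∫ s in (0 : ℝ)..r, k s) := by
      ext r
      simp only [ρ, h, exp_smul_apply_exp_smul]
      congr 1
      rw [intervalIntegral.integral_interval_sub_left (hk.intervalIntegrable _ _)
        (hk.intervalIntegrable _ _)]
      have := intervalIntegral.integral_comp_add_right (a := 0) (b := S) k r
      rw [zero_add] at this
      exact this
    have h2 : HasDerivAt (fun r : ℝ => ρ (NormedSpace.exp (r • M) z)) (S⁻¹ * (k S - k 0)) 0 := by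
      rw [e]
      have d1 : HasDerivAt (fun x => ∫ s in (0 : ℝ)..x, k s) (k S) (S + 0) := by
        rw [add_zero]
        exact intervalIntegral.integral_hasDerivAt_right (hk.intervalIntegrable _ _)
          hk.stronglyMeasurable.stronglyMeasurableAtFilter hk.continuousAt
      have d2 : HasDerivAt (fun x => ∫ s in (0 : ℝ)..x, k s) (k 0) 0 :=
        intervalIntegral.integral_hasDerivAt_right (hk.intervalIntegrable _ _)
          hk.stronglyMeasurable.stronglyMeasurableAtFilter hk.continuousAt
      exact ((d1.comp_const_add S 0).sub d2).const_mul _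
    rw [h1.unique h2]
    simp [k, h]
  calc kernelFlux ρ M = ∫ z, |S⁻¹ * (h (S, z) - ρ₀ z)| := by simp only [kernelFlux, hder]
    _ ≤ ∫ z, S⁻¹ * (h (S, z) + ρ₀ z) := by
        refine integral_mono_of_nonneg (Eventually.of_forall fun z => abs_nonneg _)
          (((integrable_of_integral_eq_one (hint S)).add hρ₀i).const_mul _)
          (Eventually.of_forall fun z => ?_)
        simp only
        rw [abs_mul, abs_of_pos (inv_pos.2 hS0)]
        refine mul_le_mul_of_nonneg_left ?_ (inv_pos.2 hS0).le
        have h1 : 0 ≤ h (S, z) := hρ₀0 _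
        have h2 := hρ₀0 z
        rw [abs_le]
        constructor <;> linarith
    _ = S⁻¹ * 2 := by
        rw [integral_const_mul, integral_add (integrable_of_integral_eq_one (hint S)) hρ₀i,
          hint, hρ₀1]
        norm_num
    _ < l := by
        rw [div_lt_iff₀ hl] at hS
        rw [inv_mul_lt_iff₀ hS0]
        exact hS

section KernelFlux

variable {ρ : X → ℝ} (hρ : ContDiff ℝ ∞ ρ) (hρc : HasCompactSupport ρ)
include hρ hρc

theorem integrable_kernelFlux (M : X →L[ℝ] X) : Integrable fun z => fderiv ℝ ρ z (M z) := by
  refine Continuous.integrable_of_hasCompactSupport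
    ((hρ.continuous_fderiv (by simp)).clm_apply M.continuous) ?_
  refine (hρc.fderiv ℝ).mono fun z hz => ?_
  simp only [Function.mem_support] at hz ⊢
  contrapose! hz
  simp [hz]

theorem integrable_norm_fderiv_mul_norm : Integrable fun z => ‖fderiv ℝ ρ z‖ * ‖z‖ :=
  Continuous.integrable_of_hasCompactSupport
    ((hρ.continuous_fderiv (by simp)).norm.mul continuous_norm) (hρc.fderiv ℝ).norm.mul_right

/-- Subadditivity yields both the Lipschitz dependence on the generator and the splitting into a
main direction and an error. -/
theorem kernelFlux_add_le (M N : X →L[ℝ] X) :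
    kernelFlux ρ (M + N) ≤ kernelFlux ρ M + kernelFlux ρ N := by
  have h1 := (integrable_kernelFlux hρ hρc M).abs
  have h2 := (integrable_kernelFlux hρ hρc N).abs
  rw [kernelFlux, kernelFlux, kernelFlux, ← integral_add h1 h2]
  refine integral_mono (integrable_kernelFlux hρ hρc (M + N)).abs (h1.add h2) fun z => ?_
  simpa using abs_add_le _ _

theorem kernelFlux_le (M : X →L[ℝ] X) :
    kernelFlux ρ M ≤ (∫ z, ‖fderiv ℝ ρ z‖ * ‖z‖) * ‖M‖ := by
  rw [kernelFlux, ← integral_mul_const]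
  refine integral_mono (integrable_kernelFlux hρ hρc M).abs
    ((integrable_norm_fderiv_mul_norm hρ hρc).mul_const _) fun z => ?_
  calc |fderiv ℝ ρ z (M z)| ≤ ‖fderiv ℝ ρ z‖ * (‖M‖ * ‖z‖) :=
        ((fderiv ℝ ρ z).le_opNorm (M z)).trans
          (mul_le_mul_of_nonneg_left (M.le_opNorm z) (norm_nonneg _))
    _ = _ := by ring

theorem continuous_kernelFlux : Continuous (kernelFlux ρ) := by
  refine (LipschitzWith.of_dist_le_mul (K := (∫ z, ‖fderiv ℝ ρ z‖ * ‖z‖).toNNReal)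
    fun M N => ?_).continuous
  have hC : 0 ≤ ∫ z, ‖fderiv ℝ ρ z‖ * ‖z‖ := by positivity
  have key : ∀ M N : X →L[ℝ] X, kernelFlux ρ M - kernelFlux ρ N
      ≤ (∫ z, ‖fderiv ℝ ρ z‖ * ‖z‖) * ‖M - N‖ := fun M N => by
    have h1 := kernelFlux_add_le hρ hρc (M - N) N
    have h2 := kernelFlux_le hρ hρc (M - N)
    rw [sub_add_cancel] at h1
    linarith
  rw [Real.dist_eq, dist_eq_norm, Real.coe_toNNReal _ hC, abs_le]
  have h1 := key M N
  have h2 := key N M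
  rw [norm_sub_rev] at h2
  constructor <;> linarith

end KernelFlux

theorem kernelFlux_smul (ρ : X → ℝ) (c : ℝ) (M : X →L[ℝ] X) :
    kernelFlux ρ (c • M) = |c| * kernelFlux ρ M := by
  simp [kernelFlux, abs_mul, integral_const_mul]

/-- Finitely many kernels are almost invariant under all trace-free flows of bounded generator. -/
theorem exists_finite_kernels (R : ℝ) {l : ℝ} (hl : 0 < l) :
    ∃ s : Set (X → ℝ), s.Finite ∧
      (∀ ρ ∈ s, ContDiff ℝ ∞ ρ ∧ HasCompactSupport ρ ∧ ∫ z, ρ z = 1) ∧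
      ∀ M : X →L[ℝ] X, ‖M‖ ≤ R → LinearMap.trace ℝ X M = 0 → ∃ ρ ∈ s, kernelFlux ρ M < l := by
  let T : (X →L[ℝ] X) →ₗ[ℝ] ℝ :=
    (LinearMap.trace ℝ X).comp (ContinuousLinearMap.coeLM ℝ)
  have hT : Continuous T := T.continuous_of_finiteDimensional
  -- For a fixed kernel the flux depends continuously on the generator, so each kernel good for one
  -- `M` is good near `M`, and finitely many cover this compact set.
  have hK : IsCompact (Metric.closedBall (0 : X →L[ℝ] X) R ∩ T ⁻¹' {0}) :=
    (isCompact_closedBall _ _).inter_right (isClosed_singleton.preimage hT)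
  let A : Set (X → ℝ) := {ρ | ContDiff ℝ ∞ ρ ∧ HasCompactSupport ρ ∧ ∫ z, ρ z = 1}
  obtain ⟨s, hsA, hs, hcov⟩ := hK.elim_finite_subcover_image (b := A)
    (c := fun ρ => {M | kernelFlux ρ M < l})
    (fun ρ hρ => isOpen_Iio.preimage (continuous_kernelFlux hρ.1 hρ.2.1)) (fun M hM => by
      obtain ⟨ρ, h1, h2, h3, h4⟩ := exists_kernelFlux_lt (M := M) hM.2 hl
      exact mem_iUnion₂.2 ⟨ρ, ⟨h1, h2, h3⟩, h4⟩)
  refine ⟨s, hs, fun ρ hρ => hsA hρ, fun M h1 h2 => ?_⟩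
  have := hcov ⟨by simpa using h1, h2⟩
  simpa using this

end AlbertiKernel

/-! ### Even mollifiers. -/

section Mollifiers

variable {G : Type*} [NormedAddCommGroup G] [NormedSpace ℝ G] [FiniteDimensional ℝ G]
  [MeasureSpace G] [BorelSpace G] [(volume : Measure G).IsAddHaarMeasure]
  {F : Type*} [NormedAddCommGroup F] [NormedSpace ℝ F]

/-- A smooth even probability density supported in the ball of radius `r`. -/
structure IsMollifier (r : ℝ) (κ : G → ℝ) : Prop where
  smooth : ContDiff ℝ ∞ κ
  hasCompactSupport : HasCompactSupport κ
  nonneg : ∀ x, 0 ≤ κ x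
  integral_eq_one : ∫ x, κ x = 1
  tsupport_subset : tsupport κ ⊆ Metric.ball 0 r
  even : ∀ x, κ (-x) = κ x

theorem exists_isMollifier {r : ℝ} (hr : 0 < r) : ∃ κ : G → ℝ, IsMollifier r κ := by
  let b : ContDiffBump (0 : G) := ⟨r / 4, r / 2, by positivity, by linarith⟩
  refine ⟨b.normed volume, b.contDiff_normed, b.hasCompactSupport_normed, b.nonneg_normed,
    b.integral_normed, ?_, b.normed_neg⟩
  rw [b.tsupport_normed_eq]
  exact Metric.closedBall_subset_ball (by simp only [b]; linarith)

theorem IsMollifier.mono {r r' : ℝ} {κ : G → ℝ} (h : IsMollifier r κ) (hr : r ≤ r') :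
    IsMollifier r' κ :=
  ⟨h.smooth, h.hasCompactSupport, h.nonneg, h.integral_eq_one,
    h.tsupport_subset.trans (Metric.ball_subset_ball hr), h.even⟩

theorem IsMollifier.integrable {r : ℝ} {κ : G → ℝ} (h : IsMollifier r κ) : Integrable κ :=
  integrable_of_integral_eq_one h.integral_eq_one

/-- Derivatives commute with mollification. -/
theorem fderiv_moll_right [CompleteSpace F] {κ : G → ℝ} {f : G → F} (hκ : Continuous κ)
    (hf : ContDiff ℝ ∞ f) (hfc : HasCompactSupport f) (x v : G) :
    fderiv ℝ (moll κ f) x v = moll κ (fun y => fderiv ℝ f y v) x := by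
  have h1 : ContDiff ℝ 1 f := hf.of_le (by exact_mod_cast le_top)
  have hl : LocallyIntegrable κ := hκ.locallyIntegrable
  have e : ∀ g : G → F, moll κ g =
      convolution κ g (ContinuousLinearMap.lsmul ℝ ℝ (E := F)) volume := fun g => by
    rw [moll_eq_convolution, convolution_flip]
  rw [e, e, (hfc.hasFDerivAt_convolution_right _ hl h1 x).fderiv,
    convolution_precompR_apply _ hl (hfc.fderiv ℝ) (h1.continuous_fderiv one_ne_zero)]

/-- A compact subset of an open set has a uniform distance to the complement. -/
theorem exists_add_mem_of_isCompact {K W : Set G} (hK : IsCompact K) (hW : IsOpen W)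
    (h : K ⊆ W) : ∃ r > 0, ∀ x ∈ K, ∀ w ∈ Metric.ball (0 : G) r, x + w ∈ W := by
  obtain ⟨r, hr, hsub⟩ := hK.exists_thickening_subset_open hW h
  refine ⟨r, hr, fun x hx w hw => hsub ?_⟩
  rw [Metric.mem_thickening_iff]
  exact ⟨x, hx, by simpa using hw⟩

end Mollifiers

/-- Real `d × d` matrices with the Frobenius norm. -/
abbrev Mat (d : ℕ) : Type := EuclideanSpace ℝ (Fin d × Fin d)

/-! ### Variation and polar approximation of mollified gradients. -/

section Gradients

variable {d : ℕ}

/-- The spatial gradient `(∂ⱼ fᵢ)` of a vector field on space-time. -/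
noncomputable def spaceGrad (f : Space d × ℝ → Space d) (z : Space d × ℝ) : Mat d :=
  WithLp.toLp 2 fun ij => (fderiv ℝ f z (basisVec ij.2, 0)) ij.1

/-- The row-wise spatial divergence of a matrix field on space-time. -/
noncomputable def matDiv (Φ : Space d × ℝ → Mat d) (z : Space d × ℝ) : Space d :=
  WithLp.toLp 2 fun i => ∑ j, (fderiv ℝ Φ z (basisVec j, 0)) (i, j)

theorem contDiff_spaceGrad {f : Space d × ℝ → Space d} (hf : ContDiff ℝ ∞ f) :
    ContDiff ℝ ∞ (spaceGrad f) := by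
  rw [contDiff_euclidean]
  intro ij
  simp only [spaceGrad]
  have h1 : ContDiff ℝ ∞ fun z => fderiv ℝ f z (basisVec ij.2, 0) :=
    (hf.fderiv_right (m := ∞) (by simp)).clm_apply contDiff_const
  exact (contDiff_euclidean.1 h1) ij.1

theorem continuous_matDiv {Φ : Space d × ℝ → Mat d} (hΦ : ContDiff ℝ ∞ Φ) :
    Continuous (matDiv Φ) := by
  refine (PiLp.continuous_toLp 2 _).comp (continuous_pi fun i => ?_)
  refine continuous_finsetSum _ fun j _ => ?_
  have h1 : Continuous fun z => fderiv ℝ Φ z (basisVec j, 0) :=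
    (hΦ.continuous_fderiv (by simp)).clm_apply continuous_const
  exact (EuclideanSpace.proj (𝕜 := ℝ) (i, j)).continuous.comp h1

theorem hasCompactSupport_matDiv {Φ : Space d × ℝ → Mat d} (hΦ : HasCompactSupport Φ) :
    HasCompactSupport (matDiv Φ) := by
  refine (hΦ.fderiv ℝ).mono fun z hz => ?_
  simp only [Function.mem_support] at hz ⊢
  contrapose! hz
  ext i
  simp [matDiv, hz]

theorem inner_eq_sum_mul {ι : Type*} [Fintype ι] (x y : EuclideanSpace ℝ ι) :
    inner ℝ x y = ∑ i, x i * y i := by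
  rw [PiLp.inner_apply]
  exact Finset.sum_congr rfl fun i _ => by simp [mul_comm]

theorem integrable_euclidean_apply {X ι : Type*} [MeasurableSpace X] {μ : Measure X} [Fintype ι]
    {f : X → EuclideanSpace ℝ ι} (hf : Integrable f μ) (i : ι) : Integrable (fun x => f x i) μ :=
  (EuclideanSpace.proj (𝕜 := ℝ) i).integrable_comp hf

theorem integral_euclidean_apply {X ι : Type*} [MeasurableSpace X] {μ : Measure X} [Fintype ι]
    {f : X → EuclideanSpace ℝ ι} (hf : Integrable f μ) (i : ι) :
    (∫ x, f x ∂μ) i = ∫ x, f x i ∂μ :=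
  ((EuclideanSpace.proj (𝕜 := ℝ) i).integral_comp_comm hf).symm

variable {L : ℝ} {U : Space d × ℝ → Space d} {r : ℝ} {κ : Space d × ℝ → ℝ}
  {W : Set (Space d × ℝ)}

/-- Duality between the gradient of a mollified field and the divergence. -/
theorem integral_inner_spaceGrad_moll (hU : Integrable U) (hκ : IsMollifier r κ)
    {Θ : Space d × ℝ → Mat d} (hΘ : Continuous Θ) (hΘc : HasCompactSupport Θ) :
    ∫ z, inner ℝ (spaceGrad (moll κ U) z) (Θ z) = - ∫ z, inner ℝ (U z) (matDiv (moll κ Θ) z) := by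
  have hΘi : Integrable Θ := hΘ.integrable_of_hasCompactSupport hΘc
  have hκ' : Continuous (fderiv ℝ κ) := hκ.smooth.continuous_fderiv (by simp)
  obtain ⟨C, hC0, hC⟩ := exists_norm_le_of_hasCompactSupport (hκ.hasCompactSupport.fderiv ℝ) hκ'
  have hint : ∀ {ι : Type} [Fintype ι] (f : Space d × ℝ → EuclideanSpace ℝ ι), Integrable f →
      ∀ x v, Integrable fun y => fderiv ℝ κ (x - y) v • f y := fun f hf x v =>
    hf.bdd_smul (C * ‖v‖) ((hκ'.comp (continuous_const.sub continuous_id)).clm_apply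
      continuous_const).aestronglyMeasurable
      (Eventually.of_forall fun y => ContinuousLinearMap.le_of_opNorm_le _ (hC _) _)
  -- Evenness of `κ` makes its derivative odd. This gives the sign of the integration by parts and
  -- lets the same kernel act on both factors.
  have hodd : ∀ x v, fderiv ℝ κ (-x) v = - fderiv ℝ κ x v := fun x v => by
    have h1 : HasFDerivAt (fun y => κ (-y)) ((fderiv ℝ κ (-x)).comp
        (-ContinuousLinearMap.id ℝ (Space d × ℝ))) x :=
      ((hκ.smooth.differentiable (by simp)) (-x)).hasFDerivAt.comp x (hasFDerivAt_id x).neg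
    have h2 : (fun y => κ (-y)) = κ := funext hκ.even
    rw [h2] at h1
    rw [h1.fderiv]
    simp
  have hprod : ∀ i j, Integrable (fun p : (Space d × ℝ) × (Space d × ℝ) =>
      Θ p.1 (i, j) * (fderiv ℝ κ (p.1 - p.2) (basisVec j, 0) * U p.2 i))
      (volume.prod volume) := fun i j => by
    have h1 := ((integrable_euclidean_apply hΘi (i, j)).mul_prod
      (integrable_euclidean_apply hU i) (μ := volume) (ν := volume)).bdd_mul
      (c := C * ‖((basisVec j : Space d), (0 : ℝ))‖)
      (f := fun p : (Space d × ℝ) × (Space d × ℝ) => fderiv ℝ κ (p.1 - p.2) (basisVec j, 0))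
      ((hκ'.comp (continuous_fst.sub continuous_snd)).clm_apply
        continuous_const).aestronglyMeasurable
      (Eventually.of_forall fun y => ContinuousLinearMap.le_of_opNorm_le _ (hC _) _)
    exact h1.congr (Eventually.of_forall fun p => by simp only; ring)
  have eL : ∀ z, inner ℝ (spaceGrad (moll κ U) z) (Θ z) = ∑ ij : Fin d × Fin d,
      ∫ y, Θ z ij * (fderiv ℝ κ (z - y) (basisVec ij.2, 0) * U y ij.1) := fun z => by
    rw [inner_eq_sum_mul]
    refine Finset.sum_congr rfl fun ij _ => ?_
    simp only [spaceGrad]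
    rw [fderiv_moll hκ.smooth hκ.hasCompactSupport hU.locallyIntegrable,
      integral_euclidean_apply (hint U hU _ _), mul_comm, ← integral_const_mul]
    rfl
  have eR : ∀ y, inner ℝ (U y) (matDiv (moll κ Θ) y) = - ∑ ij : Fin d × Fin d,
      ∫ z, Θ z ij * (fderiv ℝ κ (z - y) (basisVec ij.2, 0) * U y ij.1) := fun y => by
    rw [inner_eq_sum_mul, Fintype.sum_prod_type, ← Finset.sum_neg_distrib]
    refine Finset.sum_congr rfl fun i _ => ?_
    simp only [matDiv]
    rw [Finset.mul_sum, ← Finset.sum_neg_distrib]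
    refine Finset.sum_congr rfl fun j _ => ?_
    rw [fderiv_moll hκ.smooth hκ.hasCompactSupport hΘi.locallyIntegrable,
      integral_euclidean_apply (hint Θ hΘi _ _), ← integral_const_mul, ← integral_neg]
    refine integral_congr_ae (Eventually.of_forall fun z => ?_)
    simp only [PiLp.smul_apply, smul_eq_mul]
    rw [← neg_sub z y, hodd]
    ring
  simp_rw [eL, eR]
  rw [integral_neg, neg_neg, integral_finsetSum _ fun ij _ =>
    (hprod ij.1 ij.2).integral_prod_left, integral_finsetSum _ fun ij _ =>
    (hprod ij.1 ij.2).integral_prod_right]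
  exact Finset.sum_congr rfl fun ij _ => integral_integral_swap (hprod ij.1 ij.2)

theorem matDiv_moll (hκ : IsMollifier r κ) {Φ : Space d × ℝ → Mat d} (hΦ : IsTestFunction W Φ) :
    matDiv (moll κ Φ) = moll κ (matDiv Φ) := by
  have hd : ∀ j, Integrable fun z => fderiv ℝ Φ z (basisVec j, 0) := fun j => by
    refine Continuous.integrable_of_hasCompactSupport
      (hΦ.continuous_fderiv.clm_apply continuous_const) ?_
    refine (hΦ.hasCompactSupport.fderiv ℝ).mono fun z hz => ?_
    simp only [Function.mem_support] at hz ⊢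
    contrapose! hz
    simp [hz]
  obtain ⟨C, hC0, hC⟩ := exists_norm_le_of_hasCompactSupport hκ.hasCompactSupport
    hκ.smooth.continuous
  have hint : ∀ {ι : Type} [Fintype ι] (f : Space d × ℝ → EuclideanSpace ℝ ι), Integrable f →
      ∀ x, Integrable fun y => κ (x - y) • f y := fun f hf x =>
    hf.bdd_smul C (hκ.smooth.continuous.comp
      (continuous_const.sub continuous_id)).aestronglyMeasurable
      (Eventually.of_forall fun y => hC _)
  have hdiv : Integrable (matDiv Φ) := (continuous_matDiv hΦ.smooth).integrable_of_hasCompactSupport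
    (hasCompactSupport_matDiv hΦ.hasCompactSupport)
  ext z i
  rw [moll, integral_euclidean_apply (hint _ hdiv z)]
  simp only [matDiv, PiLp.smul_apply, smul_eq_mul, Finset.mul_sum]
  rw [integral_finsetSum]
  · refine Finset.sum_congr rfl fun j _ => ?_
    rw [fderiv_moll_right hκ.smooth.continuous hΦ.smooth hΦ.hasCompactSupport, moll,
      integral_euclidean_apply (hint _ (hd j) z)]
    rfl
  · intro j _
    exact integrable_euclidean_apply (hint _ (hd j) z) (i, j)

/-- By duality the mollifier falls on `matDiv Φ`; the error is the bound for `U` times the `L¹`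
error in mollifying a fixed continuous compactly supported field. -/
theorem exists_abs_integral_inner_spaceGrad_moll_add_le (hUm : StronglyMeasurable U)
    (hU : Integrable U)
    (hL : ∀ z, ‖U z‖ ≤ L) {Φ : Space d × ℝ → Mat d} (hΦ : IsTestFunction W Φ) {e : ℝ}
    (he : 0 < e) : ∃ r > 0, ∀ κ, IsMollifier r κ →
      |(∫ z, inner ℝ (spaceGrad (moll κ U) z) (Φ z)) + ∫ z, inner ℝ (U z) (matDiv Φ z)| ≤ e := by
  have hL0 : 0 ≤ L := (norm_nonneg _).trans (hL 0)
  have hdiv : Integrable (matDiv Φ) := (continuous_matDiv hΦ.smooth).integrable_of_hasCompactSupport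
    (hasCompactSupport_matDiv hΦ.hasCompactSupport)
  obtain ⟨r, hr, h⟩ := exists_moll_sub_le hdiv (e := e / (L + 1)) (by positivity)
  refine ⟨r, hr, fun κ hκ => ?_⟩
  have hm : Integrable (moll κ (matDiv Φ)) := integrable_moll hκ.integrable hdiv
  have hinner : ∀ f : Space d × ℝ → Space d, Integrable f →
      Integrable fun z => inner ℝ (U z) (f z) := fun f hf =>
    (hf.norm.const_mul L).mono' (hUm.aestronglyMeasurable.inner hf.aestronglyMeasurable)
      (Eventually.of_forall fun z => (norm_inner_le_norm _ _).trans
        (mul_le_mul_of_nonneg_right (hL z) (norm_nonneg _)))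
  rw [integral_inner_spaceGrad_moll hU hκ hΦ.continuous hΦ.hasCompactSupport,
    matDiv_moll hκ hΦ, ← sub_eq_neg_add, ← integral_sub (hinner _ hdiv) (hinner _ hm)]
  simp_rw [← inner_sub_right]
  calc |∫ z, inner ℝ (U z) (matDiv Φ z - moll κ (matDiv Φ) z)|
      ≤ ∫ z, L * ‖moll κ (matDiv Φ) z - matDiv Φ z‖ := by
        rw [← Real.norm_eq_abs]
        refine norm_integral_le_of_norm_le ((hm.sub hdiv).norm.const_mul L)
          (Eventually.of_forall fun z => ?_)
        rw [norm_sub_rev (moll κ (matDiv Φ) z)]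
        exact (norm_inner_le_norm _ _).trans (mul_le_mul_of_nonneg_right (hL z) (norm_nonneg _))
    _ ≤ L * (e / (L + 1)) := by
        rw [integral_const_mul]
        exact mul_le_mul_of_nonneg_left
          (h κ hκ.smooth.continuous hκ.nonneg hκ.integral_eq_one hκ.tsupport_subset) hL0
    _ ≤ e := by
        rw [mul_div_assoc', div_le_iff₀ (by positivity)]
        nlinarith

/-- `V` bounds the variation of `U` in `W`. -/
def VariationLE (U : Space d × ℝ → Space d) (W : Set (Space d × ℝ)) (V : ℝ) : Prop :=
  ∀ Φ : Space d × ℝ → Mat d, IsTestFunction W Φ → (∀ z, ‖Φ z‖ ≤ 1) →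
    ∫ z, inner ℝ (U z) (matDiv Φ z) ≤ V

theorem matDiv_neg (Φ : Space d × ℝ → Mat d) : matDiv (fun z => -Φ z) = fun z => -matDiv Φ z := by
  ext z i
  simp [matDiv, fderiv_fun_neg]

/-- The variation bound is tested with the mollification of `-χ G / |G|`, `G` being the gradient of
the mollified field. Mollifying keeps the field bounded by one and, for small radius, supported in
`W`. -/
theorem integral_mul_norm_spaceGrad_le {V : ℝ} (hV : VariationLE U W V) (hU : Integrable U)
    (hW : IsOpen W) {χ : Space d × ℝ → ℝ} (hχ : IsTestFunction W χ) (h0 : ∀ z, 0 ≤ χ z)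
    (h1 : ∀ z, χ z ≤ 1) : ∃ r > 0, ∀ κ, IsMollifier r κ →
      ∫ z, χ z * ‖spaceGrad (moll κ U) z‖ ≤ V := by
  obtain ⟨r, hr, hrW⟩ := exists_add_mem_of_isCompact hχ.hasCompactSupport.isCompact hW
    hχ.tsupport_subset
  refine ⟨r, hr, fun κ hκ => ?_⟩
  set G := spaceGrad (moll κ U)
  have hG : ContDiff ℝ ∞ G :=
    contDiff_spaceGrad (contDiff_moll hκ.smooth hκ.hasCompactSupport hU.locallyIntegrable)
  have hχi : Integrable χ := hχ.continuous.integrable_of_hasCompactSupport hχ.hasCompactSupport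
  have hχG : Integrable fun z => χ z * ‖G z‖ :=
    (hχ.continuous.mul hG.continuous.norm).integrable_of_hasCompactSupport
      hχ.hasCompactSupport.mul_right
  have key : ∀ s > 0, ∫ z, χ z * ‖G z‖ ≤ V + s * ∫ z, χ z := by
    intro s hs
    have hpos : ∀ z, 0 < ‖G z‖ ^ 2 + s ^ 2 := fun z => by positivity
    -- Replacing `|G|` by `√(|G|² + s²)` keeps the field smooth where `G` vanishes. The loss is at
    -- most `s χ`, and `s` is arbitrary.
    let Θ : Space d × ℝ → Mat d := fun z => χ z • (-(Real.sqrt (‖G z‖ ^ 2 + s ^ 2))⁻¹ • G z)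
    have hΘ : IsTestFunction W Θ := by
      have hs : ContDiff ℝ ∞ fun z => -(Real.sqrt (‖G z‖ ^ 2 + s ^ 2))⁻¹ := ((((hG.norm_sq ℝ).add contDiff_const).sqrt fun z => (hpos z).ne').inv
        fun z => (Real.sqrt_pos.2 (hpos z)).ne').neg
      exact hχ.smul (hs.smul hG)
    have hΘ1 : ∀ z, ‖Θ z‖ ≤ 1 := fun z => by
      simp only [Θ, norm_smul, norm_neg, norm_inv, Real.norm_eq_abs,
        abs_of_nonneg (Real.sqrt_nonneg _), abs_of_nonneg (h0 z)]
      have h2 : ‖G z‖ ≤ Real.sqrt (‖G z‖ ^ 2 + s ^ 2) :=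
        Real.le_sqrt_of_sq_le (by nlinarith [sq_nonneg s])
      have h3 : (Real.sqrt (‖G z‖ ^ 2 + s ^ 2))⁻¹ * ‖G z‖ ≤ 1 := by
        rw [inv_mul_le_iff₀ (Real.sqrt_pos.2 (hpos z)), mul_one]
        exact h2
      exact mul_le_one₀ (h1 z) (by positivity) h3
    have hm : IsTestFunction W (moll κ Θ) :=
      isTestFunction_moll hκ.smooth hκ.hasCompactSupport
        (hΘ.continuous.integrable_of_hasCompactSupport hΘ.hasCompactSupport)
        hΘ.hasCompactSupport fun x hx w hw =>
          hrW x (tsupport_smul_subset_left _ _ hx) w (hκ.tsupport_subset hw)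
    have hle := hV _ hm (norm_moll_le hΘ1 hκ.nonneg hκ.integral_eq_one)
    have heq := integral_inner_spaceGrad_moll hU hκ hΘ.continuous hΘ.hasCompactSupport
    have hpt : ∀ z, χ z * ‖G z‖ - s * χ z ≤ - inner ℝ (G z) (Θ z) := fun z => by
      simp only [Θ, inner_smul_right, neg_smul, inner_neg_right, real_inner_self_eq_norm_sq,
        mul_neg, neg_neg]
      have h2 : Real.sqrt (‖G z‖ ^ 2 + s ^ 2) ≤ ‖G z‖ + s :=
        Real.sqrt_le_iff.2 ⟨by positivity, by nlinarith [norm_nonneg (G z)]⟩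
      have h3 : ‖G z‖ - s ≤ (Real.sqrt (‖G z‖ ^ 2 + s ^ 2))⁻¹ * ‖G z‖ ^ 2 := by
        rw [le_inv_mul_iff₀ (Real.sqrt_pos.2 (hpos z))]
        by_cases hc : ‖G z‖ ≤ s
        · have := mul_nonneg (Real.sqrt_nonneg (‖G z‖ ^ 2 + s ^ 2)) (sub_nonneg.2 hc)
          nlinarith [sq_nonneg ‖G z‖]
        · push Not at hc
          have := mul_le_mul_of_nonneg_right h2 (sub_nonneg.2 hc.le)
          nlinarith [sq_nonneg s]
      have := mul_le_mul_of_nonneg_left h3 (h0 z)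
      linarith
    have hIΘ : Integrable fun z => inner ℝ (G z) (Θ z) :=
      (hG.continuous.inner hΘ.continuous).integrable_of_hasCompactSupport
        (hΘ.hasCompactSupport.mono fun z hz => by
          simp only [Function.mem_support] at hz ⊢
          contrapose! hz
          simp [hz])
    have := integral_mono (hχG.sub (hχi.const_mul s)) hIΘ.neg hpt
    simp only [Pi.sub_apply, Pi.neg_apply] at this
    rw [integral_sub hχG (hχi.const_mul s), integral_const_mul, integral_neg, heq, neg_neg] at this
    linarith
  have hχ0 : 0 ≤ ∫ z, χ z := integral_nonneg h0
  refine le_of_forall_pos_le_add fun e he => ?_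
  refine (key (e / ((∫ z, χ z) + 1)) (by positivity)).trans ?_
  gcongr
  rw [div_mul_eq_mul_div, div_le_iff₀ (by positivity)]
  nlinarith

/-- Since `‖P‖ ≤ 1`, expanding the square bounds it by `2 ‖A‖ (‖A‖ - ⟪A, P⟫)`; Young's inequality
with weight `e` separates the factors. If `P` nearly attains the norm of `A` on average, then `‖A‖
P` is close to `A` in `L¹`. -/
theorem norm_smul_sub_le {E : Type*} [NormedAddCommGroup E] [InnerProductSpace ℝ E] (A P : E)
    (hP : ‖P‖ ≤ 1) {e : ℝ} (he : 0 < e) :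
    ‖‖A‖ • P - A‖ ≤ e * ‖A‖ + (‖A‖ - inner ℝ A P) / (2 * e) := by
  have hin : inner ℝ A P ≤ ‖A‖ := (real_inner_le_norm _ _).trans
    (mul_le_of_le_one_right (norm_nonneg _) hP)
  have h1 : ‖‖A‖ • P - A‖ ^ 2 ≤ 2 * ‖A‖ * (‖A‖ - inner ℝ A P) := by
    rw [norm_sub_sq_real, norm_smul, inner_smul_left, real_inner_comm]
    simp only [norm_norm, conj_trivial]
    have : ‖P‖ ^ 2 ≤ 1 := pow_le_one₀ (norm_nonneg _) hP
    nlinarith [mul_le_mul_of_nonneg_left this (sq_nonneg ‖A‖)]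
  refine abs_le_of_sq_le_sq' (h1.trans ?_) ?_ |>.2
  · have h2 : (‖A‖ - inner ℝ A P) = 2 * e * ((‖A‖ - inner ℝ A P) / (2 * e)) := by
      field_simp
    set b := (‖A‖ - inner ℝ A P) / (2 * e)
    rw [h2]
    nlinarith [sq_nonneg (e * ‖A‖ - b)]
  · have : 0 ≤ (‖A‖ - inner ℝ A P) / (2 * e) := div_nonneg (by linarith) (by positivity)
    positivity

/-- The gradient of a mollified `BV` field is close to its modulus times a fixed smooth field. -/
theorem exists_polar_approximation (hUm : StronglyMeasurable U) (hU : Integrable U)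
    (hL : ∀ z, ‖U z‖ ≤ L) (hW : IsOpen W) (hV : ∃ V, VariationLE U W V) :
    ∃ V, 0 ≤ V ∧ ∀ e > 0, ∃ Φ : Space d × ℝ → Mat d, IsTestFunction W Φ ∧ (∀ z, ‖Φ z‖ ≤ 1) ∧
      ∀ χ : Space d × ℝ → ℝ, IsTestFunction W χ → (∀ z, 0 ≤ χ z) → (∀ z, χ z ≤ 1) →
        (∀ z ∈ tsupport Φ, χ z = 1) → ∃ r > 0, ∀ κ, IsMollifier r κ →
          ∫ z, χ z * ‖spaceGrad (moll κ U) z‖ ≤ V ∧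
          ∫ z, χ z * ‖‖spaceGrad (moll κ U) z‖ • Φ z - spaceGrad (moll κ U) z‖ ≤ e := by
  obtain ⟨V₀, hV₀⟩ := hV
  let S : Set ℝ := {s | ∃ Φ : Space d × ℝ → Mat d, IsTestFunction W Φ ∧ (∀ z, ‖Φ z‖ ≤ 1) ∧
    s = ∫ z, inner ℝ (U z) (matDiv Φ z)}
  have hz : IsTestFunction W (fun _ : Space d × ℝ => (0 : Mat d)) :=
    ⟨contDiff_const, HasCompactSupport.zero, by simp [tsupport]⟩
  have hS0 : (0 : ℝ) ∈ S := ⟨fun _ => 0, hz, by simp, by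
    have : matDiv (fun _ : Space d × ℝ => (0 : Mat d)) = fun _ => 0 := by
      ext z i; simp [matDiv]
    simp [this]⟩
  have hSb : BddAbove S := ⟨V₀, by rintro _ ⟨Φ, h1, h2, rfl⟩; exact hV₀ Φ h1 h2⟩
  have hVar : VariationLE U W (sSup S) := fun Φ h1 h2 => le_csSup hSb ⟨Φ, h1, h2, rfl⟩
  have hV0 : 0 ≤ sSup S := le_csSup hSb hS0
  refine ⟨sSup S, hV0, fun e he => ?_⟩
  set V := sSup S
  -- Chosen so that the final bound `t V + 2 t² / (2 t) = t (V + 1)` equals `e`. One `t²` comes from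
  -- the near-maximiser, the other from mollification.
  set t : ℝ := e / (V + 1) with ht
  have htp : 0 < t := by positivity
  obtain ⟨_, ⟨Φ', h1, h2, rfl⟩, hlt⟩ := exists_lt_of_lt_csSup ⟨0, hS0⟩
    (show V - t ^ 2 < sSup S by simp only [V]; linarith [sq_nonneg t, pow_pos htp 2])
  -- The sign is reversed because integration by parts turns `∫ ⟪U, div Φ'⟫` into minus the pairing
  -- with the gradient.
  set Φ : Space d × ℝ → Mat d := fun z => - Φ' z with hΦdef
  have hΦ : IsTestFunction W Φ := by
    have := (h1.hasCompactSupport).neg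
    refine ⟨h1.smooth.neg, this, ?_⟩
    have e1 : tsupport Φ = tsupport Φ' := by
      simp only [tsupport, hΦdef]
      congr 1
      ext z; simp
    rw [e1]; exact h1.tsupport_subset
  have hΦ1 : ∀ z, ‖Φ z‖ ≤ 1 := fun z => by simpa [hΦdef] using h2 z
  have hdiv : ∫ z, inner ℝ (U z) (matDiv Φ z) = - ∫ z, inner ℝ (U z) (matDiv Φ' z) := by
    rw [hΦdef, matDiv_neg, ← integral_neg]
    simp
  refine ⟨Φ, hΦ, hΦ1, fun χ hχ hχ0 hχ1 hχΦ => ?_⟩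
  obtain ⟨r₁, hr₁, H₁⟩ := integral_mul_norm_spaceGrad_le hVar hU hW hχ hχ0 hχ1
  obtain ⟨r₂, hr₂, H₂⟩ := exists_abs_integral_inner_spaceGrad_moll_add_le hUm hU hL hΦ
    (pow_pos htp 2)
  refine ⟨min r₁ r₂, lt_min hr₁ hr₂, fun κ hκ => ?_⟩
  have b1 := H₁ κ (hκ.mono (min_le_left _ _))
  have b2 := H₂ κ (hκ.mono (min_le_right _ _))
  refine ⟨b1, ?_⟩
  set G := spaceGrad (moll κ U)
  have hG : ContDiff ℝ ∞ G :=
    contDiff_spaceGrad (contDiff_moll hκ.smooth hκ.hasCompactSupport hU.locallyIntegrable)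
  have hχG : Integrable fun z => χ z * ‖G z‖ :=
    (hχ.continuous.mul hG.continuous.norm).integrable_of_hasCompactSupport
      hχ.hasCompactSupport.mul_right
  have hIΦ : Integrable fun z => inner ℝ (G z) (Φ z) :=
    (hG.continuous.inner hΦ.continuous).integrable_of_hasCompactSupport
      (hΦ.hasCompactSupport.mono fun z hz => by
        simp only [Function.mem_support] at hz ⊢
        contrapose! hz
        simp [hz])
  have hχΦ' : ∀ z, χ z * inner ℝ (G z) (Φ z) = inner ℝ (G z) (Φ z) := fun z => by
    by_cases hz : z ∈ tsupport Φ
    · rw [hχΦ z hz, one_mul]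
    · simp [image_eq_zero_of_notMem_tsupport hz]
  calc ∫ z, χ z * ‖‖G z‖ • Φ z - G z‖
      ≤ ∫ z, (t * (χ z * ‖G z‖) + (χ z * ‖G z‖ - inner ℝ (G z) (Φ z)) / (2 * t)) := by
        refine integral_mono_of_nonneg
          (Eventually.of_forall fun z => mul_nonneg (hχ0 z) (norm_nonneg _))
          ((hχG.const_mul t).add ((hχG.sub hIΦ).div_const _)) (Eventually.of_forall fun z => ?_)
        have := mul_le_mul_of_nonneg_left (norm_smul_sub_le (G z) (Φ z) (hΦ1 z) htp) (hχ0 z)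
        refine this.trans (le_of_eq ?_)
        simp only
        nth_rewrite 2 [← hχΦ' z]
        ring
    _ = t * (∫ z, χ z * ‖G z‖) + ((∫ z, χ z * ‖G z‖) - ∫ z, inner ℝ (G z) (Φ z)) / (2 * t) := by
        rw [← integral_sub hχG hIΦ, ← integral_div, ← integral_const_mul]
        exact integral_add (hχG.const_mul t) ((hχG.sub hIΦ).div_const _)
    _ ≤ t * V + (2 * t ^ 2) / (2 * t) := by
        gcongr
        have := (abs_le.1 b2).1
        rw [hdiv] at this
        linarith
    _ = e := by
        rw [ht]; field_simp

end Gradients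

/-! ### The energy form and its bound by velocity increments. -/

section EnergyForm

variable {d : ℕ} {W : Set (Space d × ℝ)} {L : ℝ} {U : Space d × ℝ → Space d}
  {q : Space d × ℝ → ℝ} {ψ κ : Space d × ℝ → ℝ}

/-- The local energy balance `∬ |u|² ∂ₜψ + (|u|² + 2p) u · ∇ψ`. -/
noncomputable def energyForm (U : Space d × ℝ → Space d) (q ψ : Space d × ℝ → ℝ) : ℝ :=
  ∫ x, commIntegrand U q ψ x x

/-- The vector paired with the translated velocity in the commutator. -/
noncomputable def commVector (U : Space d × ℝ → Space d) (q ψ : Space d × ℝ → ℝ)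
    (x : Space d × ℝ) : Space d :=
  fderiv ℝ ψ x (U x, 1) • U x + q x • WithLp.toLp 2 fun j => fderiv ℝ ψ x (basisVec j, 0)

/-- This exhibits the dependence on `y` as linear in `(U y, q y)`: an integrable vector paired with
the bounded velocity, and a bounded coefficient times the integrable pressure. Continuity of
translations in `L¹` then suffices for both. -/
theorem commIntegrand_eq (x y : Space d × ℝ) :
    commIntegrand U q ψ x y
      = inner ℝ (commVector U q ψ x) (U y) + fderiv ℝ ψ x (U x, 0) * q y := by
  rw [commVector, inner_add_left, inner_smul_left, inner_smul_left, commIntegrand,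
    apply_eq_sum_basisVec (fderiv ℝ ψ x) (U y),
    inner_eq_sum_mul (WithLp.toLp 2 fun j => fderiv ℝ ψ x (basisVec j, 0))]
  simp only [conj_trivial, mul_comm (fderiv ℝ ψ x (basisVec _, 0)) (U y _)]
  ring

namespace LocalEuler

variable (h : LocalEuler W L U q)
include h

theorem integrable_fderiv_apply (hψ : IsTestFunction W ψ) (c : ℝ) :
    Integrable fun x => fderiv ℝ ψ x (U x, c) := by
  have hi : Integrable (fderiv ℝ ψ) := hψ.continuous_fderiv.integrable_of_hasCompactSupport
    (hψ.hasCompactSupport.fderiv ℝ)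
  refine (hi.norm.mul_const (max L |c|)).mono' ?_ (Eventually.of_forall fun x => ?_)
  · exact aestronglyMeasurable_clm_apply hψ.continuous_fderiv.aestronglyMeasurable
      (h.measurable.aestronglyMeasurable.prodMk aestronglyMeasurable_const)
  · refine ((fderiv ℝ ψ x).le_opNorm _).trans (mul_le_mul_of_nonneg_left ?_ (norm_nonneg _))
    rw [Prod.norm_def]
    exact max_le_max (h.bound x) le_rfl

theorem exists_fderiv_apply_le (hψ : IsTestFunction W ψ) :
    ∃ B, 0 ≤ B ∧ ∀ x, ‖fderiv ℝ ψ x (U x, 0)‖ ≤ B := by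
  obtain ⟨C, hC0, hC⟩ := exists_norm_le_of_hasCompactSupport (hψ.hasCompactSupport.fderiv ℝ)
    hψ.continuous_fderiv
  refine ⟨C * (L + 1), mul_nonneg hC0 (by linarith [h.L_nonneg]), fun x => ?_⟩
  exact ((fderiv ℝ ψ x).le_opNorm _).trans
    (mul_le_mul (hC x) (norm_pair_le (h.bound x) (by simp)) (norm_nonneg _) hC0)

theorem integrable_commVector (hψ : IsTestFunction W ψ) : Integrable (commVector U q ψ) := by
  refine Integrable.add ?_ ?_
  · exact (h.integrable_fderiv_apply hψ 1).smul_of_top_left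
      (memLp_top_of_bound h.measurable.aestronglyMeasurable L (Eventually.of_forall h.bound))
  · have hc : Continuous fun x => WithLp.toLp 2 fun j : Fin d => fderiv ℝ ψ x (basisVec j, 0) :=
      (PiLp.continuous_toLp 2 _).comp (continuous_pi fun j =>
        hψ.continuous_fderiv.clm_apply continuous_const)
    have hs : HasCompactSupport fun x =>
        WithLp.toLp 2 fun j : Fin d => fderiv ℝ ψ x (basisVec j, 0) := by
      refine (hψ.hasCompactSupport.fderiv ℝ).mono fun z hz => ?_
      simp only [Function.mem_support] at hz ⊢
      contrapose! hz
      ext j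
      simp [hz]
    obtain ⟨C, hC0, hC⟩ := exists_norm_le_of_hasCompactSupport hs hc
    exact h.pressure_integrable.smul_of_top_left
      (memLp_top_of_bound hc.aestronglyMeasurable C (Eventually.of_forall hC))

theorem integrable_inner_commVector (hψ : IsTestFunction W ψ) (w : Space d × ℝ) :
    Integrable fun x => inner ℝ (commVector U q ψ x) (U (x - w)) := by
  have ha := h.integrable_commVector hψ
  refine (ha.norm.mul_const L).mono' ?_ (Eventually.of_forall fun x => ?_)
  · exact ha.aestronglyMeasurable.inner
      (h.measurable.comp_measurable (measurable_id.sub_const w)).aestronglyMeasurable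
  · exact (norm_inner_le_norm _ _).trans (mul_le_mul_of_nonneg_left (h.bound _) (norm_nonneg _))

theorem integrable_fderiv_mul_pressure (hψ : IsTestFunction W ψ) (w : Space d × ℝ) :
    Integrable fun x => fderiv ℝ ψ x (U x, 0) * q (x - w) := by
  obtain ⟨B, hB0, hB⟩ := h.exists_fderiv_apply_le hψ
  exact (h.pressure_integrable.comp_sub_right w).bdd_mul (c := B)
    (h.integrable_fderiv_apply hψ 0).aestronglyMeasurable (Eventually.of_forall hB)

theorem integrable_commIntegrand (hψ : IsTestFunction W ψ) (w : Space d × ℝ) :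
    Integrable fun x => commIntegrand U q ψ x (x - w) := by
  simp_rw [commIntegrand_eq]
  exact (h.integrable_inner_commVector hψ w).add (h.integrable_fderiv_mul_pressure hψ w)

theorem energyForm_add {ψ' : Space d × ℝ → ℝ} (hψ : IsTestFunction W ψ)
    (hψ' : IsTestFunction W ψ') :
    energyForm U q (fun x => ψ x + ψ' x) = energyForm U q ψ + energyForm U q ψ' := by
  have h1 := h.integrable_commIntegrand hψ 0
  have h2 := h.integrable_commIntegrand hψ' 0
  simp only [sub_zero] at h1 h2
  rw [energyForm, energyForm, energyForm, ← integral_add h1 h2]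
  refine integral_congr_ae (Eventually.of_forall fun x => ?_)
  simp only [commIntegrand]
  rw [fderiv_fun_add (hψ.differentiable x) (hψ'.differentiable x)]
  simp only [add_apply]
  ring

/-- Additivity is what allows each piece of a partition of unity to be estimated with its own
kernel. -/
theorem energyForm_sum {ι : Type*} (s : Finset ι) (f : ι → Space d × ℝ → ℝ)
    (hf : ∀ i ∈ s, IsTestFunction W (f i)) :
    energyForm U q (fun x => ∑ i ∈ s, f i x) = ∑ i ∈ s, energyForm U q (f i) ∧
      IsTestFunction W fun x => ∑ i ∈ s, f i x := by
  classical
  induction s using Finset.induction_on with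
  | empty =>
    refine ⟨by simp [energyForm, commIntegrand], ?_⟩
    exact ⟨contDiff_const, HasCompactSupport.zero, by simp [tsupport]⟩
  | insert a s ha ih =>
    obtain ⟨h1, h2⟩ := ih fun i hi => hf i (Finset.mem_insert_of_mem hi)
    simp only [Finset.sum_insert ha]
    have h3 := hf a (Finset.mem_insert_self a s)
    exact ⟨by rw [h.energyForm_add h3 h2, h1], h3.add h2⟩

/-- Translating the second argument of the commutator integrand is continuous. -/
theorem exists_abs_integral_commIntegrand_sub_le (hψ : IsTestFunction W ψ) {e : ℝ} (he : 0 < e) :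
    ∃ r > 0, ∀ w ∈ Metric.ball (0 : Space d × ℝ) r,
      |(∫ x, commIntegrand U q ψ x (x - w)) - energyForm U q ψ| ≤ e := by
  have hL := h.L_nonneg
  have ha := h.integrable_commVector hψ
  obtain ⟨B, hB0, hB⟩ := h.exists_fderiv_apply_le hψ
  obtain ⟨r₁, hr₁, H₁⟩ := Metric.eventually_nhds_iff_ball.1
    ((tendsto_integral_norm_translate_sub ha).eventually
      (gt_mem_nhds (show (0 : ℝ) < e / (2 * (L + 1)) by positivity)))
  obtain ⟨r₂, hr₂, H₂⟩ := Metric.eventually_nhds_iff_ball.1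
    ((tendsto_integral_norm_translate_sub h.pressure_integrable).eventually
      (gt_mem_nhds (show (0 : ℝ) < e / (2 * (B + 1)) by positivity)))
  refine ⟨min r₁ r₂, lt_min hr₁ hr₂, fun w hw => ?_⟩
  have hw1 : -w ∈ Metric.ball (0 : Space d × ℝ) r₁ := by
    simpa using (Metric.ball_subset_ball (min_le_left r₁ r₂)) hw
  have hw2 := (Metric.ball_subset_ball (min_le_right r₁ r₂)) hw
  have i1 := h.integrable_inner_commVector hψ w
  have i2 := h.integrable_fderiv_mul_pressure hψ w
  have i3 := h.integrable_inner_commVector hψ 0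
  have i4 := h.integrable_fderiv_mul_pressure hψ 0
  simp only [sub_zero] at i3 i4
  have b1 : |(∫ x, inner ℝ (commVector U q ψ x) (U (x - w)))
      - ∫ x, inner ℝ (commVector U q ψ x) (U x)| ≤ e / 2 := by
    -- A change of variables puts the translation on the `L¹` factor, leaving only the uniform bound
    -- of `U` on the other.
    have e1 : ∫ x, inner ℝ (commVector U q ψ x) (U (x - w))
        = ∫ x, inner ℝ (commVector U q ψ (x - (-w))) (U x) := by
      rw [← integral_add_right_eq_self _ w]
      simp
    have i1' : Integrable fun x => inner ℝ (commVector U q ψ (x - (-w))) (U x) := by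
      have := i1.comp_add_right w
      simpa using this
    rw [e1, ← integral_sub i1' i3, ← Real.norm_eq_abs]
    simp_rw [← inner_sub_left]
    have hai : Integrable fun x => commVector U q ψ (x - -w) - commVector U q ψ x :=
      (ha.comp_sub_right (-w)).sub ha
    calc _ ≤ ∫ x, ‖commVector U q ψ (x - -w) - commVector U q ψ x‖ * L :=
          norm_integral_le_of_norm_le (hai.norm.mul_const L) (Eventually.of_forall fun x =>
            (norm_inner_le_norm _ _).trans
              (mul_le_mul_of_nonneg_left (h.bound _) (norm_nonneg _)))
      _ ≤ e / (2 * (L + 1)) * L := by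
          rw [integral_mul_const]
          exact mul_le_mul_of_nonneg_right (H₁ _ hw1).le hL
      _ ≤ e / 2 := by
          rw [div_mul_eq_mul_div, div_le_div_iff₀ (by positivity) (by positivity)]
          nlinarith
  have b2 : |(∫ x, fderiv ℝ ψ x (U x, 0) * q (x - w))
      - ∫ x, fderiv ℝ ψ x (U x, 0) * q x| ≤ e / 2 := by
    rw [← integral_sub i2 i4, ← Real.norm_eq_abs]
    simp_rw [← mul_sub]
    have hqi : Integrable fun x => q (x - w) - q x :=
      (h.pressure_integrable.comp_sub_right w).sub h.pressure_integrable
    calc _ ≤ ∫ x, B * ‖q (x - w) - q x‖ :=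
          norm_integral_le_of_norm_le (hqi.norm.const_mul B) (Eventually.of_forall fun x => by
            rw [norm_mul]
            exact mul_le_mul_of_nonneg_right (hB x) (norm_nonneg _))
      _ ≤ B * (e / (2 * (B + 1))) := by
          rw [integral_const_mul]
          exact mul_le_mul_of_nonneg_left (H₂ _ hw2).le hB0
      _ ≤ e / 2 := by
          rw [mul_div_assoc', div_le_div_iff₀ (by positivity) (by positivity)]
          nlinarith
  rw [energyForm]
  simp_rw [commIntegrand_eq]
  rw [integral_add i1 i2, integral_add i3 i4]
  calc _ = |((∫ x, inner ℝ (commVector U q ψ x) (U (x - w)))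
      - ∫ x, inner ℝ (commVector U q ψ x) (U x)) + ((∫ x, fderiv ℝ ψ x (U x, 0) * q (x - w))
      - ∫ x, fderiv ℝ ψ x (U x, 0) * q x)| := by congr 1; ring
    _ ≤ e / 2 + e / 2 := (abs_add_le _ _).trans (add_le_add b1 b2)
    _ = e := by ring

/-- The substitution `w = x - y` exhibits the smoothed form as a `κ`-average of translated forms,
each close to the energy form. -/
theorem integral_kernel_commIntegrand (hψ : IsTestFunction W ψ) (hκ : ContDiff ℝ ∞ κ)
    (hκc : HasCompactSupport κ) :
    (Integrable fun w => κ w * ∫ x, commIntegrand U q ψ x (x - w)) ∧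
    ∫ x, ∫ y, κ (x - y) * commIntegrand U q ψ x y
      = ∫ w, κ w * ∫ x, commIntegrand U q ψ x (x - w) := by
  have ha := h.integrable_commVector hψ
  have hκi : Integrable κ := hκ.continuous.integrable_of_hasCompactSupport hκc
  obtain ⟨B, hB0, hB⟩ := h.exists_fderiv_apply_le hψ
  have h1 : Integrable (fun p : (Space d × ℝ) × (Space d × ℝ) =>
      κ p.2 * inner ℝ (commVector U q ψ p.1) (U (p.1 - p.2))) (volume.prod volume) := by
    refine ((ha.norm.mul_prod hκi.norm (μ := volume) (ν := volume)).const_mul L).mono' ?_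
      (Eventually.of_forall fun p => ?_)
    · exact hκi.aestronglyMeasurable.comp_snd.mul (ha.aestronglyMeasurable.comp_fst.inner
        (h.measurable.comp_measurable (measurable_fst.sub measurable_snd)).aestronglyMeasurable)
    · rw [norm_mul]
      calc _ ≤ ‖κ p.2‖ * (‖commVector U q ψ p.1‖ * L) := by
            gcongr
            exact (norm_inner_le_norm _ _).trans
              (mul_le_mul_of_nonneg_left (h.bound _) (norm_nonneg _))
        _ = _ := by ring
  have h2 : Integrable (fun p : (Space d × ℝ) × (Space d × ℝ) =>
      κ p.2 * (fderiv ℝ ψ p.1 (U p.1, 0) * q (p.1 - p.2))) (volume.prod volume) := by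
    have := (hκi.convolution_integrand (ContinuousLinearMap.mul ℝ ℝ) h.pressure_integrable
      (μ := volume) (ν := volume)).bdd_mul (c := B)
      (f := fun p : (Space d × ℝ) × (Space d × ℝ) => fderiv ℝ ψ p.1 (U p.1, 0))
      (h.integrable_fderiv_apply hψ 0).aestronglyMeasurable.comp_fst
      (Eventually.of_forall fun p => hB _)
    refine this.congr (Eventually.of_forall fun p => ?_)
    simp only [ContinuousLinearMap.mul_apply']
    ring
  have h3 : Integrable (Function.uncurry fun x w =>
      κ w * commIntegrand U q ψ x (x - w)) (volume.prod volume) := by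
    refine (h1.add h2).congr (Eventually.of_forall fun p => ?_)
    simp only [Pi.add_apply, Function.uncurry, commIntegrand_eq]
    ring
  have h4 := h3.integral_prod_right
  simp only [Function.uncurry_apply_pair, integral_const_mul] at h4
  refine ⟨h4, ?_⟩
  calc ∫ x, ∫ y, κ (x - y) * commIntegrand U q ψ x y
      = ∫ x, ∫ w, κ w * commIntegrand U q ψ x (x - w) := by
        refine integral_congr_ae (Eventually.of_forall fun x => ?_)
        simp only
        rw [← integral_sub_left_eq_self _ volume x]
        simp
    _ = ∫ w, ∫ x, κ w * commIntegrand U q ψ x (x - w) := integral_integral_swap h3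
    _ = _ := by simp_rw [integral_const_mul]

/-- The velocity increments which control the energy defect. -/
theorem abs_energyForm_le (hψ : IsTestFunction W ψ) {e C : ℝ} (he : 0 < e) (hC0 : 0 ≤ C) :
    ∃ r > 0, ∀ κ : Space d × ℝ → ℝ, ContDiff ℝ ∞ κ → HasCompactSupport κ →
      tsupport κ ⊆ Metric.ball 0 r → ∫ w, κ w = 1 → ∫ w, |κ w| ≤ C →
      (∀ x ∈ tsupport ψ, ∀ w ∈ tsupport κ, x - w ∈ W) →
      |energyForm U q ψ| ≤ e +
        L ^ 2 * ∫ w, ∫ x, |ψ x| * |fderiv ℝ κ w (U x - U (x - w), 0)| := by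
  have hL := h.L_nonneg
  obtain ⟨r, hr, H⟩ := h.exists_abs_integral_commIntegrand_sub_le hψ
    -- The kernel may change sign, so the error is multiplied by its `L¹` norm, which is at most
    -- `C`.
    (show 0 < e / (C + 1) by positivity)
  refine ⟨r, hr, fun κ hκ hκc hκr hκ1 hκC hW => ?_⟩
  have hκi : Integrable κ := hκ.continuous.integrable_of_hasCompactSupport hκc
  obtain ⟨k1, k2⟩ := h.integral_kernel_commIntegrand hψ hκ hκc
  have hid := commutator_identity h hψ hκ hκc hW
  rw [k2] at hid
  have b1 : |energyForm U q ψ - ∫ w, κ w * ∫ x, commIntegrand U q ψ x (x - w)| ≤ e := by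
    have e1 : energyForm U q ψ = ∫ w, κ w * energyForm U q ψ := by
      rw [integral_mul_const, hκ1, one_mul]
    rw [e1, ← integral_sub (hκi.mul_const _) k1, ← Real.norm_eq_abs]
    calc _ ≤ ∫ w, |κ w| * (e / (C + 1)) := by
          refine norm_integral_le_of_norm_le (hκi.abs.mul_const _) (Eventually.of_forall fun w => ?_)
          rw [← mul_sub, norm_mul, Real.norm_eq_abs, Real.norm_eq_abs]
          by_cases hw : w ∈ tsupport κ
          · rw [abs_sub_comm (energyForm U q ψ)]
            exact mul_le_mul_of_nonneg_left (H w (hκr hw)) (abs_nonneg _)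
          · simp [image_eq_zero_of_notMem_tsupport hw]
      _ ≤ C * (e / (C + 1)) := by
          rw [integral_mul_const]
          exact mul_le_mul_of_nonneg_right hκC (by positivity)
      _ ≤ e := by
          rw [mul_div_assoc', div_le_iff₀ (by positivity)]
          nlinarith
  have hκ' : Continuous (fderiv ℝ κ) := hκ.continuous_fderiv (by simp)
  have hψi : Integrable ψ := hψ.continuous.integrable_of_hasCompactSupport hψ.hasCompactSupport
  have hκ'i : Integrable (fderiv ℝ κ) :=
    hκ'.integrable_of_hasCompactSupport (hκc.fderiv ℝ)
  have hUU : ∀ x y, ‖(U x - U y, (0 : ℝ))‖ ≤ 2 * L := fun x y => by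
    simp only [Prod.norm_def, norm_zero]
    refine max_le ((norm_sub_le _ _).trans ?_) (by linarith)
    linarith [h.bound x, h.bound y]
  have hI : Integrable (Function.uncurry fun x w : Space d × ℝ =>
      |ψ x| * |fderiv ℝ κ w (U x - U (x - w), 0)|) (volume.prod volume) := by
    refine ((hψi.norm.mul_prod hκ'i.norm (μ := volume) (ν := volume)).const_mul (2 * L)).mono' ?_
      (Eventually.of_forall fun p => ?_)
    · have hm1 : StronglyMeasurable fun p : (Space d × ℝ) × (Space d × ℝ) => U p.1 :=
        h.measurable.comp_measurable measurable_fst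
      have hm2 : StronglyMeasurable fun p : (Space d × ℝ) × (Space d × ℝ) => U (p.1 - p.2) :=
        h.measurable.comp_measurable (measurable_fst.sub measurable_snd)
      have := aestronglyMeasurable_clm_apply (μ := (volume : Measure (Space d × ℝ)).prod volume)
        (hκ'i.aestronglyMeasurable.comp_snd)
        ((hm1.sub hm2).aestronglyMeasurable.prodMk (aestronglyMeasurable_const (b := (0 : ℝ))))
      exact hψi.norm.aestronglyMeasurable.comp_fst.mul this.norm
    · simp only [Function.uncurry, norm_mul, Real.norm_eq_abs, abs_abs]
      calc _ ≤ |ψ p.1| * (‖fderiv ℝ κ p.2‖ * (2 * L)) := by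
            gcongr
            exact ((fderiv ℝ κ p.2).le_opNorm _).trans
              (mul_le_mul_of_nonneg_left (hUU _ _) (norm_nonneg _))
        _ = _ := by ring
  have b2 : |∫ x, ∫ y, ψ x * inner ℝ (U x) (U y) * fderiv ℝ κ (x - y) (U x - U y, 0)|
      ≤ L ^ 2 * ∫ w, ∫ x, |ψ x| * |fderiv ℝ κ w (U x - U (x - w), 0)| := by
    rw [← integral_integral_swap hI, ← Real.norm_eq_abs, ← integral_const_mul]
    refine norm_integral_le_of_norm_le (hI.integral_prod_left.const_mul _) ?_
    filter_upwards [hI.prod_right_ae] with x hx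
    simp only [Function.uncurry] at hx ⊢
    rw [← integral_sub_left_eq_self _ volume x, ← integral_const_mul]
    refine norm_integral_le_of_norm_le (hx.const_mul _) (Eventually.of_forall fun w => ?_)
    rw [sub_sub_cancel, norm_mul, norm_mul]
    -- The factor `U x · U (x - w)` is merely bounded; all smallness will come from the choice of
    -- kernel.
    have : ‖inner ℝ (U x) (U (x - w))‖ ≤ L ^ 2 := (norm_inner_le_norm _ _).trans (by
      rw [sq]; exact mul_le_mul (h.bound _) (h.bound _) (norm_nonneg _) hL)
    simp only [Real.norm_eq_abs] at this ⊢
    calc _ ≤ |ψ x| * L ^ 2 * |fderiv ℝ κ w (U x - U (x - w), 0)| := by gcongr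
      _ = _ := by ring
  rw [hid, sub_neg_eq_add] at b1
  have := abs_sub_abs_le_abs_sub (energyForm U q ψ)
    (-∫ x, ∫ y, ψ x * inner ℝ (U x) (U y) * fderiv ℝ κ (x - y) (U x - U y, 0))
  rw [abs_neg, sub_neg_eq_add] at this
  linarith

end LocalEuler

end EnergyForm

/-! ### From velocity increments to kernel fluxes. -/

section Increments

variable {d : ℕ}

/-- The spatial derivative of a vector field on space-time. -/
noncomputable def spaceDeriv (V : Space d × ℝ → Space d) (x : Space d × ℝ) :
    Space d →L[ℝ] Space d :=
  (fderiv ℝ V x).comp (ContinuousLinearMap.inl ℝ (Space d) ℝ)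

theorem continuous_spaceDeriv {V : Space d × ℝ → Space d} (hV : ContDiff ℝ ∞ V) :
    Continuous (spaceDeriv V) :=
  (hV.continuous_fderiv (by simp)).clm_comp continuous_const

/-- The increment is the integral of the derivative along the segment from `x - (y, 0)` to `x`;
after Fubini, `x` is translated along it. Uniform continuity of `ψ` costs `m`, and `χ` absorbs the
enlarged support. The radius does not depend on `V` or `a`, so it can be fixed before the kernel and
the mollifier. -/
theorem integral_abs_increment_le {ψ χ : Space d × ℝ → ℝ} (hψ : Continuous ψ)
    (hψc : HasCompactSupport ψ) (hχ : Continuous χ) (hχc : HasCompactSupport χ)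
    (hχ0 : ∀ x, 0 ≤ χ x) {r₁ : ℝ} (hr₁ : 0 < r₁)
    (h1 : ∀ x ∈ tsupport ψ, ∀ w ∈ Metric.ball (0 : Space d × ℝ) r₁, χ (x + w) = 1)
    {m : ℝ} (hm : 0 < m) :
    ∃ r > 0, ∀ y : Space d, ‖y‖ < r → ∀ (V : Space d × ℝ → Space d), ContDiff ℝ ∞ V →
      ∀ a : Space d →L[ℝ] ℝ, ∫ x, |ψ x| * |a (V x - V (x - (y, 0)))|
        ≤ ∫ x, (|ψ x| + m) * χ x * |a (spaceDeriv V x y)| := by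
  have huc := hψc.uniformContinuous_of_continuous hψ
  obtain ⟨r₂, hr₂, H⟩ := Metric.uniformContinuous_iff.1 huc m hm
  refine ⟨min r₁ r₂, lt_min hr₁ hr₂, fun y hy V hV a => ?_⟩
  set F : Space d × ℝ → ℝ := fun x => |a (spaceDeriv V x y)| with hF
  have hFc : Continuous F :=
    (a.continuous.comp ((continuous_spaceDeriv hV).clm_apply continuous_const)).abs
  set y' : Space d × ℝ := (y, 0) with hy'
  have hny : ‖y'‖ = ‖y‖ := by simp [hy', Prod.norm_def]
  have hpt : ∀ x, |a (V x - V (x - y'))| ≤ ∫ t in (0 : ℝ)..1, F (x - t • y') := fun x => by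
    have hder : ∀ t ∈ uIcc (0 : ℝ) 1, HasDerivAt (fun t : ℝ => a (V (x - t • y')))
        (-a (spaceDeriv V (x - t • y') y)) t := fun t _ => by
      have hl : HasDerivAt (fun t : ℝ => x - t • y') (-y') t := by
        simpa using ((hasDerivAt_id t).smul_const y').const_sub x
      have := a.hasFDerivAt.comp_hasDerivAt t
        (((hV.differentiable (by simp)) (x - t • y')).hasFDerivAt.comp_hasDerivAt t hl)
      rw [map_neg, map_neg] at this
      exact this
    have hcont : Continuous fun t : ℝ => -a (spaceDeriv V (x - t • y') y) :=
      (a.continuous.comp (((continuous_spaceDeriv hV).comp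
        (continuous_const.sub (continuous_id.smul continuous_const))).clm_apply
          continuous_const)).neg
    have hftc := intervalIntegral.integral_eq_sub_of_hasDerivAt hder
      (hcont.intervalIntegrable _ _)
    have e1 : a (V x - V (x - y')) = - ∫ t in (0 : ℝ)..1, -a (spaceDeriv V (x - t • y') y) := by
      rw [hftc]; simp
    rw [e1, abs_neg]
    refine (intervalIntegral.abs_integral_le_integral_abs zero_le_one).trans (le_of_eq ?_)
    simp [hF]
  have hcprod : Continuous fun p : (Space d × ℝ) × ℝ => |ψ p.1| * F (p.1 - p.2 • y') :=
    (hψ.comp continuous_fst).abs.mul (hFc.comp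
      (continuous_fst.sub (continuous_snd.smul continuous_const)))
  have hprod : Integrable (Function.uncurry fun x t => |ψ x| * F (x - t • y'))
      ((volume.restrict (tsupport ψ)).prod (volume.restrict (Ioc (0 : ℝ) 1))) := by
    rw [Measure.prod_restrict]
    exact (hcprod.continuousOn.integrableOn_compact
      (hψc.isCompact.prod isCompact_Icc)).mono_set
        (prod_mono_right Ioc_subset_Icc_self)
  have hset : ∀ g : Space d × ℝ → ℝ, ∫ x in tsupport ψ, |ψ x| * g x = ∫ x, |ψ x| * g x :=
    fun g => setIntegral_eq_integral_of_forall_compl_eq_zero fun x hx => by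
      simp [image_eq_zero_of_notMem_tsupport hx]
  have hR : Integrable fun x => (|ψ x| + m) * χ x * F x :=
    ((hψ.abs.add continuous_const).mul hχ).mul hFc |>.integrable_of_hasCompactSupport
      (HasCompactSupport.mul_right hχc.mul_left)
  have hshift : ∀ t ∈ Ioc (0 : ℝ) 1, ∫ x, |ψ x| * F (x - t • y')
      ≤ ∫ x, (|ψ x| + m) * χ x * F x := fun t ht => by
    rw [← integral_add_right_eq_self _ (t • y')]
    simp only [add_sub_cancel_right]
    refine integral_mono_of_nonneg (Eventually.of_forall fun x =>
      mul_nonneg (abs_nonneg _) (abs_nonneg _)) hR (Eventually.of_forall fun x => ?_)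
    refine mul_le_mul_of_nonneg_right ?_ (abs_nonneg _)
    have hty : ‖t • y'‖ < min r₁ r₂ := by
      rw [norm_smul, Real.norm_eq_abs, abs_of_pos ht.1, hny]
      nlinarith [ht.2, norm_nonneg y]
    by_cases hx : x + t • y' ∈ tsupport ψ
    · have hχx : χ x = 1 := by
        have := h1 _ hx (-(t • y')) (by
          simpa using hty.trans_le (min_le_left _ _))
        simpa using this
      rw [hχx, mul_one]
      have := H (a := x + t • y') (b := x) (by
        rw [dist_eq_norm]; simpa using hty.trans_le (min_le_right _ _))
      rw [Real.dist_eq] at this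
      have h2 := abs_sub_abs_le_abs_sub (ψ (x + t • y')) (ψ x)
      linarith
    · rw [image_eq_zero_of_notMem_tsupport hx, abs_zero]
      exact mul_nonneg (by positivity) (hχ0 x)
  calc ∫ x, |ψ x| * |a (V x - V (x - y'))|
      = ∫ x in tsupport ψ, |ψ x| * |a (V x - V (x - y'))| := (hset _).symm
    _ ≤ ∫ x in tsupport ψ, ∫ t in Ioc (0 : ℝ) 1, |ψ x| * F (x - t • y') := by
        refine integral_mono_of_nonneg (Eventually.of_forall fun x =>
          mul_nonneg (abs_nonneg _) (abs_nonneg _)) hprod.integral_prod_left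
          (Eventually.of_forall fun x => ?_)
        simp only
        rw [integral_const_mul, ← intervalIntegral.integral_of_le zero_le_one]
        exact mul_le_mul_of_nonneg_left (hpt x) (abs_nonneg _)
    _ = ∫ t in Ioc (0 : ℝ) 1, ∫ x in tsupport ψ, |ψ x| * F (x - t • y') :=
        integral_integral_swap hprod
    _ ≤ ∫ t in Ioc (0 : ℝ) 1, ∫ x, (|ψ x| + m) * χ x * F x := by
        refine setIntegral_mono_on hprod.integral_prod_right (integrable_const _)
          measurableSet_Ioc fun t ht => ?_
        rw [hset]
        exact hshift t ht
    _ = ∫ x, (|ψ x| + m) * χ x * F x := by simp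

variable {W : Set (Space d × ℝ)} {L : ℝ} {U : Space d × ℝ → Space d}
  {q : Space d × ℝ → ℝ} {ψ χ : Space d × ℝ → ℝ}

theorem integrable_abs_increment {f : Space d × ℝ → Space d} (hf : Integrable f)
    {ψ : Space d × ℝ → ℝ} (hψ : Continuous ψ) (hψc : HasCompactSupport ψ)
    (a : Space d →L[ℝ] ℝ) : Integrable fun x => |ψ x| * |a (f x)| := by
  obtain ⟨B, hB0, hB⟩ := exists_norm_le_of_hasCompactSupport hψc hψ
  exact (a.integrable_comp hf).abs.bdd_mul (c := B) hψ.abs.aestronglyMeasurable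
    (Eventually.of_forall fun x => by simpa using hB x)

theorem integral_abs_apply_le {f : Space d × ℝ → Space d} (hf : Integrable f)
    {ψ : Space d × ℝ → ℝ} {B : ℝ} (hB : ∀ x, ‖ψ x‖ ≤ B) (a : Space d →L[ℝ] ℝ) :
    ∫ x, |ψ x| * |a (f x)| ≤ B * (‖a‖ * ∫ x, ‖f x‖) := by
  rw [← integral_const_mul, ← integral_const_mul]
  refine integral_mono_of_nonneg (Eventually.of_forall fun x =>
    mul_nonneg (abs_nonneg _) (abs_nonneg _)) ((hf.norm.const_mul _).const_mul _)
    (Eventually.of_forall fun x => ?_)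
  exact mul_le_mul (hB x) (a.le_opNorm _) (abs_nonneg _) ((norm_nonneg _).trans (hB x))

/-- Increments of `U` are controlled by those of a smooth approximation `V`. -/
theorem integral_abs_increment_approx_le {V : Space d × ℝ → Space d} (hU : Integrable U)
    (hV : Integrable V) (hψ : Continuous ψ) (hψc : HasCompactSupport ψ) {B e : ℝ} (hB0 : 0 ≤ B)
    (hB : ∀ x, ‖ψ x‖ ≤ B) (hUV : ∫ x, ‖V x - U x‖ ≤ e) {y : Space d} {s : ℝ}
    (hs : ∫ x, ‖U (x - (0, s)) - U x‖ ≤ e) (a : Space d →L[ℝ] ℝ) :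
    ∫ x, |ψ x| * |a (U x - U (x - (y, s)))|
      ≤ (∫ x, |ψ x| * |a (V x - V (x - (y, 0)))|) + 3 * (B * (‖a‖ * e)) := by
  set y' : Space d × ℝ := (y, 0)
  have i1 : Integrable fun x => V x - U x := hV.sub hU
  have i2 : Integrable fun x => V (x - y') - U (x - y') := i1.comp_sub_right y'
  have i3 : Integrable fun x => U (x - y' - (0, s)) - U (x - y') :=
    ((hU.comp_sub_right (0, s)).sub hU).comp_sub_right y'
  have i4 : Integrable fun x => V x - V (x - y') := hV.sub (hV.comp_sub_right y')
  have n2 : ∫ x, ‖V (x - y') - U (x - y')‖ ≤ e := by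
    rw [integral_sub_right_eq_self (fun x => ‖V x - U x‖) y']; exact hUV
  have n3 : ∫ x, ‖U (x - y' - (0, s)) - U (x - y')‖ ≤ e := by
    rw [integral_sub_right_eq_self (fun x => ‖U (x - (0, s)) - U x‖) y']; exact hs
  have b : ∀ {f : Space d × ℝ → Space d}, Integrable f → ∫ x, ‖f x‖ ≤ e →
      ∫ x, |ψ x| * |a (f x)| ≤ B * (‖a‖ * e) := fun hf he =>
    (integral_abs_apply_le hf hB a).trans (by gcongr)
  have J : ∀ {f : Space d × ℝ → Space d}, Integrable f → Integrable fun x => |ψ x| * |a (f x)| :=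
    fun hf => integrable_abs_increment hf hψ hψc a
  -- There are three errors: replacing `U` by `V` at `x`, replacing it at `x - y'`, and the
  -- remaining shift in time of `U`.
  have key : ∀ x, |ψ x| * |a (U x - U (x - (y, s)))| ≤
      (|ψ x| * |a (V x - V (x - y'))| + |ψ x| * |a (V x - U x)|) +
      (|ψ x| * |a (V (x - y') - U (x - y'))| + |ψ x| * |a (U (x - y' - (0, s)) - U (x - y'))|) := by
    intro x
    have e1 : x - (y, s) = x - y' - (0, s) := by
      rw [sub_sub]; simp [y']
    have e2 : U x - U (x - (y, s)) = ((V x - V (x - y')) - (V x - U x))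
        + ((V (x - y') - U (x - y')) - (U (x - y' - (0, s)) - U (x - y'))) := by
      rw [e1]; abel
    rw [e2, map_add, map_sub, map_sub a (V (x - y') - U (x - y'))]
    rw [← mul_add, ← mul_add, ← mul_add]
    refine mul_le_mul_of_nonneg_left ?_ (abs_nonneg _)
    exact (abs_add_le _ _).trans (add_le_add (abs_sub _ _) (abs_sub _ _))
  have := integral_mono_of_nonneg (Eventually.of_forall fun x =>
    mul_nonneg (abs_nonneg (ψ x)) (abs_nonneg _)) (((J i4).add (J i1)).add ((J i2).add (J i3)))
    (Eventually.of_forall key)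
  refine this.trans ?_
  rw [integral_add' ((J i4).add (J i1)) ((J i2).add (J i3)), integral_add' (J i4) (J i1),
    integral_add' (J i2) (J i3)]
  have b1 := b i1 hUV
  have b2 := b i2 n2
  have b3 := b i3 n3
  linarith

/-- The kernel is `ρ(y) θ(s)`: horizontal derivatives differentiate only `ρ`, so time increments are
never divided by the time scale. That scale can therefore be taken tiny compared with `ρ`, and so
can the scale of the mollifier `κ` replacing `U` by a smooth field. The radius `r` is fixed before
`ρ` and depends on it only through `C`, so a given kernel can be rescaled to fit. -/
theorem LocalEuler.abs_energyForm_le_kernelFlux (h : LocalEuler W L U q) (hW : IsOpen W)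
    (hψ : IsTestFunction W ψ) (hχ : Continuous χ) (hχc : HasCompactSupport χ)
    (hχ0 : ∀ x, 0 ≤ χ x) {r₁ : ℝ} (hr₁ : 0 < r₁)
    (h1 : ∀ x ∈ tsupport ψ, ∀ w ∈ Metric.ball (0 : Space d × ℝ) r₁, χ (x + w) = 1)
    {m e C : ℝ} (hm : 0 < m) (he : 0 < e) (hC0 : 0 ≤ C) :
    ∃ r > 0, ∀ ρ : Space d → ℝ, ContDiff ℝ ∞ ρ → HasCompactSupport ρ →
      tsupport ρ ⊆ Metric.ball 0 r → ∫ y, ρ y = 1 → ∫ y, |ρ y| ≤ C →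
      ∃ η > 0, ∀ κ, IsMollifier η κ → |energyForm U q ψ| ≤ e +
        L ^ 2 * ∫ x, (|ψ x| + m) * χ x * kernelFlux ρ (spaceDeriv (moll κ U) x) := by
  have hL := h.L_nonneg
  obtain ⟨ra, hra, Ha⟩ := h.abs_energyForm_le hψ (half_pos he) hC0
  obtain ⟨rb, hrb, Hb⟩ := integral_abs_increment_le hψ.continuous hψ.hasCompactSupport hχ hχc hχ0
    hr₁ h1 hm
  obtain ⟨rc, hrc, Hc⟩ := exists_add_mem_of_isCompact hψ.hasCompactSupport.isCompact hW
    hψ.tsupport_subset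
  obtain ⟨r, hr, hra', hrb', hrc'⟩ : ∃ r > 0, r ≤ ra ∧ r ≤ rb ∧ r ≤ rc :=
    ⟨min ra (min rb rc), lt_min hra (lt_min hrb hrc), min_le_left _ _,
      (min_le_right _ _).trans (min_le_left _ _), (min_le_right _ _).trans (min_le_right _ _)⟩
  refine ⟨r, hr, fun ρ hρ hρc hρr hρ1 hρC => ?_⟩
  obtain ⟨B, hB0, hB⟩ := exists_norm_le_of_hasCompactSupport hψ.hasCompactSupport hψ.continuous
  have hρ' : Continuous (fderiv ℝ ρ) := hρ.continuous_fderiv (by simp)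
  have hρi : Integrable ρ := hρ.continuous.integrable_of_hasCompactSupport hρc
  have hρ'i : Integrable (fderiv ℝ ρ) := hρ'.integrable_of_hasCompactSupport (hρc.fderiv ℝ)
  set D : ℝ := ∫ y, ‖fderiv ℝ ρ y‖ with hD
  have hD0 : 0 ≤ D := integral_nonneg fun _ => norm_nonneg _
  -- Three errors, each weighted by at most `L² B D` after integration in `y`, must fit in `e / 2`;
  -- this explains the `6`.
  set e₁ : ℝ := e / (6 * ((B + 1) * ((D + 1) * (L ^ 2 + 1)))) with he₁
  have he₁0 : 0 < e₁ := by positivity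
  obtain ⟨s₀, hs₀, Hs⟩ := Metric.eventually_nhds_iff_ball.1
    ((tendsto_integral_norm_translate_sub h.integrable).eventually (gt_mem_nhds he₁0))
  obtain ⟨η, hη, Hη⟩ := exists_moll_sub_le h.integrable he₁0
  refine ⟨η, hη, fun κ hκ => ?_⟩
  -- The radius `s₀` depends on `ρ` through `D`: it makes time shifts of `U` smaller than `e₁` in
  -- `L¹`.
  obtain ⟨θ, hθ⟩ := exists_isMollifier (G := ℝ) (lt_min hr hs₀)
  set V := moll κ U with hVdef
  have hV : ContDiff ℝ ∞ V :=
    contDiff_moll hκ.smooth hκ.hasCompactSupport h.integrable.locallyIntegrable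
  have hVi : Integrable V := integrable_moll hκ.integrable h.integrable
  have hUV := Hη κ hκ.smooth.continuous hκ.nonneg hκ.integral_eq_one hκ.tsupport_subset
  set κ' : Space d × ℝ → ℝ := fun w => ρ w.1 * θ w.2 with hκ'
  have hκ's : ContDiff ℝ ∞ κ' := (hρ.comp contDiff_fst).mul (hθ.smooth.comp contDiff_snd)
  have hsupp : tsupport κ' ⊆ tsupport ρ ×ˢ tsupport θ := by
    refine closure_minimal (fun w hw => ?_) ((isClosed_tsupport ρ).prod (isClosed_tsupport θ))
    exact ⟨subset_tsupport _ (left_ne_zero_of_mul hw), subset_tsupport _ (right_ne_zero_of_mul hw)⟩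
  have hκ'c : HasCompactSupport κ' :=
    (hρc.isCompact.prod hθ.hasCompactSupport.isCompact).of_isClosed_subset
      (isClosed_tsupport _) hsupp
  have hball : tsupport κ' ⊆ Metric.ball 0 r := fun w hw => by
    have h2 := hρr (hsupp hw).1
    have h3 := (hθ.tsupport_subset.trans (Metric.ball_subset_ball (min_le_left _ _))) (hsupp hw).2
    simp only [mem_ball_zero_iff] at h2 h3 ⊢
    exact max_lt h2 h3
  have hκ'1 : ∫ w, κ' w = 1 := by
    rw [hκ', Measure.volume_eq_prod, integral_prod_mul, hρ1, hθ.integral_eq_one, one_mul]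
  have hκ'C : ∫ w, |κ' w| ≤ C := by
    have : (fun w => |κ' w|) = fun w => |ρ w.1| * θ w.2 := by
      ext w; rw [hκ', abs_mul, abs_of_nonneg (hθ.nonneg _)]
    rw [this, Measure.volume_eq_prod, integral_prod_mul (fun y => |ρ y|) θ, hθ.integral_eq_one,
      mul_one]
    exact hρC
  have hder : ∀ (w : Space d × ℝ) v, fderiv ℝ κ' w (v, 0) = θ w.2 * fderiv ℝ ρ w.1 v := by
    intro w v
    have d1 : HasFDerivAt (fun w : Space d × ℝ => ρ w.1)
        ((fderiv ℝ ρ w.1).comp (ContinuousLinearMap.fst ℝ (Space d) ℝ)) w :=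
      ((hρ.differentiable (by simp)) w.1).hasFDerivAt.comp w hasFDerivAt_fst
    have d2 : HasFDerivAt (fun w : Space d × ℝ => θ w.2)
        ((fderiv ℝ θ w.2).comp (ContinuousLinearMap.snd ℝ (Space d) ℝ)) w :=
      ((hθ.smooth.differentiable (by simp)) w.2).hasFDerivAt.comp w hasFDerivAt_snd
    have := (d1.mul d2).fderiv
    rw [show κ' = (fun w : Space d × ℝ => ρ w.1) * fun w => θ w.2 from rfl, this]
    simp
  have main := Ha κ' hκ's hκ'c (hball.trans (Metric.ball_subset_ball hra')) hκ'1 hκ'C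
    fun x hx w hw => by
      have := hball hw
      rw [sub_eq_add_neg]
      exact Hc x hx _ (by simpa using (Metric.ball_subset_ball hrc') this)
  set K : Space d → ℝ := fun y =>
    ∫ x, (|ψ x| + m) * χ x * |fderiv ℝ ρ y (spaceDeriv V x y)| with hK
  have hKc : Continuous fun p : (Space d × ℝ) × Space d =>
      (|ψ p.1| + m) * χ p.1 * |fderiv ℝ ρ p.2 (spaceDeriv V p.1 p.2)| := by
    refine (((hψ.continuous.comp continuous_fst).abs.add continuous_const).mul
      (hχ.comp continuous_fst)).mul ?_
    exact ((hρ'.comp continuous_snd).clm_apply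
      (((continuous_spaceDeriv hV).comp continuous_fst).clm_apply continuous_snd)).abs
  have hKi : Integrable (Function.uncurry fun (x : Space d × ℝ) (y : Space d) =>
      (|ψ x| + m) * χ x * |fderiv ℝ ρ y (spaceDeriv V x y)|) (volume.prod volume) := by
    refine hKc.integrable_of_hasCompactSupport (HasCompactSupport.intro
      (hχc.isCompact.prod (hρc.fderiv ℝ).isCompact) fun p hp => ?_)
    by_cases hp1 : p.1 ∈ tsupport χ
    · have : p.2 ∉ tsupport (fderiv ℝ ρ) := fun h' => hp ⟨hp1, h'⟩
      simp [image_eq_zero_of_notMem_tsupport this]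
    · simp [image_eq_zero_of_notMem_tsupport hp1]
  have hKint : Integrable K := hKi.integral_prod_right
  have hKval : ∫ y, K y = ∫ x, (|ψ x| + m) * χ x * kernelFlux ρ (spaceDeriv V x) := by
    rw [hK, ← integral_integral_swap hKi]
    simp only [integral_const_mul, kernelFlux]
  have hbound : ∀ w : Space d × ℝ, ∫ x, |ψ x| * |fderiv ℝ κ' w (U x - U (x - w), 0)|
      ≤ (K w.1 + 3 * (B * e₁) * ‖fderiv ℝ ρ w.1‖) * θ w.2 := by
    rintro ⟨y, s⟩
    simp only [hder, abs_mul, abs_of_nonneg (hθ.nonneg _)]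
    by_cases hw : y ∈ tsupport ρ ∧ s ∈ tsupport θ
    · have e1 : ∀ x, |ψ x| * (θ s * |fderiv ℝ ρ y (U x - U (x - (y, s)))|)
          = |ψ x| * |fderiv ℝ ρ y (U x - U (x - (y, s)))| * θ s := fun x => by ring
      simp_rw [e1]
      rw [integral_mul_const]
      refine mul_le_mul_of_nonneg_right ?_ (hθ.nonneg _)
      have hs : ∫ x, ‖U (x - (0, s)) - U x‖ ≤ e₁ := by
        refine (Hs (0, s) ?_).le
        have := (hθ.tsupport_subset.trans (Metric.ball_subset_ball (min_le_right _ _))) hw.2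
        simp only [mem_ball_zero_iff] at this ⊢
        simpa [Prod.norm_def] using this
      have b1 := integral_abs_increment_approx_le h.integrable hVi hψ.continuous
        hψ.hasCompactSupport hB0 hB hUV (y := y) hs (fderiv ℝ ρ y)
      have b2 := Hb y (by simpa using (hρr.trans (Metric.ball_subset_ball hrb')) hw.1) V hV
        (fderiv ℝ ρ y)
      refine b1.trans (le_trans (add_le_add_left b2 _) (le_of_eq ?_))
      simp only [hK]
      ring
    · have hz : ∀ v, θ s * |fderiv ℝ ρ y v| = 0 := fun v => by
        by_cases hy : y ∈ tsupport ρ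
        · rw [image_eq_zero_of_notMem_tsupport fun h' => hw ⟨hy, h'⟩, zero_mul]
        · have : fderiv ℝ ρ y = 0 := by
            by_contra hne
            exact hy (support_fderiv_subset ℝ hne)
          simp [this]
      simp only [hz, mul_zero, integral_zero]
      have : 0 ≤ K y := integral_nonneg fun x =>
        mul_nonneg (mul_nonneg (by positivity) (hχ0 x)) (abs_nonneg _)
      exact mul_nonneg (by positivity) (hθ.nonneg _)
  have hfin : ∫ w, ∫ x, |ψ x| * |fderiv ℝ κ' w (U x - U (x - w), 0)|
      ≤ (∫ x, (|ψ x| + m) * χ x * kernelFlux ρ (spaceDeriv V x)) + 3 * (B * e₁) * D := by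
    have hi : Integrable fun y => K y + 3 * (B * e₁) * ‖fderiv ℝ ρ y‖ :=
      hKint.add (hρ'i.norm.const_mul _)
    have hi2 : Integrable fun w : Space d × ℝ =>
        (K w.1 + 3 * (B * e₁) * ‖fderiv ℝ ρ w.1‖) * θ w.2 :=
      hi.mul_prod hθ.integrable
    refine (integral_mono_of_nonneg (Eventually.of_forall fun w => integral_nonneg fun x =>
      mul_nonneg (abs_nonneg _) (abs_nonneg _)) hi2 (Eventually.of_forall hbound)).trans ?_
    rw [Measure.volume_eq_prod, integral_prod_mul (fun y => K y + 3 * (B * e₁) * ‖fderiv ℝ ρ y‖) θ,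
      hθ.integral_eq_one, mul_one, integral_add hKint (hρ'i.norm.const_mul _),
      integral_const_mul, hKval]
    exact le_rfl
  have hsmall : L ^ 2 * (3 * (B * e₁) * D) ≤ e / 2 := by
    have hc : 0 < (B + 1) * ((D + 1) * (L ^ 2 + 1)) := by positivity
    have h3 : B * (D * L ^ 2) ≤ (B + 1) * ((D + 1) * (L ^ 2 + 1)) := by
      gcongr <;> linarith
    have h4 : L ^ 2 * (3 * (B * e₁) * D) = (e / 2) * ((B * (D * L ^ 2)) /
        ((B + 1) * ((D + 1) * (L ^ 2 + 1)))) := by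
      rw [he₁]; field_simp; ring
    rw [h4]
    exact mul_le_of_le_one_right (by positivity) ((div_le_one hc).2 h3)
  have := mul_le_mul_of_nonneg_left hfin (sq_nonneg L)
  linarith

end Increments

/-! ### Smooth cutoffs and partitions of unity. -/

section Cutoffs

variable {X : Type*} [NormedAddCommGroup X] [NormedSpace ℝ X] [FiniteDimensional ℝ X]

theorem exists_cutoff {K W : Set X} (hK : IsCompact K) (hW : IsOpen W) (h : K ⊆ W) :
    ∃ χ : X → ℝ, IsTestFunction W χ ∧ (∀ x, 0 ≤ χ x) ∧ (∀ x, χ x ≤ 1) ∧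
      ∃ r > 0, ∀ x ∈ K, ∀ w ∈ Metric.ball (0 : X) r, χ (x + w) = 1 := by
  obtain ⟨r, hr, hsub⟩ := hK.exists_cthickening_subset_open hW h
  have hT : IsCompact (Metric.cthickening r K) := hK.cthickening
  obtain ⟨f, h1, h2, h3⟩ := exists_contMDiffMap_one_nhds_of_subset_interior 𝓘(ℝ, X) (n := (⊤ : ℕ∞))
    (s := Metric.cthickening (r / 2) K) (t := Metric.cthickening r K) Metric.isClosed_cthickening
    ((Metric.cthickening_subset_thickening' hr (by linarith) K).trans
      (interior_maximal (Metric.thickening_subset_cthickening r K) Metric.isOpen_thickening))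
  have hts : tsupport f ⊆ Metric.cthickening r K :=
    closure_minimal (fun x hx => by_contra fun hn => hx (h2 x hn)) Metric.isClosed_cthickening
  refine ⟨f, ⟨f.contMDiff.contDiff, hT.of_isClosed_subset (isClosed_tsupport _) hts,
    hts.trans hsub⟩, fun x => (h3 x).1, fun x => (h3 x).2, r / 2, by positivity, fun x hx w hw => ?_⟩
  refine h1.self_of_nhdsSet _ (Metric.mem_cthickening_of_dist_le _ x _ _ hx ?_)
  simpa using (mem_ball_zero_iff.1 hw).le

theorem exists_smooth_partition {ι : Type*} [Fintype ι] {O : ι → Set X} (hO : ∀ i, IsOpen (O i))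
    (hcov : ∀ x, ∃ i, x ∈ O i) : ∃ f : ι → X → ℝ, (∀ i, ContDiff ℝ ∞ (f i)) ∧
      (∀ i x, 0 ≤ f i x) ∧ (∀ i, tsupport (f i) ⊆ O i) ∧ ∀ x, ∑ i, f i x = 1 := by
  obtain ⟨f, hf⟩ := SmoothPartitionOfUnity.exists_isSubordinate 𝓘(ℝ, X) isClosed_univ O hO
    (fun x _ => mem_iUnion.2 (hcov x))
  refine ⟨fun i => f i, fun i => (f i).contMDiff.contDiff, fun i x => f.nonneg i x, hf, fun x => ?_⟩
  rw [← finsum_eq_sum_of_fintype]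
  exact f.sum_eq_one (mem_univ x)

end Cutoffs

/-! ### Scale invariance of the kernel flux. -/

section Scaling

variable {X : Type*} [NormedAddCommGroup X] [NormedSpace ℝ X] [FiniteDimensional ℝ X]
  [MeasureSpace X] [BorelSpace X] [(volume : Measure X).IsAddHaarMeasure]

/-- The rescaled kernel `ε⁻ᵈ ρ(x / ε)`. -/
noncomputable def scaleKernel (ε : ℝ) (ρ : X → ℝ) (y : X) : ℝ :=
  (ε ^ Module.finrank ℝ X)⁻¹ * ρ (ε⁻¹ • y)

theorem integral_scale {ε : ℝ} (hε : 0 < ε) (g : X → ℝ) :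
    ∫ y, (ε ^ Module.finrank ℝ X)⁻¹ * g (ε⁻¹ • y) = ∫ y, g y := by
  rw [integral_const_mul, Measure.integral_comp_inv_smul_of_nonneg _ _ hε.le, smul_eq_mul,
    ← mul_assoc, inv_mul_cancel₀ (by positivity), one_mul]

variable {ρ : X → ℝ} {ε : ℝ}

theorem contDiff_scaleKernel (hρ : ContDiff ℝ ∞ ρ) : ContDiff ℝ ∞ (scaleKernel ε ρ) :=
  contDiff_const.mul (hρ.comp (contDiff_const.smul contDiff_id))

theorem tsupport_scaleKernel_subset (hε : 0 < ε) {r R : ℝ}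
    (hR : tsupport ρ ⊆ Metric.closedBall 0 R) (hr : ε * R < r) :
    tsupport (scaleKernel ε ρ) ⊆ Metric.ball 0 r ∧ HasCompactSupport (scaleKernel ε ρ) := by
  have h1 : tsupport (scaleKernel ε ρ) ⊆ Metric.closedBall 0 (ε * R) := by
    refine closure_minimal (fun y hy => ?_) Metric.isClosed_closedBall
    have := hR (subset_tsupport _ (right_ne_zero_of_mul hy))
    rw [mem_closedBall_zero_iff, norm_smul, norm_inv, Real.norm_eq_abs, abs_of_pos hε,
      inv_mul_le_iff₀ hε] at this
    simpa using this
  exact ⟨h1.trans (Metric.closedBall_subset_ball hr),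
    (isCompact_closedBall _ _).of_isClosed_subset (isClosed_tsupport _) h1⟩

theorem integral_scaleKernel (hε : 0 < ε) : ∫ y, scaleKernel ε ρ y = ∫ y, ρ y :=
  integral_scale hε ρ

theorem integral_abs_scaleKernel (hε : 0 < ε) : ∫ y, |scaleKernel ε ρ y| = ∫ y, |ρ y| := by
  rw [← integral_scale hε fun y => |ρ y|]
  refine integral_congr_ae (Eventually.of_forall fun y => ?_)
  simp only [scaleKernel]
  rw [abs_mul, abs_of_pos (by positivity : 0 < (ε ^ Module.finrank ℝ X)⁻¹)]

/-- The gradient gains a factor `ε⁻¹` and `M z` loses it. Hence Alberti's kernels may be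
concentrated at the origin without spoiling their flux. -/
theorem kernelFlux_scaleKernel (hρ : ContDiff ℝ ∞ ρ) (hε : 0 < ε) (M : X →L[ℝ] X) :
    kernelFlux (scaleKernel ε ρ) M = kernelFlux ρ M := by
  rw [kernelFlux, kernelFlux, ← integral_scale hε fun y => |fderiv ℝ ρ y (M y)|]
  refine integral_congr_ae (Eventually.of_forall fun y => ?_)
  have hd : HasFDerivAt (scaleKernel ε ρ) ((ε ^ Module.finrank ℝ X)⁻¹ •
      (fderiv ℝ ρ (ε⁻¹ • y)).comp (ε⁻¹ • ContinuousLinearMap.id ℝ X)) y :=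
    (((hρ.differentiable (by simp)) (ε⁻¹ • y)).hasFDerivAt.comp y
      ((hasFDerivAt_id y).const_smul ε⁻¹)).const_mul _
  simp only
  rw [hd.fderiv]
  simp only [_root_.smul_apply, ContinuousLinearMap.comp_apply,
    ContinuousLinearMap.id_apply, smul_eq_mul, map_smul]
  rw [abs_mul, abs_of_pos (by positivity : 0 < (ε ^ Module.finrank ℝ X)⁻¹)]

end Scaling

/-! ### Matrices, linear maps and traces. -/

section Matrices

variable {d : ℕ}

/-- The linear map of a matrix. -/
noncomputable def matToCLM : Mat d →ₗ[ℝ] (Space d →L[ℝ] Space d) :=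
  ∑ ij : Fin d × Fin d, (EuclideanSpace.proj (𝕜 := ℝ) ij : Mat d →L[ℝ] ℝ).toLinearMap.smulRight
    ((EuclideanSpace.proj (𝕜 := ℝ) ij.2 : Space d →L[ℝ] ℝ).smulRight (basisVec ij.1))

theorem eq_sum_smul_basisVec (v : Space d) : v = ∑ j, v j • basisVec j := by
  have := (EuclideanSpace.basisFun (Fin d) ℝ).sum_repr v
  simpa [basisVec] using this.symm

theorem matToCLM_spaceGrad (V : Space d × ℝ → Space d) (x : Space d × ℝ) :
    matToCLM (spaceGrad V x) = spaceDeriv V x := by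
  ext1 v
  conv_rhs => rw [eq_sum_smul_basisVec v]
  simp only [matToCLM, LinearMap.sum_apply, LinearMap.smulRight_apply, _root_.sum_apply,
    _root_.smul_apply, ContinuousLinearMap.smulRight_apply, map_sum, map_smul]
  rw [Fintype.sum_prod_type, Finset.sum_comm]
  refine Finset.sum_congr rfl fun j _ => ?_
  rw [eq_sum_smul_basisVec (spaceDeriv V x (basisVec j)), Finset.smul_sum]
  refine Finset.sum_congr rfl fun i _ => ?_
  rw [smul_comm]
  rfl

theorem trace_spaceDeriv (V : Space d × ℝ → Space d) (x : Space d × ℝ) :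
    LinearMap.trace ℝ (Space d) (spaceDeriv V x)
      = ∑ j, (fderiv ℝ V x (basisVec j, 0)) j := by
  rw [LinearMap.trace_eq_matrix_trace ℝ (EuclideanSpace.basisFun (Fin d) ℝ).toBasis, Matrix.trace]
  refine Finset.sum_congr rfl fun j _ => ?_
  simp [LinearMap.toMatrix_apply, spaceDeriv, basisVec]

/-- The trace-free part of the linear map of a matrix. -/
noncomputable def traceFree : Mat d →L[ℝ] (Space d →L[ℝ] Space d) :=
  LinearMap.toContinuousLinearMap (matToCLM - ((d : ℝ)⁻¹ •
    (LinearMap.trace ℝ (Space d) ∘ₗ ContinuousLinearMap.coeLM ℝ ∘ₗ matToCLM)).smulRight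
      (ContinuousLinearMap.id ℝ (Space d)))

theorem traceFree_apply (M : Mat d) : traceFree M = matToCLM M -
    ((d : ℝ)⁻¹ * LinearMap.trace ℝ (Space d) (matToCLM M)) • ContinuousLinearMap.id ℝ (Space d) :=
  rfl

theorem trace_traceFree (M : Mat d) : LinearMap.trace ℝ (Space d) (traceFree M) = 0 := by
  rw [traceFree_apply]
  simp only [ContinuousLinearMap.toLinearMap_sub, ContinuousLinearMap.toLinearMap_smul, map_sub, map_smul,
    ContinuousLinearMap.coe_id, LinearMap.trace_id, finrank_euclideanSpace, Fintype.card_fin,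
    smul_eq_mul]
  -- In dimension zero `d⁻¹` is `0`, but then every operator vanishes.
  rcases Nat.eq_zero_or_pos d with rfl | hd
  · have : ((matToCLM M : Space 0 →L[ℝ] Space 0) : Space 0 →ₗ[ℝ] Space 0) = 0 :=
      LinearMap.ext fun v => Subsingleton.elim _ _
    rw [this]; simp
  · have : (d : ℝ) ≠ 0 := by positivity
    field_simp
    ring

end Matrices

/-! ### The local energy identity. -/

section EnergyIdentity

variable {d : ℕ} {W : Set (Space d × ℝ)} {L : ℝ} {U : Space d × ℝ → Space d}
  {q : Space d × ℝ → ℝ} {φ : Space d × ℝ → ℝ}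

/-- The flux of a kernel along a trace-free gradient close to a given polar direction. -/
theorem kernelFlux_le_of_polar {ρ : Space d → ℝ} (hρ : ContDiff ℝ ∞ ρ) (hρc : HasCompactSupport ρ)
    {G P : Mat d} {l : ℝ} (hG : LinearMap.trace ℝ (Space d) (matToCLM G) = 0)
    (hP : kernelFlux ρ (traceFree P) ≤ l) :
    kernelFlux ρ (matToCLM G) ≤ l * ‖G‖ + (∫ z, ‖fderiv ℝ ρ z‖ * ‖z‖) *
      (‖(traceFree : Mat d →L[ℝ] _)‖ * ‖‖G‖ • P - G‖) := by
  have e1 : matToCLM G = traceFree G := by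
    ext1 v
    simp [traceFree_apply, hG]
  -- The main term has small flux by `hP`. The approximate direction `P` need not be trace-free,
  -- which is why everything is projected first.
  have e2 : traceFree G = ‖G‖ • traceFree P + -traceFree (‖G‖ • P - G) := by
    rw [map_sub, map_smul]; abel
  rw [e1, e2]
  refine (kernelFlux_add_le hρ hρc _ _).trans (add_le_add ?_ ?_)
  · rw [kernelFlux_smul, abs_norm, mul_comm]
    exact mul_le_mul_of_nonneg_right hP (norm_nonneg _)
  · refine (kernelFlux_le hρ hρc _).trans ?_
    rw [norm_neg]
    exact mul_le_mul_of_nonneg_left (ContinuousLinearMap.le_opNorm _ _)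
      (integral_nonneg fun z => by positivity)

theorem kernelFlux_matToCLM_le {ρ : Space d → ℝ} (hρ : ContDiff ℝ ∞ ρ)
    (hρc : HasCompactSupport ρ) (G : Mat d) :
    kernelFlux ρ (matToCLM G) ≤ (∫ z, ‖fderiv ℝ ρ z‖ * ‖z‖) *
      (‖LinearMap.toContinuousLinearMap (matToCLM (d := d))‖ * ‖G‖) := by
  refine (kernelFlux_le hρ hρc _).trans (mul_le_mul_of_nonneg_left ?_
    (integral_nonneg fun z => by positivity))
  exact ContinuousLinearMap.le_opNorm (LinearMap.toContinuousLinearMap (matToCLM (d := d))) G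

/-- A smooth partition of unity adapted to the direction of a matrix field. -/
theorem exists_adapted_partition {s : Set (Space d → ℝ)} [Fintype s] {l : ℝ}
    (hsm : ∀ i : s, ContDiff ℝ ∞ (i : Space d → ℝ))
    (hsc : ∀ i : s, HasCompactSupport (i : Space d → ℝ))
    (hcov : ∀ M : Space d →L[ℝ] Space d, ‖M‖ ≤ ‖(traceFree : Mat d →L[ℝ] _)‖ →
      LinearMap.trace ℝ (Space d) M = 0 → ∃ ρ ∈ s, kernelFlux ρ M < l)
    {Φ : Space d × ℝ → Mat d} (hΦ : Continuous Φ) (hΦ1 : ∀ z, ‖Φ z‖ ≤ 1) :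
    ∃ f : s → Space d × ℝ → ℝ, (∀ i, ContDiff ℝ ∞ (f i)) ∧ (∀ i x, 0 ≤ f i x) ∧
      (∀ i, tsupport (f i) ⊆ {z | kernelFlux (i : Space d → ℝ) (traceFree (Φ z)) < l}) ∧
      ∀ x, ∑ i, f i x = 1 := by
  have hc : ∀ i : s, Continuous fun z => kernelFlux (i : Space d → ℝ) (traceFree (Φ z)) :=
    fun i => (continuous_kernelFlux (hsm i) (hsc i)).comp (traceFree.continuous.comp hΦ)
  refine exists_smooth_partition (fun i => isOpen_lt (hc i) continuous_const) fun z => ?_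
  obtain ⟨ρ, hρ, hlt⟩ := hcov (traceFree (Φ z))
    ((traceFree.le_opNorm _).trans (mul_le_of_le_one_right (norm_nonneg _) (hΦ1 z)))
    (trace_traceFree _)
  exact ⟨⟨ρ, hρ⟩, hlt⟩

theorem mul_div_add_one_le {C l : ℝ} (hC : 0 ≤ C) (hl : 0 ≤ l) : C * (l / (C + 1)) ≤ l := by
  rw [mul_div_assoc', div_le_iff₀ (by positivity)]
  nlinarith

theorem sum_integral_partition {ι X : Type*} [Fintype ι] [MeasureSpace X] {χ g k : X → ℝ}
    {f : ι → X → ℝ} {c : ι → ℝ} {B l C₁ m n : ℝ} (hf : ∀ x, ∑ i, f i x = 1)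
    (hi : ∀ i, Integrable fun x => χ x * (f i x * (B * (l * g x + C₁ * k x)) + m * (c i * n * g x)))
    (hg : Integrable fun x => χ x * g x) (hk : Integrable fun x => χ x * k x) :
    ∑ i, ∫ x, χ x * (f i x * (B * (l * g x + C₁ * k x)) + m * (c i * n * g x))
      = B * (l * (∫ x, χ x * g x) + C₁ * ∫ x, χ x * k x)
        + m * (((∑ i, c i) * n) * ∫ x, χ x * g x) := by
  have e : ∀ x, ∑ i, χ x * (f i x * (B * (l * g x + C₁ * k x)) + m * (c i * n * g x))
      = (B * l + m * ((∑ i, c i) * n)) * (χ x * g x) + B * C₁ * (χ x * k x) := fun x => by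
    rw [← Finset.mul_sum, Finset.sum_add_distrib, ← Finset.sum_mul, hf, one_mul,
      ← Finset.mul_sum, ← Finset.sum_mul, ← Finset.sum_mul]
    ring
  rw [← integral_finsetSum _ fun i _ => hi i]
  simp_rw [e]
  rw [integral_add (hg.const_mul _) (hk.const_mul _), integral_const_mul, integral_const_mul]
  ring

-- The parameters are chosen in the order: level `l`, finite family of kernels, smooth direction
-- field `Φ`, partition of unity, cutoff `χ`, scales of the kernels, and last one mollifier common
-- to all pieces. The constant `K` depends on `L`, `sup |φ|` and the variation, but not on the
-- kernels, whose constants blow up as `l` tends to `0`.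
set_option maxHeartbeats 1000000 in
theorem LocalEuler.abs_energyForm_le_mul (h : LocalEuler W L U q) (hW : IsOpen W)
    (hV : ∃ V, VariationLE U W V) (hφ : IsTestFunction W φ) :
    ∃ K, ∀ l > 0, |energyForm U q φ| ≤ l * K := by
  obtain ⟨V, hV0, HV⟩ := exists_polar_approximation h.measurable h.integrable h.bound hW hV
  obtain ⟨B, hB0, hB⟩ := exists_norm_le_of_hasCompactSupport hφ.hasCompactSupport hφ.continuous
  refine ⟨1 + L ^ 2 * (B * (V + 1) + V), fun l hl => ?_⟩
  obtain ⟨s, hsf, hs, hcov⟩ := exists_finite_kernels (X := Space d)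
    ‖(traceFree : Mat d →L[ℝ] _)‖ hl
  have : Fintype s := hsf.fintype
  have hsm : ∀ i : s, ContDiff ℝ ∞ (i : Space d → ℝ) := fun i => (hs i i.2).1
  have hsc : ∀ i : s, HasCompactSupport (i : Space d → ℝ) := fun i => (hs i i.2).2.1
  set c : s → ℝ := fun i => ∫ z, ‖fderiv ℝ (i : Space d → ℝ) z‖ * ‖z‖ with hc
  have hc0 : ∀ i, 0 ≤ c i := fun i => integral_nonneg fun z => by positivity
  set n₁ := ‖(traceFree : Mat d →L[ℝ] _)‖
  set n₂ := ‖LinearMap.toContinuousLinearMap (matToCLM (d := d))‖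
  set C₁ : ℝ := (∑ i, c i) * n₁ with hC₁
  set C₂ : ℝ := (∑ i, c i) * n₂ with hC₂
  have hsum0 : 0 ≤ ∑ i, c i := Finset.sum_nonneg fun i _ => hc0 i
  have hn₁ : 0 ≤ n₁ := norm_nonneg (traceFree : Mat d →L[ℝ] _)
  have hn₂ : 0 ≤ n₂ := norm_nonneg (LinearMap.toContinuousLinearMap (matToCLM (d := d)))
  have hC₁0 : 0 ≤ C₁ := mul_nonneg hsum0 hn₁
  have hC₂0 : 0 ≤ C₂ := mul_nonneg hsum0 hn₂
  clear_value C₁ C₂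
  -- The kernels are already fixed, so their total constant `C₁` can be compensated in the accuracy
  -- of the polar approximation.
  obtain ⟨Φ, hΦ, hΦ1, HΦ⟩ := HV (l / (C₁ + 1)) (by positivity)
  -- a partition of unity adapted to the direction of the gradient
  obtain ⟨f, hfs, hf0, hfO, hf1⟩ := exists_adapted_partition hsm hsc hcov hΦ.continuous hΦ1
  set ψ : s → Space d × ℝ → ℝ := fun i z => φ z * f i z with hψdef
  have hψ : ∀ i, IsTestFunction W (ψ i) := fun i => hφ.smul (hfs i)
  have hψsum : (fun z => ∑ i, ψ i z) = φ := by
    ext z; simp only [hψdef, ← Finset.mul_sum, hf1, mul_one]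
  have hEsum : energyForm U q φ = ∑ i, energyForm U q (ψ i) := by
    have := (h.energyForm_sum Finset.univ ψ fun i _ => hψ i).1
    rwa [hψsum] at this
  -- the cutoff
  obtain ⟨χ, hχ, hχ0, hχ1, r₁, hr₁, hχr⟩ := exists_cutoff
    (hφ.hasCompactSupport.isCompact.union hΦ.hasCompactSupport.isCompact) hW
    (union_subset hφ.tsupport_subset hΦ.tsupport_subset)
  have hψφ : ∀ i, tsupport (ψ i) ⊆ tsupport φ := fun i =>
    closure_mono fun x hx => left_ne_zero_of_mul hx
  obtain ⟨r₂, hr₂, H₂⟩ := HΦ χ hχ hχ0 hχ1 fun z hz => by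
    simpa using hχr z (Or.inr hz) 0 (Metric.mem_ball_self hr₁)
  obtain ⟨r₃, hr₃, H₃⟩ := exists_add_mem_of_isCompact hφ.hasCompactSupport.isCompact hW
    hφ.tsupport_subset
  obtain ⟨N, hN⟩ : ∃ N : ℝ, N = (Fintype.card s : ℝ) := ⟨_, rfl⟩
  have hN0 : 0 ≤ N := hN ▸ Nat.cast_nonneg _
  -- The value of `m` in the increment estimate, small enough to absorb the crude flux bound summed
  -- over all kernels.
  have hm0 : 0 < l / (C₂ + 1) := by positivity
  have hη : ∀ i : s, ∃ η > 0, ∀ κ, IsMollifier η κ → |energyForm U q (ψ i)| ≤ l / (N + 1) +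
      L ^ 2 * ∫ x, (|ψ i x| + l / (C₂ + 1)) * χ x *
        kernelFlux (i : Space d → ℝ) (spaceDeriv (moll κ U) x) := fun i => by
    obtain ⟨r, hr, H⟩ := h.abs_energyForm_le_kernelFlux hW (hψ i) hχ.continuous
      hχ.hasCompactSupport hχ0 hr₁ (fun x hx => hχr x (Or.inl (hψφ i hx))) hm0
      (show 0 < l / (N + 1) by positivity)
      (C := ∫ y, |(i : Space d → ℝ) y|) (integral_nonneg fun _ => abs_nonneg _)
    obtain ⟨R, hR0, hR⟩ := (hsc i).isCompact.isBounded.subset_closedBall_lt 0 (0 : Space d)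
    -- Rescaling by this factor shrinks the support from radius `R` to `r / 2`, with the same
    -- integral, `L¹` norm and flux.
    have hε : 0 < r / (2 * R) := by positivity
    obtain ⟨t1, t2⟩ := tsupport_scaleKernel_subset hε hR (r := r) (by
      rw [div_mul_eq_mul_div, div_lt_iff₀ (by positivity)]; nlinarith)
    obtain ⟨η, hη, Hη⟩ := H (scaleKernel (r / (2 * R)) i) (contDiff_scaleKernel (hsm i)) t2 t1
      ((integral_scaleKernel hε).trans (hs i i.2).2.2) (integral_abs_scaleKernel hε).le
    refine ⟨η, hη, fun κ hκ => ?_⟩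
    have := Hη κ hκ
    simp_rw [kernelFlux_scaleKernel (hsm i) hε] at this
    exact this
  choose η hη0 Hη using hη
  obtain ⟨r, hr, hrη, hr2, hr3⟩ : ∃ r > 0, (∀ i, r ≤ η i) ∧ r ≤ r₂ ∧ r ≤ r₃ := by
    obtain ⟨r, hr, hle⟩ : ∃ r > 0, ∀ i, r ≤ η i := by
      rcases isEmpty_or_nonempty s with he | hne
      · exact ⟨1, one_pos, fun i => he.elim i⟩
      · obtain ⟨i, hi⟩ := Finite.exists_min η
        exact ⟨η i, hη0 i, hi⟩
    exact ⟨min r (min r₂ r₃), lt_min hr (lt_min hr₂ hr₃),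
      fun i => (min_le_left _ _).trans (hle i), (min_le_right _ _).trans (min_le_left _ _),
      (min_le_right _ _).trans (min_le_right _ _)⟩
  obtain ⟨κ, hκ⟩ := exists_isMollifier (G := Space d × ℝ) hr
  obtain ⟨bV, bP⟩ := H₂ κ (hκ.mono hr2)
  set G := spaceGrad (moll κ U) with hG
  have hGc : Continuous G := (contDiff_spaceGrad
    (contDiff_moll hκ.smooth hκ.hasCompactSupport h.integrable.locallyIntegrable)).continuous
  have hGD : ∀ x, spaceDeriv (moll κ U) x = matToCLM (G x) := fun x => (matToCLM_spaceGrad _ _).symm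
  have hχ_int : ∀ g : Space d × ℝ → ℝ, Continuous g → Integrable fun x => χ x * g x := fun g hg =>
    (hχ.continuous.mul hg).integrable_of_hasCompactSupport hχ.hasCompactSupport.mul_right
  set g : Space d × ℝ → ℝ := fun x => ‖G x‖ with hg
  set k : Space d × ℝ → ℝ := fun x => ‖‖G x‖ • Φ x - G x‖ with hk
  have hgc : Continuous g := hGc.norm
  have hkc : Continuous k := ((hGc.norm.smul hΦ.continuous).sub hGc).norm
  have hpt : ∀ (i : s) x, (|ψ i x| + l / (C₂ + 1)) * χ x *
      kernelFlux (i : Space d → ℝ) (spaceDeriv (moll κ U) x)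
      ≤ χ x * (f i x * (B * (l * g x + C₁ * k x)) + l / (C₂ + 1) * (c i * n₂ * g x)) := by
    intro i x
    -- On the support of the `i`-th piece the direction `Φ x` has flux below `l` for the `i`-th
    -- kernel. The gradient there is trace-free because the mollified velocity is divergence-free
    -- near the support of `φ`.
    have q1 : |ψ i x| * kernelFlux (i : Space d → ℝ) (matToCLM (G x))
        ≤ f i x * (B * (l * g x + C₁ * k x)) := by
      by_cases hx : x ∈ tsupport (ψ i)
      · have hxφ := hψφ i hx
        have htr : LinearMap.trace ℝ (Space d) (matToCLM (G x)) = 0 := by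
          rw [← hGD, trace_spaceDeriv]
          refine h.divergence_moll_eq_zero hκ.smooth hκ.hasCompactSupport fun w hw => ?_
          rw [sub_eq_add_neg]
          refine H₃ x hxφ _ ?_
          simpa using (hκ.mono hr3).tsupport_subset hw
        have hP : kernelFlux (i : Space d → ℝ) (traceFree (Φ x)) ≤ l :=
          le_of_lt (hfO i (tsupport_smul_subset_right φ (f i) hx))
        have b1 := kernelFlux_le_of_polar (hsm i) (hsc i) htr hP
        have b2 : kernelFlux (i : Space d → ℝ) (matToCLM (G x)) ≤ l * g x + C₁ * k x := by
          refine b1.trans (add_le_add_right ?_ _)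
          have hci : c i ≤ ∑ j, c j := Finset.single_le_sum (fun j _ => hc0 j) (Finset.mem_univ i)
          calc c i * (n₁ * k x) = (c i * n₁) * k x := by ring
            _ ≤ C₁ * k x := by
                refine mul_le_mul_of_nonneg_right ?_ (norm_nonneg _)
                exact hC₁ ▸ mul_le_mul_of_nonneg_right hci hn₁
        have b3 : |ψ i x| ≤ f i x * B := by
          simp only [hψdef, abs_mul, abs_of_nonneg (hf0 i x)]
          rw [mul_comm]
          exact mul_le_mul_of_nonneg_left (hB x) (hf0 i x)
        calc _ ≤ (f i x * B) * (l * g x + C₁ * k x) :=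
              mul_le_mul b3 b2 (integral_nonneg fun _ => abs_nonneg _)
                (mul_nonneg (hf0 i x) hB0)
          _ = _ := by ring
      · rw [image_eq_zero_of_notMem_tsupport hx, abs_zero, zero_mul]
        have : 0 ≤ g x := norm_nonneg _
        have : 0 ≤ k x := norm_nonneg _
        exact mul_nonneg (hf0 i x) (by positivity)
    -- Off that support nothing is known about the direction; this crude bound is used only with the
    -- small weight `m`.
    have q2 : kernelFlux (i : Space d → ℝ) (matToCLM (G x)) ≤ c i * n₂ * g x := by
      refine (kernelFlux_matToCLM_le (hsm i) (hsc i) (G x)).trans (le_of_eq ?_)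
      simp only [hc, hg, n₂]; ring
    rw [hGD]
    calc _ = χ x * (|ψ i x| * kernelFlux (i : Space d → ℝ) (matToCLM (G x))
          + l / (C₂ + 1) * kernelFlux (i : Space d → ℝ) (matToCLM (G x))) := by ring
      _ ≤ _ := mul_le_mul_of_nonneg_left (add_le_add q1
          (mul_le_mul_of_nonneg_left q2 hm0.le)) (hχ0 x)
  have hbig : ∀ i : s, Integrable fun x =>
      χ x * (f i x * (B * (l * g x + C₁ * k x)) + l / (C₂ + 1) * (c i * n₂ * g x)) := fun i =>
    hχ_int _ (((hfs i).continuous.mul (continuous_const.mul ((continuous_const.mul hgc).add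
      (continuous_const.mul hkc)))).add (continuous_const.mul (continuous_const.mul hgc)))
  have hone : ∀ i : s, |energyForm U q (ψ i)| ≤ l / (N + 1) + L ^ 2 * ∫ x,
      χ x * (f i x * (B * (l * g x + C₁ * k x)) + l / (C₂ + 1) * (c i * n₂ * g x)) := fun i => by
    refine (Hη i κ (hκ.mono (hrη i))).trans (add_le_add_right
      (mul_le_mul_of_nonneg_left ?_ (sq_nonneg L)) _)
    refine integral_mono_of_nonneg (Eventually.of_forall fun x => ?_) (hbig i)
      (Eventually.of_forall (hpt i))
    exact mul_nonneg (mul_nonneg (by positivity) (hχ0 x)) (integral_nonneg fun _ => abs_nonneg _)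
  have bV' : ∫ x, χ x * g x ≤ V := bV
  have bP' : ∫ x, χ x * k x ≤ l / (C₁ + 1) := bP
  clear_value g k c n₁ n₂
  have hsumint : ∑ i : s, ∫ x,
      χ x * (f i x * (B * (l * g x + C₁ * k x)) + l / (C₂ + 1) * (c i * n₂ * g x))
      = B * (l * (∫ x, χ x * g x) + C₁ * ∫ x, χ x * k x)
        + l / (C₂ + 1) * (C₂ * ∫ x, χ x * g x) := by
    refine (sum_integral_partition hf1 hbig (hχ_int g hgc) (hχ_int k hkc)).trans ?_
    rw [← hC₂]
  have hP2 : l / (C₂ + 1) * (C₂ * V) ≤ l * V := by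
    rw [← mul_assoc, mul_comm _ C₂]
    exact mul_le_mul_of_nonneg_right (mul_div_add_one_le hC₂0 hl.le) hV0
  calc |energyForm U q φ| ≤ ∑ i : s, |energyForm U q (ψ i)| := by
        rw [hEsum]; exact Finset.abs_sum_le_sum_abs _ _
    _ ≤ ∑ i : s, (l / (N + 1) + L ^ 2 * ∫ x,
      χ x * (f i x * (B * (l * g x + C₁ * k x)) + l / (C₂ + 1) * (c i * n₂ * g x))) :=
        Finset.sum_le_sum fun i _ => hone i
    _ = N * (l / (N + 1)) + L ^ 2 * (B * (l * (∫ x, χ x * g x) + C₁ * ∫ x, χ x * k x)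
        + l / (C₂ + 1) * (C₂ * ∫ x, χ x * g x)) := by
        rw [Finset.sum_add_distrib, ← Finset.mul_sum, hsumint]
        simp [hN]
    _ ≤ l + L ^ 2 * (B * (l * V + l) + l * V) := by
        refine add_le_add (mul_div_add_one_le hN0 hl.le)
          (mul_le_mul_of_nonneg_left (add_le_add ?_ ?_) (sq_nonneg L))
        · refine mul_le_mul_of_nonneg_left (add_le_add ?_ ?_) hB0
          · exact mul_le_mul_of_nonneg_left bV' hl.le
          · exact (mul_le_mul_of_nonneg_left bP' hC₁0).trans (mul_div_add_one_le hC₁0 hl.le)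
        · exact le_trans (mul_le_mul_of_nonneg_left (mul_le_mul_of_nonneg_left bV' hC₂0)
            hm0.le) hP2
    _ = l * (1 + L ^ 2 * (B * (V + 1) + V)) := by ring

/-- Bounded divergence-free `BV` solutions satisfy the local energy balance. -/
theorem LocalEuler.energyForm_eq_zero (h : LocalEuler W L U q) (hW : IsOpen W)
    (hV : ∃ V, VariationLE U W V) (hφ : IsTestFunction W φ) : energyForm U q φ = 0 := by
  obtain ⟨K, hK⟩ := h.abs_energyForm_le_mul hW hV hφ
  have ht : Tendsto (fun l : ℝ => l * K) (𝓝[>] 0) (𝓝 0) := by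
    have : Tendsto (fun l : ℝ => l * K) (𝓝 0) (𝓝 (0 * K)) := tendsto_id.mul_const K
    rw [zero_mul] at this
    exact this.mono_left nhdsWithin_le_nhds
  exact abs_nonpos_iff.1 (ge_of_tendsto ht (eventually_mem_nhdsWithin.mono fun l hl => hK l hl))

end EnergyIdentity

/-! ### Time slices of space-time objects. -/

section Slices

theorem ae_ae_swap {α β : Type*} [MeasurableSpace α] [MeasurableSpace β] {μ : Measure α}
    {ν : Measure β} [SFinite μ] [SFinite ν] {P : α × β → Prop} (h : ∀ᵐ z ∂μ.prod ν, P z) :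
    ∀ᵐ y ∂ν, ∀ᵐ x ∂μ, P (x, y) :=
  Measure.ae_ae_of_ae_prod (Measure.measurePreserving_swap.quasiMeasurePreserving.ae h)

/-- No integrability is needed: otherwise the left side is zero by the convention for the integral.
-/
theorem ofReal_integral_le {α : Type*} [MeasurableSpace α] {μ : Measure α} (f : α → ℝ) :
    ENNReal.ofReal (∫ x, f x ∂μ) ≤ ∫⁻ x, ENNReal.ofReal (f x) ∂μ := by
  by_cases hf : Integrable f μ
  · rw [integral_eq_lintegral_pos_part_sub_lintegral_neg_part hf]
    refine (ENNReal.ofReal_le_ofReal (sub_le_self _ ENNReal.toReal_nonneg)).trans ?_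
    exact ENNReal.ofReal_toReal_le
  · simp [integral_undef hf]

variable {d : ℕ} {F : Type*} [NormedAddCommGroup F] [NormedSpace ℝ F]

theorem fderiv_slice {φ : Space d × ℝ → F} {x : Space d} {t : ℝ}
    (hφ : DifferentiableAt ℝ φ (x, t)) (v : Space d) :
    fderiv ℝ (fun y => φ (y, t)) x v = fderiv ℝ φ (x, t) (v, 0) := by
  have h : HasFDerivAt (fun y => φ (y, t))
      ((fderiv ℝ φ (x, t)).comp (ContinuousLinearMap.inl ℝ (Space d) ℝ)) x :=
    hφ.hasFDerivAt.comp x (hasFDerivAt_prodMk_left x t)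
  rw [h.fderiv]
  rfl

theorem IsTestFunction.slice {φ : Space d × ℝ → F} {O : Set (Space d)} {I : Set ℝ}
    (h : IsTestFunction (O ×ˢ I) φ) (t : ℝ) : IsTestFunction O fun x => φ (x, t) := by
  have hc : IsCompact (Prod.fst '' tsupport φ) := h.hasCompactSupport.isCompact.image continuous_fst
  have hs : tsupport (fun x => φ (x, t)) ⊆ Prod.fst '' tsupport φ :=
    closure_minimal (fun x hx => ⟨(x, t), subset_tsupport _ hx, rfl⟩) hc.isClosed
  refine ⟨h.smooth.comp (contDiff_id.prodMk contDiff_const),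
    hc.of_isClosed_subset (isClosed_tsupport _) hs, hs.trans ?_⟩
  rintro _ ⟨z, hz, rfl⟩
  exact (h.tsupport_subset hz).1

/-- This makes time slices of space-time test functions admissible in the orthogonality condition
for almost every time. -/
theorem IsTestFunction.isH1WithGradient {Ω : Set (Space d)} {η : Space d → ℝ}
    (h : IsTestFunction Ω η) : IsH1WithGradient Ω η (gradient η) := by
  have hg : gradient η = fun x => (InnerProductSpace.toDual ℝ (Space d)).symm (fderiv ℝ η x) := rfl
  have hgc : Continuous (gradient η) := by
    rw [hg]; exact (LinearIsometryEquiv.continuous _).comp h.continuous_fderiv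
  have hgs : HasCompactSupport (gradient η) := by
    rw [hg]; exact (h.hasCompactSupport.fderiv (𝕜 := ℝ)).comp_left (map_zero _)
  refine ⟨(h.continuous.memLp_of_hasCompactSupport h.hasCompactSupport).restrict _,
    (hgc.memLp_of_hasCompactSupport hgs).restrict _, fun ζ hζ j => ?_⟩
  have hcoord : ∀ x, gradient η x j = fderiv ℝ η x (basisVec j) := fun x => by
    rw [← inner_gradient_left, basisVec, EuclideanSpace.inner_single_right]
    simp
  have hint : ∀ f g : Space d → ℝ, Continuous f → Continuous g → HasCompactSupport f →
      Integrable fun x => f x * g x := fun f g hf hg' hfc =>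
    (hf.mul hg').integrable_of_hasCompactSupport hfc.mul_right
  have hz : ∀ x ∉ Ω, η x = 0 := fun x hx =>
    image_eq_zero_of_notMem_tsupport fun hn => hx (h.tsupport_subset hn)
  have hz' : ∀ x ∉ Ω, fderiv ℝ η x = 0 := fun x hx =>
    image_eq_zero_of_notMem_tsupport fun hn => hx (h.tsupport_subset (tsupport_fderiv_subset ℝ hn))
  simp_rw [hcoord]
  rw [setIntegral_eq_integral_of_forall_compl_eq_zero fun x hx => by rw [hz x hx, zero_mul],
    setIntegral_eq_integral_of_forall_compl_eq_zero fun x hx => by simp [hz' x hx]]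
  have hd : ∀ f : Space d → ℝ, IsTestFunction Ω f → Continuous fun x => fderiv ℝ f x (basisVec j) :=
    fun f hf => hf.continuous_fderiv.clm_apply continuous_const
  refine integral_mul_fderiv_eq_neg_fderiv_mul_of_integrable ?_
    (hint _ _ h.continuous (hd ζ hζ) h.hasCompactSupport)
    (hint _ _ h.continuous hζ.continuous h.hasCompactSupport)
    (fun x _ => h.differentiable x) fun x _ => hζ.differentiable x
  exact hint _ _ (hd η h) hζ.continuous (h.hasCompactSupport.fderiv_apply (𝕜 := ℝ) _)

end Slices

/-! ### Reduction to a local solution and the local energy balance. -/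

section Localization

variable {d : ℕ} {Ω O : Set (Space d)} {T a b : ℝ} {u : Space d → ℝ → Space d}
  {p : Space d → ℝ → ℝ} {U : Space d × ℝ → Space d}

/-- The divergence involves only spatial derivatives, so by Fubini the pairing is at most the time
integral of the slice variations. Measurability of the slice variation in time plays no role, since
only monotonicity of the lower integral is used. -/
theorem variationLE_of_memL1BV (hO : IsOpen O) (hu : MemL1BV u O (Ioo a b)) (hUi : Integrable U)
    (hU : ∀ᵐ z, U z = (O ×ˢ Ioo a b).indicator (fun z => u z.1 z.2) z) :
    ∃ V, VariationLE U (O ×ˢ Ioo a b) V := by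
  set TV : ℝ → ℝ≥0∞ := fun t => totalVariation (fun x => u x t) O with hTV
  have hfin : ∫⁻ t in Ioo a b, TV t < ⊤ :=
    (lintegral_mono fun t => le_add_self).trans_lt hu.norm_integrable
  refine ⟨(∫⁻ t in Ioo a b, TV t).toReal, fun Φ hΦ hΦ1 => ?_⟩
  rw [← ENNReal.ofReal_le_iff_le_toReal hfin.ne]
  obtain ⟨C, hC0, hC⟩ := exists_norm_le_of_hasCompactSupport (hasCompactSupport_matDiv
    hΦ.hasCompactSupport) (continuous_matDiv hΦ.smooth)
  have hint : Integrable fun z => inner ℝ (U z) (matDiv Φ z) := by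
    refine Integrable.mono' (hUi.norm.mul_const C) (hUi.aestronglyMeasurable.inner
      (continuous_matDiv hΦ.smooth).aestronglyMeasurable) (Eventually.of_forall fun z => ?_)
    exact (norm_inner_le_norm _ _).trans (mul_le_mul_of_nonneg_left (hC z) (norm_nonneg _))
  have hzero : ∀ z ∉ O ×ˢ Ioo a b, matDiv Φ z = 0 := fun z hz => by
    have : fderiv ℝ Φ z = 0 := image_eq_zero_of_notMem_tsupport fun hn =>
      hz (hΦ.tsupport_subset (tsupport_fderiv_subset ℝ hn))
    ext i
    simp [matDiv, this]
  rw [Measure.volume_eq_prod, integral_prod_symm _ hint]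
  rw [← setIntegral_eq_integral_of_forall_compl_eq_zero (s := Ioo a b) fun t ht => by
    refine integral_eq_zero_of_ae (Eventually.of_forall fun x => ?_)
    simp only [hzero (x, t) fun h => ht h.2, inner_zero_right, Pi.zero_apply]]
  refine (ofReal_integral_le _).trans (lintegral_mono_ae ?_)
  rw [Measure.volume_eq_prod] at hU
  filter_upwards [ae_restrict_of_ae (ae_ae_swap hU), ae_restrict_mem measurableSet_Ioo] with t ht htI
  -- The rows of the slice `Φ(·, t)`; the Frobenius bound on `Φ` is exactly the constraint in
  -- `totalVariation`.
  let R : Fin d → Space d → Space d := fun i x => WithLp.toLp 2 fun j => Φ (x, t) (i, j)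
  have hRi : ∀ i, R i = (LinearMap.toContinuousLinearMap
      ({ toFun := fun M => WithLp.toLp 2 fun j => M (i, j)
         map_add' := fun _ _ => rfl
         map_smul' := fun _ _ => rfl } : Mat d →ₗ[ℝ] Space d)) ∘ fun x => Φ (x, t) := fun i => rfl
  have hsl := hΦ.slice t
  have hR : ∀ i, IsTestFunction O (R i) := fun i => by
    rw [hRi]
    refine ⟨(ContinuousLinearMap.contDiff _).comp hsl.smooth,
      hsl.hasCompactSupport.comp_left (map_zero _),
      (closure_mono (Function.support_comp_subset (map_zero _) _)).trans hsl.tsupport_subset⟩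
  have hR1 : ∀ x, ∑ i, ‖R i x‖ ^ 2 ≤ 1 := fun x => by
    have h1 : ‖Φ (x, t)‖ ^ 2 ≤ 1 := pow_le_one₀ (norm_nonneg _) (hΦ1 _)
    rw [EuclideanSpace.norm_sq_eq, Fintype.sum_prod_type] at h1
    simpa only [R, EuclideanSpace.norm_sq_eq] using h1
  have hdiv : ∀ i x, divergence (R i) x = matDiv Φ (x, t) i := fun i x => by
    simp only [divergence, matDiv]
    refine Finset.sum_congr rfl fun j _ => ?_
    rw [hRi, fderiv_comp x (ContinuousLinearMap.differentiableAt _) (hsl.differentiable x),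
      ContinuousLinearMap.fderiv, ContinuousLinearMap.comp_apply,
      fderiv_slice (hΦ.differentiable _)]
    rfl
  have heq : ∫ x, inner ℝ (U (x, t)) (matDiv Φ (x, t))
      = ∫ x in O, ∑ i, u x t i * divergence (R i) x := by
    rw [← setIntegral_eq_integral_of_forall_compl_eq_zero (s := O) fun x hx => by
      rw [hzero (x, t) fun h => hx h.1, inner_zero_right]]
    refine setIntegral_congr_ae hO.measurableSet (ht.mono fun x hx hxO => ?_)
    rw [hx, indicator_of_mem (show (x, t) ∈ O ×ˢ Ioo a b from ⟨hxO, htI⟩), inner_eq_sum_mul]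
    simp only [hdiv]
  rw [heq, hTV]
  exact le_iSup₂_of_le R hR (le_iSup_of_le hR1 le_rfl)

/-- Velocity and pressure are extended by zero. Test functions supported in `O × (a, b)` do not see
the extension, so both equations persist there. -/
theorem exists_localEuler (hΩ : IsOpen Ω) (hEuler : IsWeakEulerSolution Ω T u p) (ha : 0 < a)
    (hb : b < T) (hO : OpenCompactlyIn O Ω)
    (hu_Linfty : MemLp (fun z : Space d × ℝ => u z.1 z.2) ∞ (volume.restrict (O ×ˢ Ioo a b)))
    (hp_L1 : MemLp (fun z : Space d × ℝ => p z.1 z.2) 1 (volume.restrict (O ×ˢ Ioo a b))) :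
    ∃ (L : ℝ) (U : Space d × ℝ → Space d) (q : Space d × ℝ → ℝ),
      LocalEuler (O ×ˢ Ioo a b) L U q ∧
      (∀ᵐ z, U z = (O ×ˢ Ioo a b).indicator (fun z => u z.1 z.2) z) ∧
      ∀ᵐ z, q z = (O ×ˢ Ioo a b).indicator (fun z => p z.1 z.2) z := by
  have hWo : IsOpen (O ×ˢ Ioo a b) := hO.1.prod isOpen_Ioo
  have hWm := hWo.measurableSet
  set f : Space d × ℝ → Space d := fun z => u z.1 z.2 with hf
  set g := hu_Linfty.1.mk f with hg
  set L := (eLpNorm f ∞ (volume.restrict (O ×ˢ Ioo a b))).toReal with hL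
  have hL0 : 0 ≤ L := ENNReal.toReal_nonneg
  have hgm : StronglyMeasurable g := hu_Linfty.1.stronglyMeasurable_mk
  have hfL : ∀ᵐ z ∂volume.restrict (O ×ˢ Ioo a b), ‖f z‖ ≤ L := by
    filter_upwards [ae_le_eLpNormEssSup (f := f) (μ := volume.restrict (O ×ˢ Ioo a b))] with z hz
    rw [← eLpNorm_exponent_top] at hz
    have := ENNReal.toReal_mono hu_Linfty.2.ne hz
    rwa [toReal_enorm] at this
  -- Cutting a measurable representative off where it exceeds its essential bound changes it on a
  -- null set only and makes the bound hold at every point.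
  set S := (O ×ˢ Ioo a b) ∩ {z | ‖g z‖ ≤ L} with hS
  have hSm : MeasurableSet S := hWm.inter (hgm.norm.measurable measurableSet_Iic)
  set U := S.indicator g with hUdef
  have hUm : StronglyMeasurable U := hgm.indicator hSm
  have hUL : ∀ z, ‖U z‖ ≤ L := fun z => by
    by_cases hz : z ∈ S
    · rw [hUdef, indicator_of_mem hz]; exact hz.2
    · rw [hUdef, indicator_of_notMem hz, norm_zero]; exact hL0
  have hU : ∀ᵐ z, U z = (O ×ˢ Ioo a b).indicator f z := by
    have h1 := (ae_restrict_iff' hWm).1 hu_Linfty.1.ae_eq_mk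
    have h2 := (ae_restrict_iff' hWm).1 hfL
    filter_upwards [h1, h2] with z h1 h2
    by_cases hz : z ∈ O ×ˢ Ioo a b
    · have h3 : z ∈ S := ⟨hz, by rw [mem_ofPred_eq, hg, ← h1 hz]; exact h2 hz⟩
      rw [hUdef, indicator_of_mem h3, indicator_of_mem hz, h1 hz]
    · rw [hUdef, indicator_of_notMem hz, indicator_of_notMem fun h => hz h.1]
  have hWfin : volume (O ×ˢ Ioo a b) < ⊤ := by
    rw [Measure.volume_eq_prod, Measure.prod_prod]
    exact ENNReal.mul_lt_top ((measure_mono subset_closure).trans_lt hO.2.1.measure_lt_top)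
      measure_Ioo_lt_top
  have hUi : Integrable U := by
    rw [hUdef, integrable_indicator_iff hSm]
    refine Measure.integrableOn_of_bounded (M := L) ((measure_mono inter_subset_left).trans_lt
      hWfin).ne hgm.aestronglyMeasurable ((ae_restrict_iff' hSm).2 (Eventually.of_forall
        fun z hz => hz.2))
  set q := (O ×ˢ Ioo a b).indicator (fun z : Space d × ℝ => p z.1 z.2) with hq
  have hqi : Integrable q := by
    rw [hq, integrable_indicator_iff hWm]
    exact memLp_one_iff_integrable.1 hp_L1
  have hsub : O ×ˢ Ioo a b ⊆ Ω ×ˢ Ioo 0 T := prod_mono (subset_closure.trans hO.2.2)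
    (Ioo_subset_Ioo ha.le hb.le)
  refine ⟨L, U, q, ⟨hUm, hUL, hUi, hqi, fun Ψ hΨ => ?_, fun η hη => ?_⟩, hU,
    Eventually.of_forall fun z => rfl⟩
  · have hz : ∀ z ∉ O ×ˢ Ioo a b, fderiv ℝ Ψ z = 0 := fun z hz =>
      image_eq_zero_of_notMem_tsupport fun hn =>
        hz (hΨ.tsupport_subset (tsupport_fderiv_subset ℝ hn))
    have hm := hEuler.momentum Ψ (hΨ.mono hsub)
    rw [setIntegral_eq_of_subset_of_forall_sdiff_eq_zero (hΩ.prod isOpen_Ioo).measurableSet hsub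
      fun z hz' => by simp [hz z hz'.2]] at hm
    rw [← setIntegral_eq_integral_of_forall_compl_eq_zero (s := O ×ˢ Ioo a b)
      fun z hz' => by simp [hz z hz']]
    refine Eq.trans (setIntegral_congr_ae hWm (hU.mono fun z h1 hz => ?_)) hm
    rw [h1, hq, indicator_of_mem hz, indicator_of_mem hz]
  · have hz : ∀ z ∉ O ×ˢ Ioo a b, fderiv ℝ η z = 0 := fun z hz =>
      image_eq_zero_of_notMem_tsupport fun hn =>
        hz (hη.tsupport_subset (tsupport_fderiv_subset ℝ hn))
    obtain ⟨C, hC0, hC⟩ := exists_norm_le_of_hasCompactSupport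
      (hη.hasCompactSupport.fderiv (𝕜 := ℝ)) hη.continuous_fderiv
    have hint : Integrable fun z => fderiv ℝ η z (U z, 0) := by
      refine Integrable.mono' (hUi.norm.const_mul C) ?_ (Eventually.of_forall fun z => ?_)
      · exact aestronglyMeasurable_clm_apply hη.continuous_fderiv.aestronglyMeasurable
          (hUm.prodMk stronglyMeasurable_const).aestronglyMeasurable
      · refine (ContinuousLinearMap.le_opNorm _ _).trans ?_
        rw [Prod.norm_mk, norm_zero, max_eq_left (norm_nonneg _)]
        exact mul_le_mul_of_nonneg_right (hC z) (norm_nonneg _)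
    rw [Measure.volume_eq_prod, integral_prod_symm _ hint]
    refine integral_eq_zero_of_ae ?_
    rw [Measure.volume_eq_prod] at hU
    filter_upwards [ae_ae_swap hU, (ae_restrict_iff' measurableSet_Ioo).1 hEuler.divFree_tangent]
      with t h1 h2
    by_cases ht : t ∈ Ioo a b
    · have hs : IsTestFunction Ω fun x => η (x, t) :=
        (hη.slice t).mono (subset_closure.trans hO.2.2)
      refine Eq.trans ?_ (h2 (Ioo_subset_Ioo ha.le hb.le ht) _ _ (hs.isH1WithGradient))
      simp_rw [inner_gradient_right]
      simp only [conj_trivial]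
      simp_rw [fderiv_slice (hη.differentiable _)]
      rw [setIntegral_eq_integral_of_forall_compl_eq_zero fun x hx => by
        rw [hz (x, t) fun h => hx (hO.2.2 (subset_closure h.1))]; rfl]
      refine integral_congr_ae (h1.mono fun x hx => ?_)
      simp only
      by_cases hxO : x ∈ O
      · rw [hx, indicator_of_mem (show (x, t) ∈ O ×ˢ Ioo a b from ⟨hxO, ht⟩)]
      · rw [hz (x, t) fun h => hxO h.1]; rfl
    · refine integral_eq_zero_of_ae (Eventually.of_forall fun x => ?_)
      simp only
      rw [hz (x, t) fun h => ht h.2]; rfl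

/-- The local energy balance `∂ₜ(|u|²/2) + div((|u|²/2 + p) u) = 0`. -/
theorem local_energy_balance (hΩ : IsOpen Ω) (hEuler : IsWeakEulerSolution Ω T u p) (ha : 0 < a)
    (hb : b < T) (hO : OpenCompactlyIn O Ω) (hu : MemL1BV u O (Ioo a b))
    (hu_Linfty : MemLp (fun z : Space d × ℝ => u z.1 z.2) ∞ (volume.restrict (O ×ˢ Ioo a b)))
    (hp_L1 : MemLp (fun z : Space d × ℝ => p z.1 z.2) 1 (volume.restrict (O ×ˢ Ioo a b)))
    {φ : Space d × ℝ → ℝ} (hφ : IsTestFunction (O ×ˢ Ioo a b) φ) :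
    ∫ z in O ×ˢ Ioo a b, (‖u z.1 z.2‖ ^ 2 / 2 * fderiv ℝ φ z (0, 1)
      + (‖u z.1 z.2‖ ^ 2 / 2 + p z.1 z.2) * fderiv ℝ φ z (u z.1 z.2, 0)) = 0 := by
  obtain ⟨L, U, q, h, hU, hq⟩ := exists_localEuler hΩ hEuler ha hb hO hu_Linfty hp_L1
  have hWo : IsOpen (O ×ˢ Ioo a b) := hO.1.prod isOpen_Ioo
  have h0 := h.energyForm_eq_zero hWo (variationLE_of_memL1BV hO.1 hu h.integrable hU) hφ
  have hz : ∀ z ∉ O ×ˢ Ioo a b, fderiv ℝ φ z = 0 := fun z hz =>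
    image_eq_zero_of_notMem_tsupport fun hn =>
      hz (hφ.tsupport_subset (tsupport_fderiv_subset ℝ hn))
  rw [energyForm, ← setIntegral_eq_integral_of_forall_compl_eq_zero (s := O ×ˢ Ioo a b)
    fun z hz' => by simp [commIntegrand, hz z hz']] at h0
  -- The energy form is twice the energy balance.
  refine Eq.trans ?_ ((integral_const_mul (1 / 2 : ℝ) _).trans (by rw [h0, mul_zero]))
  refine setIntegral_congr_ae hWo.measurableSet ?_
  filter_upwards [hU, hq] with z h1 h2 hz
  rw [commIntegrand, h1, h2, indicator_of_mem hz, indicator_of_mem hz, real_inner_self_eq_norm_sq,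
    show ((u z.1 z.2, (1 : ℝ)) : Space d × ℝ) = (u z.1 z.2, 0) + (0, 1) by simp, map_add]
  ring

end Localization

/-! ### Smooth approximation of Lipschitz functions. -/

section LipschitzApproximation

theorem moll_eq_convolution_left {G F : Type*} [NormedAddCommGroup G] [NormedSpace ℝ G]
    [FiniteDimensional ℝ G] [MeasureSpace G] [BorelSpace G]
    [(volume : Measure G).IsAddHaarMeasure] [NormedAddCommGroup F] [NormedSpace ℝ F]
    (κ : G → ℝ) (g : G → F) :
    moll κ g = convolution κ g (ContinuousLinearMap.lsmul ℝ ℝ (E := F)) volume := by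
  rw [moll_eq_convolution, convolution_flip]

variable {G : Type*} [NormedAddCommGroup G] [NormedSpace ℝ G] [FiniteDimensional ℝ G]
  [MeasureSpace G] [BorelSpace G] [(volume : Measure G).IsAddHaarMeasure] {f : G → ℝ} {K : ℝ≥0}

/-- Integration by parts for Lipschitz functions moves the derivative off the kernel. The derivative
of the mollification is then an average of line derivatives, hence bounded by the Lipschitz
constant. -/
theorem fderiv_moll_of_lipschitz (hf : LipschitzWith K f) {κ : G → ℝ} (hκ : ContDiff ℝ ∞ κ)
    (hκc : HasCompactSupport κ) (x v : G) :
    fderiv ℝ (moll κ f) x v = moll κ (fun y => lineDeriv ℝ f y v) x := by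
  rw [fderiv_moll hκ hκc hf.continuous.locallyIntegrable, moll]
  have hgd : ContDiff ℝ ∞ fun y => κ (x - y) := hκ.comp (contDiff_const.sub contDiff_id)
  have hgc : HasCompactSupport fun y => κ (x - y) :=
    hκc.comp_homeomorph (Homeomorph.subLeft x)
  obtain ⟨D, hD⟩ := hgd.lipschitzWith_of_hasCompactSupport hgc (by simp)
  have h := LipschitzWith.integral_lineDeriv_mul_eq (μ := volume) hf hD hgc v
  simp only [smul_eq_mul]
  rw [show (∫ y, κ (x - y) * lineDeriv ℝ f y v) = ∫ y, lineDeriv ℝ f y v * κ (x - y) from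
    integral_congr_ae (Eventually.of_forall fun y => mul_comm _ _), h]
  refine integral_congr_ae (Eventually.of_forall fun y => ?_)
  have hd : HasFDerivAt (fun y => κ (x - y)) ((fderiv ℝ κ (x - y)).comp
      (-ContinuousLinearMap.id ℝ G)) y :=
    ((hκ.differentiable (by simp)) (x - y)).hasFDerivAt.comp y ((hasFDerivAt_id y).const_sub x)
  simp only
  rw [hd.differentiableAt.lineDeriv_eq_fderiv, hd.fderiv]
  simp

/-- Smooth approximation of a compactly supported Lipschitz function. -/
theorem exists_smooth_approx (hf : LipschitzWith K f) (hfc : HasCompactSupport f) {O : Set G}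
    (hO : IsOpen O) (hfO : tsupport f ⊆ O) :
    ∃ c : ℕ → G → ℝ, (∀ n, IsTestFunction O (c n)) ∧
      (∀ n x, ‖fderiv ℝ (c n) x‖ ≤ K) ∧ (∀ B, (∀ x, ‖f x‖ ≤ B) → ∀ n x, ‖c n x‖ ≤ B) ∧
      (∀ x, Tendsto (fun n => c n x) atTop (𝓝 (f x))) ∧
      ∀ᵐ x, ∀ v, Tendsto (fun n => fderiv ℝ (c n) x v) atTop (𝓝 (fderiv ℝ f x v)) := by
  obtain ⟨r, hr, hrO⟩ := exists_add_mem_of_isCompact hfc.isCompact hO hfO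
  -- The ratio of outer to inner radius stays equal to `2`, as Lebesgue differentiation with bump
  -- kernels requires, and all supports lie within `r`.
  let φ : ℕ → ContDiffBump (0 : G) := fun n =>
    ⟨r / 4 * (1 / ((n : ℝ) + 1)), r / 2 * (1 / ((n : ℝ) + 1)), by positivity, by
      have : 0 < 1 / ((n : ℝ) + 1) := by positivity
      nlinarith⟩
  have hφ : Tendsto (fun n => (φ n).rOut) atTop (𝓝 0) := by
    simpa [φ] using tendsto_one_div_add_atTop_nhds_zero_nat.const_mul (r / 2)
  have hφ2 : ∀ n, (φ n).rOut ≤ 2 * (φ n).rIn := fun n => le_of_eq (by simp only [φ]; ring)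
  have hφr : ∀ n, tsupport ((φ n).normed volume) ⊆ Metric.ball 0 r := fun n => by
    rw [(φ n).tsupport_normed_eq]
    refine Metric.closedBall_subset_ball ?_
    have : 1 / ((n : ℝ) + 1) ≤ 1 := by
      rw [div_le_one (by positivity)]; linarith [Nat.cast_nonneg (α := ℝ) n]
    simp only [φ]
    nlinarith
  have hfi : Integrable f := hf.continuous.integrable_of_hasCompactSupport hfc
  have hder := fun n => fderiv_moll_of_lipschitz hf ((φ n).contDiff_normed (n := ⊤) (μ := volume))
    (φ n).hasCompactSupport_normed
  have hlb : ∀ x v, ‖lineDeriv ℝ f x v‖ ≤ K * ‖v‖ := fun x v => norm_lineDeriv_le_of_lipschitz ℝ hf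
  refine ⟨fun n => moll ((φ n).normed volume) f, fun n => isTestFunction_moll
    (φ n).contDiff_normed (φ n).hasCompactSupport_normed hfi hfc
      fun x hx w hw => hrO x hx w (hφr n hw), fun n x => ?_, fun B hB n x =>
        norm_moll_le hB (φ n).nonneg_normed (φ n).integral_normed x, fun x => ?_, ?_⟩
  · refine ContinuousLinearMap.opNorm_le_bound _ K.2 fun v => ?_
    rw [hder]
    exact norm_moll_le (fun y => hlb y v) (φ n).nonneg_normed (φ n).integral_normed x
  · simp_rw [moll_eq_convolution_left]
    exact ContDiffBump.convolution_tendsto_right_of_continuous hφ hf.continuous x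
  · let b := Module.finBasis ℝ G
    have hae : ∀ᵐ x, ∀ i, Tendsto (fun n => fderiv ℝ (moll ((φ n).normed volume) f) x (b i)) atTop
        (𝓝 (lineDeriv ℝ f x (b i))) := by
      rw [ae_all_iff]
      intro i
      simp_rw [hder, moll_eq_convolution_left]
      refine ContDiffBump.ae_convolution_tendsto_right_of_locallyIntegrable hφ
        (Eventually.of_forall hφ2) ?_
      intro x
      refine ⟨Metric.ball x 1, Metric.ball_mem_nhds _ one_pos, ?_⟩
      exact Measure.integrableOn_of_bounded measure_ball_lt_top.ne
        (stronglyMeasurable_lineDeriv hf.continuous).aestronglyMeasurable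
        (Eventually.of_forall fun y => hlb y (b i))
    -- By Rademacher's theorem the line derivatives along a basis determine the full derivative
    -- almost everywhere.
    filter_upwards [hae, hf.ae_differentiableAt (μ := volume)] with x h1 h2 v
    rw [← b.sum_repr v]
    simp only [map_sum, map_smul]
    refine tendsto_finsetSum _ fun i _ => (h1 i).const_smul _ |>.trans ?_
    rw [h2.lineDeriv_eq_fderiv]

end LipschitzApproximation

/-! ### The cutoff as a function of the distance to the complement. -/

section Cutoff

variable {d : ℕ} {Ω : Set (Space d)} {ε : ℝ}

/-- A nearest point of the complement lies on the frontier, and the frontier of an open set lies in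
its complement. -/
theorem infDist_frontier_eq {S : Set (Space d)} (hS : IsOpen S) (hne : S ≠ univ) {x : Space d}
    (hx : x ∈ S) : Metric.infDist x (frontier S) = Metric.infDist x Sᶜ := by
  obtain ⟨y, hy, hxy⟩ := exists_mem_frontier_infDist_compl_eq_dist hx hne
  have hsub : frontier S ⊆ Sᶜ := fun z hz hzS => by
    rw [hS.frontier_eq] at hz; exact hz.2 hzS
  exact le_antisymm (hxy ▸ Metric.infDist_le_dist_of_mem hy)
    (Metric.infDist_le_infDist_of_subset hsub ⟨y, hy⟩)

theorem innerSet_eq (hΩ : IsOpen Ω) (hne : Ω ≠ univ) (hε : 0 ≤ ε) :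
    innerSet Ω ε = {x | ε < Metric.infDist x Ωᶜ} := by
  ext x
  simp only [innerSet, mem_ofPred_eq]
  constructor
  · rintro ⟨hx, h⟩
    rwa [infDist_frontier_eq hΩ hne hx] at h
  · intro h
    have hx : x ∈ Ω := by
      by_contra hx
      rw [Metric.infDist_zero_of_mem (show x ∈ Ωᶜ from hx)] at h
      linarith
    exact ⟨hx, by rwa [infDist_frontier_eq hΩ hne hx]⟩

theorem infDist_frontier_innerSet (hΩ : IsOpen Ω) (hne : Ω ≠ univ) (hε : 0 < ε) {x : Space d}
    (hx : x ∈ innerSet Ω ε) :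
    Metric.infDist x (frontier (innerSet Ω ε)) = Metric.infDist x Ωᶜ - ε := by
  have hS := innerSet_eq hΩ hne hε.le
  have hSo : IsOpen (innerSet Ω ε) := by
    rw [hS]; exact isOpen_lt continuous_const (Metric.continuous_infDist_pt _)
  have hcne : (Ωᶜ).Nonempty := nonempty_compl.2 hne
  have hSne : innerSet Ω ε ≠ univ := fun h => by
    obtain ⟨y, hy⟩ := hcne
    exact hy (h.symm ▸ mem_univ y : y ∈ innerSet Ω ε).1
  rw [infDist_frontier_eq hSo hSne hx]
  have hx' : ε < Metric.infDist x Ωᶜ := by rw [hS] at hx; exact hx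
  obtain ⟨y, hy, hxy⟩ := hΩ.isClosed_compl.exists_infDist_eq_dist hcne x
  set δ := Metric.infDist x Ωᶜ
  have hδ : 0 < δ := hε.trans hx'
  refine le_antisymm ?_ ?_
  -- On the segment to the nearest point `y` of the complement, the point at distance `ε` from `y`
  -- has left `Ω^ε`. The reverse inequality below is the 1-Lipschitz property of the distance.
  · have hz : AffineMap.lineMap x y (1 - ε / δ) ∈ (innerSet Ω ε)ᶜ := by
      rw [hS]
      simp only [mem_compl_iff, mem_ofPred_eq, not_lt]
      refine (Metric.infDist_le_dist_of_mem hy).trans (le_of_eq ?_)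
      rw [dist_lineMap_right, ← hxy, sub_sub_cancel, Real.norm_of_nonneg (by positivity)]
      field_simp
    refine (Metric.infDist_le_dist_of_mem hz).trans (le_of_eq ?_)
    have : 0 ≤ 1 - ε / δ := by rw [sub_nonneg, div_le_one hδ]; exact hx'.le
    rw [dist_left_lineMap, ← hxy, Real.norm_of_nonneg this]
    field_simp
  · refine (Metric.le_infDist (nonempty_compl.2 hSne)).2 fun z hz => ?_
    rw [hS] at hz
    simp only [mem_compl_iff, mem_ofPred_eq, not_lt] at hz
    have := Metric.infDist_le_infDist_add_dist (s := Ωᶜ) (x := x) (y := z)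
    linarith

/-- The cutoff is a truncated affine function of the distance to the complement. -/
theorem cutoff_eq (hΩ : IsOpen Ω) (hne : Ω ≠ univ) (hε : 0 < ε) :
    cutoff Ω ε = fun x => max 0 (min 1 (ε⁻¹ * Metric.infDist x Ωᶜ - 1)) := by
  ext x
  have hx2 : x ∈ innerSet Ω (2 * ε) ↔ 2 * ε < Metric.infDist x Ωᶜ := by
    rw [innerSet_eq hΩ hne (by positivity)]; rfl
  have hx1 : x ∈ innerSet Ω ε ↔ ε < Metric.infDist x Ωᶜ := by
    rw [innerSet_eq hΩ hne hε.le]; rfl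
  rw [cutoff]
  split_ifs with h2 h1
  · have : 2 ≤ ε⁻¹ * Metric.infDist x Ωᶜ := by
      rw [le_inv_mul_iff₀ hε]; linarith [hx2.1 h2]
    rw [min_eq_left (by linarith), max_eq_right zero_le_one]
  · rw [infDist_frontier_innerSet hΩ hne hε h1, mul_sub, inv_mul_cancel₀ hε.ne']
    have a1 : ε⁻¹ * Metric.infDist x Ωᶜ ≤ 2 := by
      rw [inv_mul_le_iff₀ hε]; linarith [not_lt.1 (hx2.not.1 h2)]
    have a2 : 1 ≤ ε⁻¹ * Metric.infDist x Ωᶜ := by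
      rw [le_inv_mul_iff₀ hε]; linarith [hx1.1 h1]
    rw [min_eq_right (by linarith), max_eq_right (by linarith)]
  · have a1 : ε⁻¹ * Metric.infDist x Ωᶜ ≤ 1 := by
      rw [inv_mul_le_iff₀ hε]; linarith [not_lt.1 (hx1.not.1 h1)]
    rw [max_eq_left ((min_le_right _ _).trans (by linarith))]

theorem cutoff_nonneg (hΩ : IsOpen Ω) (hne : Ω ≠ univ) (hε : 0 < ε) (x : Space d) :
    0 ≤ cutoff Ω ε x := by
  rw [cutoff_eq hΩ hne hε]; exact le_max_left _ _

theorem cutoff_le_one (hΩ : IsOpen Ω) (hne : Ω ≠ univ) (hε : 0 < ε) (x : Space d) :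
    cutoff Ω ε x ≤ 1 := by
  rw [cutoff_eq hΩ hne hε]; exact max_le zero_le_one (min_le_left _ _)

/-- This monotonicity makes the weighted energies converge along the full limit `ε → 0`, so that a
lower limit of the flux suffices. -/
theorem cutoff_anti (hΩ : IsOpen Ω) (hne : Ω ≠ univ) {ε' : ℝ} (hε : 0 < ε) (h : ε ≤ ε')
    (x : Space d) : cutoff Ω ε' x ≤ cutoff Ω ε x := by
  rw [cutoff_eq hΩ hne hε, cutoff_eq hΩ hne (hε.trans_le h)]
  have := mul_le_mul_of_nonneg_right (inv_anti₀ hε h) (Metric.infDist_nonneg (x := x) (s := Ωᶜ))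
  exact max_le_max le_rfl (min_le_min le_rfl (sub_le_sub_right this 1))

theorem lipschitzWith_cutoff (hΩ : IsOpen Ω) (hne : Ω ≠ univ) (hε : 0 < ε) :
    LipschitzWith (Real.toNNReal ε⁻¹) (cutoff Ω ε) := by
  rw [cutoff_eq hΩ hne hε]
  refine LipschitzWith.const_max (LipschitzWith.const_min ?_ 1) 0
  refine LipschitzWith.of_dist_le_mul fun x y => ?_
  rw [Real.dist_eq, Real.coe_toNNReal _ (by positivity), sub_sub_sub_cancel_right, ← mul_sub,
    abs_mul, abs_of_pos (inv_pos.2 hε)]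
  refine mul_le_mul_of_nonneg_left ?_ (by positivity)
  simpa [Real.dist_eq] using (Metric.lipschitz_infDist_pt Ωᶜ).dist_le_mul x y

theorem tsupport_cutoff_subset (hΩ : IsOpen Ω) (hne : Ω ≠ univ) (hε : 0 < ε) :
    tsupport (cutoff Ω ε) ⊆ {x | ε ≤ Metric.infDist x Ωᶜ} := by
  refine closure_minimal (fun x hx => ?_)
    (isClosed_le continuous_const (Metric.continuous_infDist_pt _))
  rw [cutoff_eq hΩ hne hε, Function.mem_support] at hx
  by_contra h
  rw [mem_ofPred_eq, not_le] at h
  refine hx (max_eq_left ((min_le_right _ _).trans ?_))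
  have : ε⁻¹ * Metric.infDist x Ωᶜ ≤ 1 := by
    rw [inv_mul_le_iff₀ hε]; linarith
  linarith

theorem openCompactlyIn_infDist (hb : Bornology.IsBounded Ω) (hε : 0 < ε) :
    OpenCompactlyIn {x | ε < Metric.infDist x Ωᶜ} Ω := by
  have hcl : IsClosed {x : Space d | ε ≤ Metric.infDist x Ωᶜ} :=
    isClosed_le continuous_const (Metric.continuous_infDist_pt _)
  have hsub : {x : Space d | ε ≤ Metric.infDist x Ωᶜ} ⊆ Ω := fun x hx => by
    by_contra h
    have h0 := Metric.infDist_zero_of_mem (show x ∈ Ωᶜ from h)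
    exact absurd (h0 ▸ hx : ε ≤ 0) (not_le.2 hε)
  have hcs : closure {x : Space d | ε < Metric.infDist x Ωᶜ} ⊆ {x | ε ≤ Metric.infDist x Ωᶜ} :=
    closure_minimal (fun x hx => by
      rw [mem_ofPred_eq] at hx ⊢; exact hx.le) hcl
  exact ⟨isOpen_lt continuous_const (Metric.continuous_infDist_pt _),
    (hb.subset (hcs.trans hsub)).isCompact_closure.of_isClosed_subset isClosed_closure
      (closure_mono subset_closure), hcs.trans hsub⟩

theorem hasCompactSupport_cutoff (hΩ : IsOpen Ω) (hne : Ω ≠ univ) (hb : Bornology.IsBounded Ω)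
    (hε : 0 < ε) : HasCompactSupport (cutoff Ω ε) :=
  (openCompactlyIn_infDist hb (half_pos hε)).2.1.of_isClosed_subset (isClosed_tsupport _)
    ((tsupport_cutoff_subset hΩ hne hε).trans fun _ hx =>
      subset_closure (lt_of_lt_of_le (half_lt_self hε) hx))

theorem tendsto_cutoff (hΩ : IsOpen Ω) (hne : Ω ≠ univ) {x : Space d} (hx : x ∈ Ω) :
    ∀ᶠ ε in 𝓝[>] 0, cutoff Ω ε x = 1 := by
  have hδ : 0 < Metric.infDist x Ωᶜ :=
    (hΩ.isClosed_compl.notMem_iff_infDist_pos (nonempty_compl.2 hne)).1 fun h => h hx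
  filter_upwards [Ioo_mem_nhdsGT (half_pos hδ)] with ε hε
  have : 2 ≤ ε⁻¹ * Metric.infDist x Ωᶜ := by
    rw [le_inv_mul_iff₀ hε.1]; linarith [hε.2]
  rw [cutoff_eq hΩ hne hε.1]
  beta_reduce
  rw [min_eq_left (by linarith), max_eq_right zero_le_one]

end Cutoff

/-! ### Distributional primitives on an interval. -/

section Primitive

variable {α β : ℝ}

theorem exists_Ioo_of_isCompact {K : Set ℝ} (hK : IsCompact K) (hαβ : α < β) (h : K ⊆ Ioo α β) :
    ∃ α' β', α < α' ∧ α' < β' ∧ β' < β ∧ K ⊆ Ioo α' β' := by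
  rcases K.eq_empty_or_nonempty with rfl | hne
  · exact ⟨(2 * α + β) / 3, (α + 2 * β) / 3, by linarith, by linarith, by linarith, empty_subset _⟩
  · obtain ⟨m, hm, hm'⟩ := hK.exists_isLeast hne
    obtain ⟨M, hM, hM'⟩ := hK.exists_isGreatest hne
    have h1 := h hm
    have h2 := h hM
    have h3 := hm' hM
    refine ⟨(α + m) / 2, (M + β) / 2, by linarith [h1.1], by linarith [h1.1, h2.2],
      by linarith [h2.2], fun x hx => ⟨?_, ?_⟩⟩
    · linarith [hm' hx, h1.1]
    · linarith [hM' hx, h2.2]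

/-- The primitive from the left endpoint vanishes to the left of the support, and to its right
because the mean is zero. -/
theorem exists_primitive (hαβ : α < β) {h : ℝ → ℝ} (hh : IsTestFunction (Ioo α β) h)
    (h0 : ∫ t, h t = 0) : ∃ θ, IsTestFunction (Ioo α β) θ ∧ deriv θ = h := by
  obtain ⟨α', β', h1, h2, h3, hs⟩ := exists_Ioo_of_isCompact hh.hasCompactSupport.isCompact hαβ
    hh.tsupport_subset
  have hd : ∀ t, HasDerivAt (fun t => ∫ s in α'..t, h s) (h t) t := fun t =>
    (hh.continuous.integral_hasStrictDerivAt α' t).hasDerivAt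
  have hderiv : deriv (fun t => ∫ s in α'..t, h s) = h := funext fun t => (hd t).deriv
  have hsupp : tsupport (fun t => ∫ s in α'..t, h s) ⊆ Icc α' β' := by
    refine closure_minimal (fun t ht => ?_) isClosed_Icc
    by_contra hn
    refine ht ?_
    rcases lt_or_ge t α' with hlt | hge
    · refine intervalIntegral.integral_zero_ae (Eventually.of_forall fun s hs' => ?_)
      rw [uIoc_of_ge hlt.le] at hs'
      exact image_eq_zero_of_notMem_tsupport fun hm => absurd (hs hm).1 (not_lt.2 hs'.2)
    · have hlt : β' < t := lt_of_not_ge fun hle => hn ⟨hge, hle⟩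
      beta_reduce
      rw [intervalIntegral.integral_eq_integral_of_support_subset, h0]
      intro s hs'
      have := hs (subset_tsupport _ hs')
      exact ⟨this.1, (this.2.trans hlt).le⟩
  refine ⟨_, ⟨contDiff_infty_iff_deriv.2 ⟨fun t => (hd t).differentiableAt, ?_⟩,
    isCompact_Icc.of_isClosed_subset (isClosed_tsupport _) hsupp,
    hsupp.trans (Icc_subset_Ioo h1 h3)⟩, hderiv⟩
  rw [hderiv]
  exact hh.smooth

/-- A function with vanishing distributional derivative on an interval is constant. -/
theorem ae_eq_const_of_integral_deriv (hαβ : α < β) {P : ℝ → ℝ} (hP : IntegrableOn P (Ioo α β))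
    (h : ∀ θ, IsTestFunction (Ioo α β) θ → ∫ t in Ioo α β, deriv θ t * P t = 0) :
    ∃ c, ∀ᵐ t, t ∈ Ioo α β → P t = c := by
  let b : ContDiffBump ((α + β) / 2) := ⟨(β - α) / 8, (β - α) / 4, by linarith, by linarith⟩
  set g₀ := b.normed volume with hg₀
  have hg : IsTestFunction (Ioo α β) g₀ := by
    refine ⟨b.contDiff_normed, b.hasCompactSupport_normed, ?_⟩
    rw [hg₀, b.tsupport_normed_eq, Real.closedBall_eq_Icc]
    refine Icc_subset_Ioo ?_ ?_ <;> simp only [b] <;> linarith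
  have hint : ∀ g, IsTestFunction (Ioo α β) g → IntegrableOn (fun t => g t * P t) (Ioo α β) :=
    fun g hg => by
      obtain ⟨C, hC0, hC⟩ := exists_norm_le_of_hasCompactSupport hg.hasCompactSupport hg.continuous
      exact hP.bdd_mul (c := C) hg.continuous.aestronglyMeasurable (Eventually.of_forall hC)
  refine ⟨∫ t in Ioo α β, g₀ t * P t, ?_⟩
  set c := ∫ t in Ioo α β, g₀ t * P t with hc
  have hfin : IntegrableOn (fun _ : ℝ => c) (Ioo α β) := integrableOn_const measure_Ioo_lt_top.ne
  have key := isOpen_Ioo.ae_eq_zero_of_integral_contDiff_smul_eq_zero (μ := volume)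
    (hP.sub hfin).locallyIntegrableOn fun g h1 h2 h3 => by
      have hgt : IsTestFunction (Ioo α β) g := ⟨h1, h2, h3⟩
      have hgi : Integrable g := hgt.continuous.integrable_of_hasCompactSupport h2
      set m := ∫ t, g t with hm
      -- Subtracting `m` times a bump of integral one gives mean zero, hence a derivative of a test
      -- function.
      have ht : IsTestFunction (Ioo α β) fun t => g t + (-m) * g₀ t := hgt.add
        ⟨contDiff_const.mul hg.smooth, hg.hasCompactSupport.mul_left,
          (closure_mono fun x hx => right_ne_zero_of_mul hx).trans hg.tsupport_subset⟩
      obtain ⟨θ, hθ, hθd⟩ := exists_primitive hαβ ht (by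
        rw [integral_add hgi (b.integrable_normed.const_mul _), integral_const_mul,
          b.integral_normed, ← hm]; ring)
      have h0 := h θ hθ
      rw [hθd] at h0
      have e0 : ∫ t in Ioo α β, (g t + -m * g₀ t) * P t
          = (∫ t in Ioo α β, g t * P t) - m * c := by
        rw [hc, ← integral_const_mul, ← integral_sub (hint g hgt) ((hint g₀ hg).const_mul m)]
        exact integral_congr_ae (Eventually.of_forall fun t => by ring)
      rw [e0] at h0
      have hz : ∀ t ∉ Ioo α β, g t = 0 := fun t ht =>
        image_eq_zero_of_notMem_tsupport fun hn => ht (h3 hn)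
      rw [← setIntegral_eq_integral_of_forall_compl_eq_zero (s := Ioo α β)
        fun t ht => by rw [hz t ht, zero_smul]]
      have e1 : ∫ t in Ioo α β, g t = m := by
        rw [hm, setIntegral_eq_integral_of_forall_compl_eq_zero hz]
      rw [← h0, ← e1, ← integral_mul_const, ← integral_sub (hint g hgt)
        (hgi.integrableOn.mul_const c)]
      exact integral_congr_ae (Eventually.of_forall fun t => by
        simp only [Pi.sub_apply, smul_eq_mul]; ring)
  exact key.mono fun t ht hm => sub_eq_zero.1 (ht hm)

/-- A function with integrable distributional derivative is a primitive of it. -/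
theorem ae_eq_primitive (hαβ : α < β) {E F : ℝ → ℝ} (hE : IntegrableOn E (Ioo α β))
    (hF : IntegrableOn F (Ioo α β))
    (h : ∀ θ, IsTestFunction (Ioo α β) θ →
      ∫ t in Ioo α β, (deriv θ t * E t + θ t * F t) = 0) :
    ∃ c, ∀ᵐ t, t ∈ Ioo α β → E t = c + ∫ s in α..t, F s := by
  have hFi : IntervalIntegrable F volume α β :=
    (intervalIntegrable_iff_integrableOn_Ioo_of_le hαβ.le).2 hF
  set G : ℝ → ℝ := fun t => ∫ s in α..t, F s with hG
  have hGac := hFi.absolutelyContinuousOnInterval_intervalIntegral (left_mem_uIcc (b := β))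
  have hGi : IntegrableOn G (Ioo α β) :=
    ((uIcc_of_le hαβ.le ▸ hGac.continuousOn).integrableOn_Icc).mono_set Ioo_subset_Icc_self
  have hbdd : ∀ g : ℝ → ℝ, Continuous g → HasCompactSupport g → ∀ Q, IntegrableOn Q (Ioo α β) →
      IntegrableOn (fun t => g t * Q t) (Ioo α β) := fun g hg hgc Q hQ => by
    obtain ⟨C, hC0, hC⟩ := exists_norm_le_of_hasCompactSupport hgc hg
    exact hQ.bdd_mul (c := C) hg.aestronglyMeasurable (Eventually.of_forall hC)
  obtain ⟨c, hc⟩ := ae_eq_const_of_integral_deriv hαβ (hE.sub hGi) fun θ hθ => by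
    have hz : ∀ t ∉ Ioo α β, θ t = 0 := fun t ht =>
      image_eq_zero_of_notMem_tsupport fun hn => ht (hθ.tsupport_subset hn)
    have hθ1 : ContDiff ℝ 1 θ := hθ.smooth.of_le (by exact_mod_cast le_top)
    have hd : Continuous (deriv θ) := hθ1.continuous_deriv le_rfl
    have hdc : HasCompactSupport (deriv θ) := hθ.hasCompactSupport.deriv
    have h1 := hbdd _ hd hdc _ hE
    have h2 := hbdd _ hd hdc _ hGi
    have h3 := hbdd _ hθ.continuous hθ.hasCompactSupport _ hF
    -- Integration by parts for absolutely continuous functions, with vanishing boundary terms,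
    -- shows that `E - G` has zero distributional derivative.
    have ibp := hθ1.contDiffOn.absolutelyContinuousOnInterval (a := α) (b := β)
      |>.integral_mul_deriv_eq_deriv_mul hGac
    rw [hz α (by simp), hz β (by simp), zero_mul, zero_mul, sub_zero, zero_sub,
      intervalIntegral.integral_of_le hαβ.le, intervalIntegral.integral_of_le hαβ.le,
      integral_Ioc_eq_integral_Ioo, integral_Ioc_eq_integral_Ioo] at ibp
    have e : ∫ t in Ioo α β, θ t * deriv G t = ∫ t in Ioo α β, θ t * F t := by
      refine setIntegral_congr_ae measurableSet_Ioo ?_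
      filter_upwards [hFi.ae_hasDerivAt_integral] with t ht htI
      rw [(ht (Ioo_subset_Icc_self.trans Icc_subset_uIcc htI) α left_mem_uIcc).deriv]
    have h0 := h θ hθ
    rw [integral_add h1 h3, ← e, ibp, ← sub_eq_add_neg, ← integral_sub h1 h2] at h0
    refine Eq.trans (integral_congr_ae (Eventually.of_forall fun t => ?_)) h0
    simp only [Pi.sub_apply]
    ring
  exact ⟨c, hc.mono fun t ht hm => by rw [← ht hm]; simp [hG]⟩

/-- For continuous functions the exceptional set is open and null, hence empty. -/
theorem le_of_ae_le {f g : ℝ → ℝ} (hf : ContinuousOn f (Ioo α β)) (hg : ContinuousOn g (Ioo α β))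
    (h : ∀ᵐ t, t ∈ Ioo α β → f t ≤ g t) {t : ℝ} (ht : t ∈ Ioo α β) : f t ≤ g t := by
  by_contra hn
  have ho : IsOpen (Ioo α β ∩ {t | g t < f t}) := by
    have := (hf.sub hg).isOpen_inter_preimage isOpen_Ioo (isOpen_Ioi (a := (0 : ℝ)))
    convert this using 2
    ext s
    simp
  have hz : volume (Ioo α β ∩ {t | g t < f t}) = 0 :=
    measure_mono_null (fun s hs => by
      rw [mem_compl_iff, mem_ofPred_eq]
      exact fun hs' => not_lt.2 (hs' hs.1) hs.2) (mem_ae_iff.1 h)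
  exact ((ho.measure_eq_zero_iff volume).1 hz).subset ⟨ht, not_le.1 hn⟩

end Primitive

/-! ### Product test functions. -/

section TensorTest

variable {d : ℕ} {O : Set (Space d)} {I : Set ℝ} {c : Space d → ℝ} {θ : ℝ → ℝ}

theorem IsTestFunction.tensor (hc : IsTestFunction O c) (hθ : IsTestFunction I θ) :
    IsTestFunction (O ×ˢ I) fun z : Space d × ℝ => c z.1 * θ z.2 := by
  have hs : tsupport (fun z : Space d × ℝ => c z.1 * θ z.2) ⊆ tsupport c ×ˢ tsupport θ :=
    closure_minimal (fun z hz => ⟨subset_tsupport _ (left_ne_zero_of_mul hz),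
      subset_tsupport _ (right_ne_zero_of_mul hz)⟩)
      ((isClosed_tsupport _).prod (isClosed_tsupport _))
  exact ⟨(hc.smooth.comp contDiff_fst).mul (hθ.smooth.comp contDiff_snd),
    (hc.hasCompactSupport.isCompact.prod hθ.hasCompactSupport.isCompact).of_isClosed_subset
      (isClosed_tsupport _) hs, hs.trans (prod_mono hc.tsupport_subset hθ.tsupport_subset)⟩

theorem fderiv_tensor (hc : Differentiable ℝ c) (hθ : Differentiable ℝ θ) (z : Space d × ℝ)
    (v : Space d) (s : ℝ) : fderiv ℝ (fun z : Space d × ℝ => c z.1 * θ z.2) z (v, s)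
      = s * (c z.1 * deriv θ z.2) + θ z.2 * fderiv ℝ c z.1 v := by
  have h1 : HasFDerivAt (fun z : Space d × ℝ => c z.1) _ z :=
    (hc z.1).hasFDerivAt.comp z hasFDerivAt_fst
  have h2 : HasFDerivAt (fun z : Space d × ℝ => θ z.2) _ z :=
    (hθ z.2).hasFDerivAt.comp z hasFDerivAt_snd
  rw [(h1.fun_mul h2).fderiv]
  have h3 : fderiv ℝ θ z.2 s = s * deriv θ z.2 := by
    rw [← fderiv_apply_one_eq_deriv, ← smul_eq_mul, ← map_smul, smul_eq_mul, mul_one]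
  simp [h3]
  ring

end TensorTest

/-! ### The energy balance with a Lipschitz weight. -/

section CutoffBalance

variable {d : ℕ} {Ω O : Set (Space d)} {T a b : ℝ} {u : Space d → ℝ → Space d}
  {p : Space d → ℝ → ℝ} {f : Space d → ℝ} {K : ℝ≥0}

/-- The energy balance tested with a Lipschitz function of space. -/
theorem energy_balance_lipschitz (hΩ : IsOpen Ω) (hEuler : IsWeakEulerSolution Ω T u p)
    (ha : 0 < a) (hb : b < T) (hO : OpenCompactlyIn O Ω) (hu : MemL1BV u O (Ioo a b))
    (hu_Linfty : MemLp (fun z : Space d × ℝ => u z.1 z.2) ∞ (volume.restrict (O ×ˢ Ioo a b)))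
    (hp_L1 : MemLp (fun z : Space d × ℝ => p z.1 z.2) 1 (volume.restrict (O ×ˢ Ioo a b)))
    (hf : LipschitzWith K f) (hfc : HasCompactSupport f) (hfO : tsupport f ⊆ O) :
    IntegrableOn (fun t => ∫ x in Ω, ‖u x t‖ ^ 2 / 2 * f x) (Ioo a b) ∧
    IntegrableOn (fun t => ∫ x in Ω, (‖u x t‖ ^ 2 / 2 + p x t) *
      inner ℝ (u x t) (gradient f x)) (Ioo a b) ∧
    ∀ θ, IsTestFunction (Ioo a b) θ → ∫ t in Ioo a b,
      (deriv θ t * (∫ x in Ω, ‖u x t‖ ^ 2 / 2 * f x)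
        + θ t * ∫ x in Ω, (‖u x t‖ ^ 2 / 2 + p x t) * inner ℝ (u x t) (gradient f x)) = 0 := by
  set μ : Measure (Space d × ℝ) := volume.restrict (O ×ˢ Ioo a b) with hμ
  have hμp : μ = (volume.restrict O).prod (volume.restrict (Ioo a b)) := by
    rw [hμ, Measure.volume_eq_prod, Measure.prod_restrict]
  set w : Space d × ℝ → Space d := fun z => u z.1 z.2 with hw
  have hfin : IsFiniteMeasure μ := ⟨by
    rw [hμ, Measure.restrict_apply_univ, Measure.volume_eq_prod, Measure.prod_prod]
    exact ENNReal.mul_lt_top ((measure_mono subset_closure).trans_lt hO.2.1.measure_lt_top)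
      measure_Ioo_lt_top⟩
  set L := (eLpNorm w ∞ μ).toReal with hL
  have hwL : ∀ᵐ z ∂μ, ‖w z‖ ≤ L := by
    filter_upwards [ae_le_eLpNormEssSup (f := w) (μ := μ)] with z hz
    rw [← eLpNorm_exponent_top] at hz
    have := ENNReal.toReal_mono hu_Linfty.2.ne hz
    rwa [toReal_enorm] at this
  have hL0 : 0 ≤ L := ENNReal.toReal_nonneg
  have hwm : AEStronglyMeasurable w μ := hu_Linfty.1
  have hpi : Integrable (fun z : Space d × ℝ => p z.1 z.2) μ := memLp_one_iff_integrable.1 hp_L1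
  obtain ⟨B, hB0, hB⟩ := exists_norm_le_of_hasCompactSupport hfc hf.continuous
  have hkin : AEStronglyMeasurable (fun z : Space d × ℝ => ‖u z.1 z.2‖ ^ 2 / 2) μ := by
    simp_rw [div_eq_mul_inv]
    exact (hwm.norm.pow 2).mul aestronglyMeasurable_const
  have hkinL : ∀ᵐ z ∂μ, ‖‖u z.1 z.2‖ ^ 2 / 2‖ ≤ L ^ 2 / 2 := hwL.mono fun z hz => by
    rw [Real.norm_of_nonneg (by positivity)]
    have := pow_le_pow_left₀ (norm_nonneg _) hz 2
    simp only [hw] at this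
    linarith
  have hkini : Integrable (fun z : Space d × ℝ => ‖u z.1 z.2‖ ^ 2 / 2) μ :=
    Integrable.of_bound hkin _ hkinL
  set e : Space d × ℝ → ℝ := fun z => ‖u z.1 z.2‖ ^ 2 / 2 * f z.1 with he
  set k : Space d × ℝ → ℝ := fun z =>
    (‖u z.1 z.2‖ ^ 2 / 2 + p z.1 z.2) * inner ℝ (u z.1 z.2) (gradient f z.1) with hk
  have hDm : ∀ g : Space d → ℝ, AEStronglyMeasurable
      (fun z : Space d × ℝ => fderiv ℝ g z.1 (w z)) μ := fun g =>
    aestronglyMeasurable_clm_apply ((measurable_fderiv ℝ g).comp measurable_fst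
      |>.aestronglyMeasurable) hwm
  have hDb : ∀ g : Space d → ℝ, (∀ x, ‖fderiv ℝ g x‖ ≤ K) →
      ∀ᵐ z ∂μ, ‖fderiv ℝ g z.1 (w z)‖ ≤ K * L := fun g hg => hwL.mono fun z hz =>
    (ContinuousLinearMap.le_opNorm _ _).trans (mul_le_mul (hg _) hz (norm_nonneg _) K.2)
  have hgrad : ∀ z : Space d × ℝ, inner ℝ (u z.1 z.2) (gradient f z.1) = fderiv ℝ f z.1 (w z) :=
    fun z => by rw [inner_gradient_right, conj_trivial]
  have hfK : ∀ x, ‖fderiv ℝ f x‖ ≤ K := fun x => norm_fderiv_le_of_lipschitz ℝ hf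
  have hei : Integrable e μ := hkini.mul_bdd (c := B)
    (hf.continuous.comp continuous_fst).aestronglyMeasurable (Eventually.of_forall fun z => hB z.1)
  have hki : Integrable k μ := by
    simp only [hk, hgrad]
    exact (hkini.add hpi).mul_bdd (c := K * L) (hDm f) (hDb f hfK)
  have hslice : ∀ (g : Space d → ℝ → ℝ), (∀ x ∉ O, ∀ t, g x t = 0) → ∀ t,
      ∫ x in Ω, g x t = ∫ x in O, g x t := fun g hg t => by
    rw [setIntegral_eq_of_subset_of_forall_sdiff_eq_zero hΩ.measurableSet
      (subset_closure.trans hO.2.2) fun x hx => hg x hx.2 t]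
  have hf0 : ∀ x ∉ O, f x = 0 := fun x hx =>
    image_eq_zero_of_notMem_tsupport fun hn => hx (hfO hn)
  have hg0 : ∀ x ∉ O, gradient f x = 0 := fun x hx => by
    have : fderiv ℝ f x = 0 := image_eq_zero_of_notMem_tsupport fun hn =>
      hx (hfO (tsupport_fderiv_subset ℝ hn))
    rw [gradient, this, map_zero]
  have hE : ∀ t, ∫ x in Ω, ‖u x t‖ ^ 2 / 2 * f x = ∫ x in O, e (x, t) :=
    hslice (fun x t => ‖u x t‖ ^ 2 / 2 * f x) fun x hx t => by rw [hf0 x hx, mul_zero]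
  have hF : ∀ t, ∫ x in Ω, (‖u x t‖ ^ 2 / 2 + p x t) * inner ℝ (u x t) (gradient f x)
      = ∫ x in O, k (x, t) :=
    hslice (fun x t => (‖u x t‖ ^ 2 / 2 + p x t) * inner ℝ (u x t) (gradient f x))
      fun x hx t => by rw [hg0 x hx, inner_zero_right, mul_zero]
  have hei' : Integrable e ((volume.restrict O).prod (volume.restrict (Ioo a b))) := hμp ▸ hei
  have hki' : Integrable k ((volume.restrict O).prod (volume.restrict (Ioo a b))) := hμp ▸ hki
  simp_rw [hE, hF]
  refine ⟨hei'.integral_prod_right, hki'.integral_prod_right, fun θ hθ => ?_⟩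
  have hθ1 : ContDiff ℝ 1 θ := hθ.smooth.of_le (by exact_mod_cast le_top)
  have hθd : Continuous (deriv θ) := hθ1.continuous_deriv le_rfl
  obtain ⟨A, hA0, hA⟩ := exists_norm_le_of_hasCompactSupport hθ.hasCompactSupport hθ.continuous
  obtain ⟨D, hD0, hD⟩ := exists_norm_le_of_hasCompactSupport hθ.hasCompactSupport.deriv hθd
  have i1 : Integrable (fun z : Space d × ℝ => deriv θ z.2 * e z) μ := hei.bdd_mul (c := D)
    (hθd.comp continuous_snd).aestronglyMeasurable (Eventually.of_forall fun z => hD z.2)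
  have i2 : Integrable (fun z : Space d × ℝ => θ z.2 * k z) μ := hki.bdd_mul (c := A)
    (hθ.continuous.comp continuous_snd).aestronglyMeasurable (Eventually.of_forall fun z => hA z.2)
  have hFub : ∫ z, (deriv θ z.2 * e z + θ z.2 * k z) ∂μ = ∫ t in Ioo a b,
      (deriv θ t * (∫ x in O, e (x, t)) + θ t * ∫ x in O, k (x, t)) := by
    have i3 := i1.add i2
    rw [hμp] at i3
    rw [hμp]
    refine (integral_prod_symm _ i3).trans (integral_congr_ae ?_)
    filter_upwards [hei'.prod_left_ae, hki'.prod_left_ae] with t h1 h2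
    simp only [Pi.add_apply]
    rw [integral_add (h1.const_mul _) (h2.const_mul _), integral_const_mul, integral_const_mul]
  rw [← hFub]
  -- The balance holds for the smooth approximations times `θ`; their uniform bounds and almost
  -- everywhere convergence of gradients permit dominated convergence.
  obtain ⟨c, hcT, hcK, hcB, hclim, hcD⟩ := exists_smooth_approx hf hfc hO.1 hfO
  have hzero : ∀ n, ∫ z, (‖u z.1 z.2‖ ^ 2 / 2 * (c n z.1 * deriv θ z.2) +
      (‖u z.1 z.2‖ ^ 2 / 2 + p z.1 z.2) * (θ z.2 * fderiv ℝ (c n) z.1 (w z))) ∂μ = 0 := fun n => by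
    refine Eq.trans (integral_congr_ae (Eventually.of_forall fun z => ?_)) (local_energy_balance hΩ
      hEuler ha hb hO hu hu_Linfty hp_L1 ((hcT n).tensor hθ))
    simp only [fderiv_tensor (hcT n).differentiable hθ.differentiable, map_zero, mul_zero, zero_mul,
      one_mul, add_zero, zero_add, hw]
  have hDz : ∀ᵐ z ∂μ, ∀ v, Tendsto (fun n => fderiv ℝ (c n) z.1 v) atTop
      (𝓝 (fderiv ℝ f z.1 v)) := by
    rw [hμp]
    exact Measure.quasiMeasurePreserving_fst.ae (ae_restrict_of_ae hcD)
  have hlim := tendsto_integral_of_dominated_convergence (μ := μ)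
    (F := fun n z => ‖u z.1 z.2‖ ^ 2 / 2 * (c n z.1 * deriv θ z.2) +
      (‖u z.1 z.2‖ ^ 2 / 2 + p z.1 z.2) * (θ z.2 * fderiv ℝ (c n) z.1 (w z)))
    (f := fun z => deriv θ z.2 * e z + θ z.2 * k z)
    (fun z => ‖‖u z.1 z.2‖ ^ 2 / 2‖ * (B * D)
      + ‖‖u z.1 z.2‖ ^ 2 / 2 + p z.1 z.2‖ * (A * (K * L)))
    (fun n => (hkin.mul (((hcT n).continuous.comp continuous_fst).mul
        (hθd.comp continuous_snd)).aestronglyMeasurable).add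
      ((hkin.add hpi.1).mul ((hθ.continuous.comp continuous_snd).aestronglyMeasurable.mul
        (hDm (c n)))))
    ((hkini.norm.mul_const _).add ((hkini.add hpi).norm.mul_const _))
    (fun n => by
      filter_upwards [hDb (c n) (hcK n)] with z hz
      refine (norm_add_le _ _).trans (add_le_add ?_ ?_)
      · rw [norm_mul, norm_mul]
        exact mul_le_mul_of_nonneg_left (mul_le_mul (hcB B hB n _) (hD _) (norm_nonneg _) hB0)
          (norm_nonneg _)
      · rw [norm_mul, norm_mul]
        exact mul_le_mul_of_nonneg_left (mul_le_mul (hA _) hz (norm_nonneg _) hA0)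
          (norm_nonneg _))
    (by
      filter_upwards [hDz] with z hz
      have h1 := ((hclim z.1).mul_const (deriv θ z.2)).const_mul (‖u z.1 z.2‖ ^ 2 / 2)
      have h2 := ((hz (w z)).const_mul (θ z.2)).const_mul (‖u z.1 z.2‖ ^ 2 / 2 + p z.1 z.2)
      convert h1.add h2 using 2
      simp only [he, hk, hgrad]
      ring)
  simp_rw [hzero] at hlim
  exact tendsto_nhds_unique hlim tendsto_const_nhds

end CutoffBalance

/-! ### Conservation of the kinetic energy. -/

section Conservation

variable {d : ℕ} {Ω : Set (Space d)} {T α β : ℝ} {u : Space d → ℝ → Space d}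
  {p : Space d → ℝ → ℝ}

/-- The kinetic energy weighted with the cutoff. -/
noncomputable def localEnergy (Ω : Set (Space d)) (u : Space d → ℝ → Space d) (ε t : ℝ) : ℝ :=
  ∫ x in Ω, ‖u x t‖ ^ 2 / 2 * cutoff Ω ε x

theorem kineticEnergy_eq (t : ℝ) : kineticEnergy Ω u t = ∫ x in Ω, ‖u x t‖ ^ 2 / 2 := by
  rw [kineticEnergy, ← integral_const_mul]
  exact integral_congr_ae (Eventually.of_forall fun x => by ring)

section Fixed

variable {ε t : ℝ}

theorem integrable_mul_cutoff (hΩ : IsOpen Ω) (hne : Ω ≠ univ)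
    (hu : IntegrableOn (fun x => ‖u x t‖ ^ 2) Ω) (hε : 0 < ε) :
    IntegrableOn (fun x => ‖u x t‖ ^ 2 / 2 * cutoff Ω ε x) Ω :=
  (hu.div_const 2).mul_bdd (c := 1)
    (lipschitzWith_cutoff hΩ hne hε).continuous.aestronglyMeasurable
    (Eventually.of_forall fun x => by
      rw [Real.norm_of_nonneg (cutoff_nonneg hΩ hne hε x)]; exact cutoff_le_one hΩ hne hε x)

theorem localEnergy_anti (hΩ : IsOpen Ω) (hne : Ω ≠ univ)
    (hu : IntegrableOn (fun x => ‖u x t‖ ^ 2) Ω) {ε' : ℝ} (hε : 0 < ε) (h : ε ≤ ε') :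
    localEnergy Ω u ε' t ≤ localEnergy Ω u ε t :=
  integral_mono (integrable_mul_cutoff hΩ hne hu (hε.trans_le h))
    (integrable_mul_cutoff hΩ hne hu hε)
    fun x => mul_le_mul_of_nonneg_left (cutoff_anti hΩ hne hε h x) (by positivity)

theorem localEnergy_le (hΩ : IsOpen Ω) (hne : Ω ≠ univ)
    (hu : IntegrableOn (fun x => ‖u x t‖ ^ 2) Ω) (hε : 0 < ε) :
    localEnergy Ω u ε t ≤ kineticEnergy Ω u t := by
  rw [kineticEnergy_eq]
  exact integral_mono (integrable_mul_cutoff hΩ hne hu hε) (hu.div_const 2)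
    fun x => mul_le_of_le_one_right (by positivity) (cutoff_le_one hΩ hne hε x)

theorem tendsto_localEnergy (hΩ : IsOpen Ω) (hne : Ω ≠ univ)
    (hu : IntegrableOn (fun x => ‖u x t‖ ^ 2) Ω) :
    Tendsto (fun ε => localEnergy Ω u ε t) (𝓝[>] 0) (𝓝 (kineticEnergy Ω u t)) := by
  rw [kineticEnergy_eq]
  refine tendsto_integral_filter_of_dominated_convergence (fun x => ‖u x t‖ ^ 2 / 2) ?_ ?_
    (hu.div_const 2) ?_
  · exact eventually_mem_nhdsWithin.mono fun ε hε => (integrable_mul_cutoff hΩ hne hu hε).1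
  · refine eventually_mem_nhdsWithin.mono fun ε hε => Eventually.of_forall fun x => ?_
    rw [Real.norm_of_nonneg (mul_nonneg (by positivity) (cutoff_nonneg hΩ hne hε x))]
    exact mul_le_of_le_one_right (by positivity) (cutoff_le_one hΩ hne hε x)
  · refine (ae_restrict_mem hΩ.measurableSet).mono fun x hx => ?_
    refine tendsto_const_nhds.congr' ((tendsto_cutoff hΩ hne hx).mono fun ε h => ?_)
    beta_reduce
    rw [h, mul_one]

end Fixed

/-- If the local energies are primitives of fluxes whose integrals become small along some sequence
`ε → 0`, then the energy is constant. -/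
theorem ae_eq_kineticEnergy (hΩ : IsOpen Ω) (hne : Ω ≠ univ) (hαβ : α < β)
    (hu : ∀ᵐ t, t ∈ Ioo α β → IntegrableOn (fun x => ‖u x t‖ ^ 2) Ω)
    {F : ℝ → ℝ → ℝ} (hF : ∀ ε > 0, IntegrableOn (F ε) (Ioo α β))
    (hE : ∀ ε > 0, ∃ c, ∀ᵐ t, t ∈ Ioo α β → localEnergy Ω u ε t = c + ∫ s in α..t, F ε s)
    (hflux : ∀ a ∈ Ioo α β, ∀ b ∈ Ioo α β, a < b →
      liminf (fun ε => ENNReal.ofReal |∫ t in Ioo a b, F ε t|) (𝓝[>] 0) = 0) :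
    ∃ c, ∀ᵐ t, t ∈ Ioo α β → kineticEnergy Ω u t = c := by
  choose! c hc using hE
  set R : ℝ → ℝ → ℝ := fun ε t => c ε + ∫ s in α..t, F ε s with hR
  have hFi : ∀ ε > 0, IntervalIntegrable (F ε) volume α β := fun ε hε =>
    (intervalIntegrable_iff_integrableOn_Ioo_of_le hαβ.le).2 (hF ε hε)
  have hRc : ∀ ε > 0, ContinuousOn (R ε) (Ioo α β) := fun ε hε =>
    continuousOn_const.add ((intervalIntegral.continuousOn_primitive_interval' (hFi ε hε)
      left_mem_uIcc).mono (Ioo_subset_Icc_self.trans Icc_subset_uIcc))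
  -- The exceptional null set depends on the pair `ε`, `ε'`; continuity in time of the
  -- representatives `R` removes it, giving monotonicity at every time for all `ε`.
  have hmono : ∀ ε ε', 0 < ε → ε ≤ ε' → ∀ t ∈ Ioo α β, R ε' t ≤ R ε t := fun ε ε' hε h t ht => by
    refine le_of_ae_le (hRc ε' (hε.trans_le h)) (hRc ε hε) ?_ ht
    filter_upwards [hc ε hε, hc ε' (hε.trans_le h), hu] with s h1 h2 h3 hs
    rw [hR]
    beta_reduce
    rw [← h1 hs, ← h2 hs]
    exact localEnergy_anti hΩ hne (h3 hs) hε h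
  have hseq : ∀ n : ℕ, (0 : ℝ) < 1 / ((n : ℝ) + 1) := fun n => by positivity
  have hlim0 : Tendsto (fun n : ℕ => 1 / ((n : ℝ) + 1)) atTop (𝓝[>] 0) :=
    tendsto_nhdsWithin_iff.2 ⟨tendsto_one_div_add_atTop_nhds_zero_nat, Eventually.of_forall hseq⟩
  -- Only the countable sequence `1 / (n + 1)` is compared with the local energies, so a single null
  -- set of times is discarded; monotonicity of `R` then gives convergence over all real `ε`.
  have hgood : ∀ᵐ t, t ∈ Ioo α β →
      Tendsto (fun ε => R ε t) (𝓝[>] 0) (𝓝 (kineticEnergy Ω u t)) := by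
    filter_upwards [ae_all_iff.2 fun n => hc _ (hseq n), hu] with t h1 h2 ht
    have hle : ∀ n : ℕ, R (1 / ((n : ℝ) + 1)) t ≤ kineticEnergy Ω u t := fun n => by
      rw [hR]
      beta_reduce
      rw [← h1 n ht]
      exact localEnergy_le hΩ hne (h2 ht) (hseq n)
    have hten : Tendsto (fun n : ℕ => R (1 / ((n : ℝ) + 1)) t) atTop
        (𝓝 (kineticEnergy Ω u t)) :=
      ((tendsto_localEnergy hΩ hne (h2 ht)).comp hlim0).congr fun n => h1 n ht
    refine tendsto_order.2 ⟨fun y hy => ?_, fun y hy => ?_⟩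
    · obtain ⟨n, hn⟩ := (hten.eventually (lt_mem_nhds hy)).exists
      filter_upwards [Ioo_mem_nhdsGT (hseq n)] with ε hε
      exact hn.trans_le (hmono _ _ hε.1 hε.2.le t ht)
    · refine eventually_mem_nhdsWithin.mono fun ε hε => ?_
      obtain ⟨n, hn⟩ := exists_nat_one_div_lt (show (0 : ℝ) < ε from hε)
      exact ((hmono _ _ (hseq n) hn.le t ht).trans (hle n)).trans_lt hy
  -- At good endpoints the time-integrated flux has a true limit, the energy difference, which must
  -- therefore coincide with its vanishing lower limit.
  have hkey : ∀ a ∈ Ioo α β, ∀ b ∈ Ioo α β, a < b →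
      Tendsto (fun ε => R ε a) (𝓝[>] 0) (𝓝 (kineticEnergy Ω u a)) →
      Tendsto (fun ε => R ε b) (𝓝[>] 0) (𝓝 (kineticEnergy Ω u b)) →
      kineticEnergy Ω u a = kineticEnergy Ω u b := fun a ha b hb hab h1 h2 => by
    have h3 : Tendsto (fun ε => ENNReal.ofReal |∫ t in Ioo a b, F ε t|) (𝓝[>] 0)
        (𝓝 (ENNReal.ofReal |kineticEnergy Ω u b - kineticEnergy Ω u a|)) := by
      refine ENNReal.tendsto_ofReal ((h2.sub h1).abs.congr' ?_)
      refine eventually_mem_nhdsWithin.mono fun ε hε => ?_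
      have hi : ∀ t ∈ Ioo α β, IntervalIntegrable (F ε) volume α t := fun t ht =>
        (hFi ε hε).mono_set (uIcc_subset_uIcc left_mem_uIcc
          (Icc_subset_uIcc (Ioo_subset_Icc_self ht)))
      rw [hR]
      beta_reduce
      rw [add_sub_add_left_eq_sub, intervalIntegral.integral_interval_sub_left (hi b hb) (hi a ha),
        intervalIntegral.integral_of_le hab.le, integral_Ioc_eq_integral_Ioo]
    have h4 := h3.liminf_eq.symm.trans (hflux a ha b hb hab)
    rw [ENNReal.ofReal_eq_zero, abs_nonpos_iff, sub_eq_zero] at h4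
    exact h4.symm
  obtain ⟨t₀, ht₀, h0⟩ : ∃ t₀ ∈ Ioo α β,
      Tendsto (fun ε => R ε t₀) (𝓝[>] 0) (𝓝 (kineticEnergy Ω u t₀)) := by
    by_contra! hcon
    have hz : volume (Ioo α β) = 0 := measure_mono_null (fun t ht => by
      rw [mem_compl_iff, mem_ofPred_eq]
      exact fun h => hcon t ht (h ht)) (mem_ae_iff.1 hgood)
    rw [Real.volume_Ioo, ENNReal.ofReal_eq_zero] at hz
    linarith
  refine ⟨kineticEnergy Ω u t₀, hgood.mono fun t h ht => ?_⟩
  rcases lt_trichotomy t t₀ with hlt | rfl | hlt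
  · exact hkey t ht t₀ ht₀ hlt (h ht) h0
  · rfl
  · exact (hkey t₀ ht₀ t ht hlt h0 (h ht)).symm

/-- The support of a test function lies in one compactly contained interval, where the energy is
constant and the derivative has zero integral. -/
theorem kineticEnergyConserved_of_const
    (h : ∀ α β, 0 < α → α < β → β < T → ∃ c, ∀ᵐ t, t ∈ Ioo α β → kineticEnergy Ω u t = c)
    (hT : 0 < T) : KineticEnergyConserved Ω T u := fun φ hφ => by
  obtain ⟨α, β, hα, hαβ, hβ, hs⟩ := exists_Ioo_of_isCompact hφ.hasCompactSupport.isCompact hT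
    hφ.tsupport_subset
  obtain ⟨c, hc⟩ := h α β hα hαβ hβ
  have hd : ∀ t ∉ Ioo α β, deriv φ t = 0 := fun t ht =>
    image_eq_zero_of_notMem_tsupport fun hn => ht (hs (tsupport_deriv_subset hn))
  have hφ1 : ContDiff ℝ 1 φ := hφ.smooth.of_le (by exact_mod_cast le_top)
  rw [setIntegral_eq_of_subset_of_forall_sdiff_eq_zero measurableSet_Ioo
    (Ioo_subset_Ioo hα.le hβ.le) fun t ht => by rw [hd t ht.2, mul_zero]]
  rw [setIntegral_congr_ae measurableSet_Ioo (hc.mono fun t h ht => by rw [h ht]),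
    integral_const_mul, setIntegral_eq_integral_of_forall_compl_eq_zero hd,
    integral_eq_zero_of_hasDerivAt_of_integrable
      (fun t => (hφ.differentiable t).hasDerivAt)
      ((hφ1.continuous_deriv le_rfl).integrable_of_hasCompactSupport hφ.hasCompactSupport.deriv)
      (hφ.continuous.integrable_of_hasCompactSupport hφ.hasCompactSupport), mul_zero]

end Conservation

end EulerBounded

/-! ### The conservation theorem. -/

theorem mainTheorem6 {d : ℕ} (Ω : Set (EulerBounded.Space d))
    (hΩ : EulerBounded.IsBoundedLipschitz Ω) (T : ℝ) (hT : 0 < T)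
    (u : EulerBounded.Space d → ℝ → EulerBounded.Space d)
    (p : EulerBounded.Space d → ℝ → ℝ)
    (hu_L2 : MemLp (fun z : EulerBounded.Space d × ℝ => u z.1 z.2) 2
      (volume.restrict (Ω ×ˢ Ioo 0 T)))
    (hEuler : EulerBounded.IsWeakEulerSolution Ω T u p)
    (hu_BV : ∀ a b : ℝ, 0 < a → a < b → b < T →
      ∀ O : Set (EulerBounded.Space d), EulerBounded.OpenCompactlyIn O Ω →
        EulerBounded.MemL1BV u O (Ioo a b))
    (hu_Linfty : ∀ a b : ℝ, 0 < a → a < b → b < T →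
      ∀ O : Set (EulerBounded.Space d), EulerBounded.OpenCompactlyIn O Ω →
        MemLp (fun z : EulerBounded.Space d × ℝ => u z.1 z.2) ∞
          (volume.restrict (O ×ˢ Ioo a b)))
    (hp_L1 : ∀ a b : ℝ, 0 < a → a < b → b < T →
      ∀ O : Set (EulerBounded.Space d), EulerBounded.OpenCompactlyIn O Ω →
        MemLp (fun z : EulerBounded.Space d × ℝ => p z.1 z.2) 1
          (volume.restrict (O ×ˢ Ioo a b)))
    (hflux : ∀ a b : ℝ, 0 < a → a < b → b < T →
      liminf (fun ε : ℝ =>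
        ENNReal.ofReal |EulerBounded.boundaryFlux Ω (Ioo a b) u p ε|) (𝓝[>] 0) = 0) :
    EulerBounded.KineticEnergyConserved Ω T u := by
  refine EulerBounded.kineticEnergyConserved_of_const (fun α β hα hαβ hβ => ?_) hT
  -- In dimension zero a bounded `Ω` may be the whole space, but then the velocity vanishes; in
  -- positive dimension boundedness makes the complement nonempty, which the distance formulas need.
  rcases Nat.eq_zero_or_pos d with rfl | hd
  · refine ⟨0, Eventually.of_forall fun t _ => ?_⟩
    have h0 : ∀ x, u x t = 0 := fun x => Subsingleton.elim _ _
    simp [EulerBounded.kineticEnergy, h0]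
  have hdim : Nonempty (Fin d) := ⟨⟨0, hd⟩⟩
  have hne : Ω ≠ univ := fun h => by
    have hb := hΩ.isBounded
    rw [h] at hb
    exact NormedSpace.noncompactSpace ℝ (EulerBounded.Space d) |>.noncompact_univ
      (Metric.isCompact_of_isClosed_isBounded isClosed_univ hb)
  have hsq : ∀ᵐ t, t ∈ Ioo α β → IntegrableOn (fun x => ‖u x t‖ ^ 2) Ω := by
    have h1 := (memLp_two_iff_integrable_sq_norm hu_L2.1).1 hu_L2
    rw [Measure.volume_eq_prod, ← Measure.prod_restrict] at h1
    filter_upwards [(ae_restrict_iff' measurableSet_Ioo).1 h1.prod_left_ae] with t ht htI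
    exact ht (Ioo_subset_Ioo hα.le hβ.le htI)
  have hbal := fun (ε : ℝ) (hε : 0 < ε) =>
    -- The set where the distance exceeds `ε / 2` is compactly contained in `Ω` and contains the
    -- support of the cutoff, where the distance is at least `ε`.
    have hO := EulerBounded.openCompactlyIn_infDist hΩ.isBounded (half_pos hε)
    EulerBounded.energy_balance_lipschitz hΩ.isOpen hEuler hα hβ hO (hu_BV α β hα hαβ hβ _ hO)
      (hu_Linfty α β hα hαβ hβ _ hO) (hp_L1 α β hα hαβ hβ _ hO)
      (EulerBounded.lipschitzWith_cutoff hΩ.isOpen hne hε)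
      (EulerBounded.hasCompactSupport_cutoff hΩ.isOpen hne hΩ.isBounded hε)
      ((EulerBounded.tsupport_cutoff_subset hΩ.isOpen hne hε).trans
        fun x hx => lt_of_lt_of_le (half_lt_self hε) hx)
  exact EulerBounded.ae_eq_kineticEnergy hΩ.isOpen hne hαβ hsq (fun ε hε => (hbal ε hε).2.1)
    (fun ε hε => EulerBounded.ae_eq_primitive hαβ (hbal ε hε).1 (hbal ε hε).2.1 (hbal ε hε).2.2)
    fun a ha b hb hab => hflux a b (hα.trans ha.1) hab (hb.2.trans hβ)
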